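/- Let $L$ be a $\mathbb{Z}$-Lie algebra whose underlying abelian group is free of rank $3$. For a Lie subalgebra $\Lambda\le L$ of finite index write $L/\Lambda\cong\bigoplus_{i=1}^{3}\mathbb{Z}/\alpha_i\mathbb{Z}$ (as abelian groups) with positive integers $\alpha_3\mid\alpha_2\mid\alpha_1$; the corank of $\Lambda$ is the largest $i$ with $\alpha_i\neq 1$ (and $0$ if $\Lambda=L$). For $1\le m\le 3$ let $$\zeta^{(m)}_L(s)=\sum_{\Lambda}[L:\Lambda]^{-s},$$ the sum being over all Lie subalgebras $\Lambda\le L$ of finite index and of corank at most $m$. Then the three functions $\zeta^{(1)}_L,\zeta^{(2)}_L,\zeta^{(3)}_L$ have their largest pole at the same point and of the same order. That is, there are a real number $\sigma$ and an integer $k\ge 1$, depending only on $L$, such that for every $m\in\{1,2,3\}$ the series $\zeta^{(m)}_L(s)$ converges absolutely for $\operatorname{Re}(s)>\sigma$ and, for some $\delta>0$, continues to a meromorphic function on $\operatorname{Re}(s)>\sigma-\delta$ which has a pole of order exactly $k$ at $s=\sigma$ and no other pole with $\operatorname{Re}(s)\ge\sigma$. -/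

import Mathlib

/-- `IsCotype Λ α`: the finite quotient group `L / Λ` is isomorphic to `⨁ i, ℤ / α i`, where
`α 0, …, α (d - 1)` are positive integers with `α j ∣ α i` for `i ≤ j`
(largest elementary divisor first; entry `i` of `α` is the `(i + 1)`-st cotype invariant). -/
def IsCotype {L : Type*} [LieRing L] {d : ℕ} (Λ : LieSubalgebra ℤ L) (α : Fin d → ℕ) : Prop :=
  (∀ i, 0 < α i) ∧ (∀ i j, i ≤ j → α j ∣ α i) ∧
    Nonempty ((L ⧸ Λ.toSubmodule) ≃+ ((i : Fin d) → ZMod (α i)))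

/-- The corank belonging to a cotype: the largest position (counted from `1`) whose entry
differs from `1`, and `0` if all entries are `1`. -/
def corankOfCotype {d : ℕ} (α : Fin d → ℕ) : ℕ :=
  Finset.univ.sup fun i : Fin d => if α i = 1 then 0 else (i : ℕ) + 1

/-- `Λ` has finite index in `L` and corank at most `m`. The cotype has as many entries as the rank
of `L`. -/
def HasCorankLE {L : Type*} [LieRing L] (Λ : LieSubalgebra ℤ L) (m : ℕ) : Prop :=
  ∃ α : Fin (Module.finrank ℤ L) → ℕ, IsCotype Λ α ∧ corankOfCotype α ≤ m

/-- The number of Lie subalgebras of `L` of index `n` and corank at most `m`. -/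
noncomputable def subalgebraCount (L : Type*) [LieRing L] (m n : ℕ) : ℕ :=
  Set.ncard {Λ : LieSubalgebra ℤ L | Λ.toSubmodule.toAddSubgroup.index = n ∧ HasCorankLE Λ m}

/-- The coefficient sequence of the corank-at-most-`m` zeta function of `L`,
the Dirichlet series `∑ [L : Λ] ^ (-s)` over the finite-index Lie subalgebras `Λ` of corank at
most `m`, grouped by the index. The zeta function itself is `LSeries (corankZetaCoeff L m)`. -/
noncomputable def corankZetaCoeff (L : Type*) [LieRing L] (m : ℕ) : ℕ → ℂ :=
  fun n => (subalgebraCount L m n : ℂ)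

/-- The Dirichlet series `∑ c n / n ^ s` has its largest pole at the real point `σ`, of order `k`:
it converges absolutely for `re s > σ`, it has a meromorphic continuation to a half-plane
`re s > σ - δ` with `δ > 0`, and there `σ` is a pole of order exactly `k ≥ 1` and the only pole
with real part at least `σ`. -/
def HasLargestPole (c : ℕ → ℂ) (σ : ℝ) (k : ℕ) : Prop :=
  1 ≤ k ∧ (∀ s : ℂ, σ < s.re → LSeriesSummable c s) ∧
    ∃ δ : ℝ, 0 < δ ∧ ∃ F : ℂ → ℂ,
      MeromorphicOn F {s : ℂ | σ - δ < s.re} ∧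
      (∀ s : ℂ, σ < s.re → F s = LSeries c s) ∧
      (∀ s : ℂ, σ ≤ s.re → s ≠ (σ : ℂ) → AnalyticAt ℂ F s) ∧
      meromorphicOrderAt F (σ : ℂ) = ((-(k : ℤ) : ℤ) : WithTop ℤ)

/-! Sublattices of `L` with cyclic quotient of order `n` are the kernels of surjections `φ : L →
ℤ/n`, with `φ` determined up to a unit. The expression `φ x * φ ⁅y, z⁆ + φ y * φ ⁅z, x⁆ + φ z * φ
⁅x, y⁆` is alternating in three arguments from a lattice of rank 3, so it is the determinant times a
scalar `Q(φ)`, where `Q` is an integral ternary quadratic form. If `φ z = 1` and `x`, `y` lie in the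
kernel, it equals `φ ⁅x, y⁆`. Hence the kernel is a subalgebra exactly if `Q(φ) = 0`
(`modKer_closed_iff`): the subalgebras of index `n` and corank at most 1 are the projective zeros of
`Q` modulo `n`.

Larger corank does not affect the leading pole. By elementary divisors, a subalgebra of index `p ^
n` has the form `p ^ c (ℤ w + p ^ d K)` with `n = a + 2 d + 3 c`, where `K` is the kernel of a `φ`
modulo `p ^ a` with `p ^ c Q(φ) = 0` (`exists_mem_smithClass`). So index `p` allows no noncyclic
quotient, index `p ^ 2` allows at most `2 p ^ 2` subalgebras outside the cyclic ones, and for every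
`n` all coranks together obey a common bound. The data that decide the pole are therefore the same
for all `m`.

If `Q` vanishes identically, there are `p ^ 2 + p + 1` subalgebras of index `p`, and the pole is
that of `ζ(s - 2)`: simple, at 3. Otherwise the count at `p ^ n` is `O((n + 1) ^ 2 p ^ (3 n / 2))`,
the pole is at 2, and its order depends on the rank of `Q` over `ℚ`. For all large `p`: rank 3 gives
`p + 1` subalgebras of index `p` and only `O(p ^ 2)` of index `p ^ 2`, so the model is `ζ(s - 1)`;
rank 2, with diagonal entries `a`, `b`, gives `p + 1 + p χ(p)` with `χ` the Jacobi character of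
`-ab`, so the model is `ζ(s - 1) L(s - 1, χ)`, with `ζ` in place of `L` if `χ` is trivial; rank 1
gives `p + 1` at `p` but `p ^ 3 + O(p ^ 2)` at `p ^ 2`, so the model is `ζ(s - 1) ζ(2 s - 3)`, with
a double pole.

The counts are multiplicative (`subalgebraCount_mul`). Divided by the Euler factor of the model, the
local factor at `p` is `1 + O(p ^ (-9/8))` uniformly on a half-plane reaching `1/16` to the left of
the pole (`norm_eulerFactor_sub_one_le`). The product of these quotients is holomorphic there and
nonzero at the pole, so location and order are those of the model (`hasLargestPole_of_localFactor`).
-/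

/-! ### Euler products compared with a meromorphic model -/

section

open Filter Topology

/-- The `p`-part of the Dirichlet series with coefficients `c`. -/
noncomputable def localFactor (c : ℕ → ℕ) (p : ℕ) (s : ℂ) : ℂ :=
  ∑' e : ℕ, LSeries.term (fun n => (c n : ℂ)) s (p ^ e)

theorem localFactor_summable_norm {c : ℕ → ℕ} {p : ℕ} {x : ℝ}
    (h : Summable fun e : ℕ => ‖LSeries.term (fun n => (c n : ℂ)) (x : ℂ) (p ^ e)‖) {s : ℂ}
    (hs : x ≤ s.re) : Summable fun e : ℕ => ‖LSeries.term (fun n => (c n : ℂ)) s (p ^ e)‖ :=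
  h.of_nonneg_of_le (fun _ => norm_nonneg _) fun e =>
    LSeries.norm_term_le_of_re_le_re _ (by simpa using hs) _

theorem differentiable_term (f : ℕ → ℂ) (n : ℕ) : Differentiable ℂ fun s => LSeries.term f s n := by
  rcases eq_or_ne n 0 with rfl | hn
  · simp
  · have : NeZero n := ⟨hn⟩
    have h : (fun s => LSeries.term f s n) = fun s => f n / (n : ℂ) ^ s := by
      funext s; exact LSeries.term_of_ne_zero hn f s
    rw [h]
    intro s
    refine (differentiableAt_const _).div ?_ ?_
    · exact (differentiableAt_id).const_cpow (Or.inl (by exact_mod_cast hn))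
    · simp [Complex.cpow_eq_zero_iff, hn]

theorem localFactor_differentiableOn {c : ℕ → ℕ} {p : ℕ} {x : ℝ}
    (h : Summable fun e : ℕ => ‖LSeries.term (fun n => (c n : ℂ)) (x : ℂ) (p ^ e)‖) :
    DifferentiableOn ℂ (localFactor c p) {s : ℂ | x < s.re} := by
  refine Complex.differentiableOn_tsum_of_summable_norm h (fun e => (differentiable_term _ _).differentiableOn)
    (isOpen_lt continuous_const Complex.continuous_re) fun e s hs =>
    LSeries.norm_term_le_of_re_le_re _ (by simpa using le_of_lt hs) _

theorem term_ofReal_eq (c : ℕ → ℕ) (x : ℝ) (n : ℕ) :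
    LSeries.term (fun n => (c n : ℂ)) (x : ℂ) n = ((‖LSeries.term (fun n => (c n : ℂ)) (x : ℂ) n‖ : ℝ) : ℂ) := by
  rw [LSeries.norm_term_eq, LSeries.term]
  split_ifs
  · simp
  · simp [Complex.ofReal_cpow (Nat.cast_nonneg n)]

theorem localFactor_ofReal (c : ℕ → ℕ) (p : ℕ) (x : ℝ) :
    localFactor c p x = ((∑' e : ℕ, ‖LSeries.term (fun n => (c n : ℂ)) (x : ℂ) (p ^ e)‖ : ℝ) : ℂ) := by
  rw [localFactor, Complex.ofReal_tsum]
  exact tsum_congr fun e => term_ofReal_eq c x _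

/-- At a real point all terms are nonnegative and the term `e = 0` is 1, so the sum is at least 1.
-/
theorem localFactor_ofReal_ne_zero {c : ℕ → ℕ} (h1 : c 1 = 1) {p : ℕ} {x : ℝ}
    (h : Summable fun e : ℕ => ‖LSeries.term (fun n => (c n : ℂ)) (x : ℂ) (p ^ e)‖) :
    localFactor c p x ≠ 0 := by
  rw [localFactor_ofReal]
  have h0 := h.le_tsum 0 (fun _ _ => norm_nonneg _)
  have : ‖LSeries.term (fun n => (c n : ℂ)) (x : ℂ) (p ^ 0)‖ = 1 := by
    rw [LSeries.norm_term_eq]; simp [h1]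
  rw [this] at h0
  exact_mod_cast (lt_of_lt_of_le one_pos h0).ne'

section Euler

variable {c : ℕ → ℕ}

theorem term_mul_of_coprime (hmul : ∀ m n : ℕ, m.Coprime n → c (m * n) = c m * c n) (s : ℂ)
    {m n : ℕ} (h : m.Coprime n) :
    LSeries.term (fun n => (c n : ℂ)) s (m * n) =
      LSeries.term (fun n => (c n : ℂ)) s m * LSeries.term (fun n => (c n : ℂ)) s n := by
  rcases eq_or_ne m 0 with rfl | hm
  · simp
  rcases eq_or_ne n 0 with rfl | hn
  · simp
  rw [LSeries.term_of_ne_zero (mul_ne_zero hm hn), LSeries.term_of_ne_zero hm,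
    LSeries.term_of_ne_zero hn, hmul m n h]
  push_cast
  rw [Complex.natCast_mul_natCast_cpow, mul_div_mul_comm]

/-- With nonnegative terms, the partial sum up to `N` is at most the sum over `N`-smooth numbers,
which is the finite Euler product over the primes below `N`. -/
theorem lseriesSummable_of_localFactor_bounded (h1 : c 1 = 1)
    (hmul : ∀ m n : ℕ, m.Coprime n → c (m * n) = c m * c n) {x : ℝ}
    (hloc : ∀ p : ℕ, p.Prime →
      Summable fun e : ℕ => ‖LSeries.term (fun n => (c n : ℂ)) (x : ℂ) (p ^ e)‖)
    {B : ℝ} (hB : ∀ N : ℕ, ‖∏ p ∈ N.primesBelow, localFactor c p x‖ ≤ B) :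
    LSeriesSummable (fun n => (c n : ℂ)) x := by
  set f : ℕ → ℝ := fun n => ‖LSeries.term (fun n => (c n : ℂ)) (x : ℂ) n‖ with hf
  have hf1 : f 1 = 1 := by simp [hf, LSeries.norm_term_eq, h1]
  have hfm : ∀ {m n : ℕ}, m.Coprime n → f (m * n) = f m * f n := fun h => by
    simp only [hf]; rw [term_mul_of_coprime hmul _ h, norm_mul]
  refine Summable.of_norm (f := LSeries.term (fun n => (c n : ℂ)) (x : ℂ)) ?_
  refine summable_of_sum_range_le (c := B) (fun n => norm_nonneg _) fun N => ?_
  obtain ⟨h2, h3⟩ := EulerProduct.summable_and_hasSum_smoothNumbers_prod_primesBelow_tsum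
    hf1 hfm (fun {p} hp => by simpa [hf] using hloc p hp) N
  have h4 : ∏ p ∈ N.primesBelow, ∑' n : ℕ, f (p ^ n) ≤ B := by
    refine le_trans (le_of_eq ?_) (hB N)
    rw [norm_prod]
    refine Finset.prod_congr rfl fun p _ => ?_
    rw [localFactor_ofReal, Complex.norm_real, Real.norm_of_nonneg (tsum_nonneg fun _ => norm_nonneg _)]
  refine le_trans ?_ (h3.tsum_eq.le.trans h4)
  have h5 : Summable fun m : N.smoothNumbers => f m := h3.summable
  have h6 := h5.sum_le_tsum ((Finset.range N).subtype (· ∈ N.smoothNumbers)) (fun _ _ => norm_nonneg _)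
  refine le_trans (le_of_eq ?_) h6
  rw [Finset.sum_subtype_eq_sum_filter (f := f)]
  refine (Finset.sum_filter_of_ne fun n hn hne => ?_).symm
  refine Nat.mem_smoothNumbers_of_lt (Nat.pos_of_ne_zero ?_) (Finset.mem_range.mp hn)
  rintro rfl
  simp at hne

theorem localFactor_hasProd (h1 : c 1 = 1) (hmul : ∀ m n : ℕ, m.Coprime n → c (m * n) = c m * c n)
    {s : ℂ} (h : LSeriesSummable (fun n => (c n : ℂ)) s) :
    HasProd (fun p : Nat.Primes => localFactor c p s) (LSeries (fun n => (c n : ℂ)) s) := by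
  refine EulerProduct.eulerProduct_hasProd (f := LSeries.term (fun n => (c n : ℂ)) s)
    (by simp [LSeries.term, h1]) (fun h => term_mul_of_coprime hmul s h) h.norm (by simp)

theorem tendsto_primesBelow_of_hasProd {f : ℕ → ℂ} {a : ℂ}
    (h : HasProd (fun p : Nat.Primes => f p) a) :
    Tendsto (fun N : ℕ => ∏ p ∈ N.primesBelow, f p) atTop (𝓝 a) := by
  have h' : HasProd (Set.mulIndicator {p | Nat.Prime p} f) a := by
    rw [← hasProd_subtype_iff_mulIndicator]; exact h
  have H (n : ℕ) : ∏ i ∈ Finset.range n, Set.mulIndicator {p | Nat.Prime p} f i =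
      ∏ p ∈ n.primesBelow, f p :=
    Finset.prod_mulIndicator_eq_prod_filter (Finset.range n) (fun _ ↦ f)
      (fun _ ↦ {p | Nat.Prime p}) id
  simpa only [H] using h'.tendsto_prod_nat

/-- If the local factors of an Euler product agree with the inverses `P p` of the local factors of
a meromorphic function `G` up to a convergent product, then the Euler product inherits the largest
pole of `G`. -/
theorem hasLargestPole_of_localFactor (h1 : c 1 = 1)
    (hmul : ∀ m n : ℕ, m.Coprime n → c (m * n) = c m * c n)
    {σ δ : ℝ} {k : ℕ} (hk : 1 ≤ k) (hδ : 0 < δ) {G : ℂ → ℂ} {P : ℕ → ℂ → ℂ}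
    (hP : ∀ p : ℕ, p.Prime → Differentiable ℂ (P p)) (hPσ : ∀ p : ℕ, p.Prime → P p σ ≠ 0)
    (hPG : ∀ s : ℂ, σ < s.re → HasProd (fun p : Nat.Primes => P p s) (G s)⁻¹)
    (hG0 : ∀ s : ℂ, σ < s.re → G s ≠ 0)
    (hGm : MeromorphicOn G {s : ℂ | σ - δ < s.re})
    (hGa : ∀ s : ℂ, σ ≤ s.re → s ≠ (σ : ℂ) → AnalyticAt ℂ G s)
    (hGo : meromorphicOrderAt G (σ : ℂ) = ((-(k : ℤ) : ℤ) : WithTop ℤ))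
    (hloc : ∀ p : ℕ, p.Prime →
      Summable fun e : ℕ => ‖LSeries.term (fun n => (c n : ℂ)) ((σ - δ : ℝ) : ℂ) (p ^ e)‖)
    {u : Nat.Primes → ℝ} (hu : Summable u)
    (hPu : ∀ (p : Nat.Primes) (s : ℂ), σ - δ < s.re → ‖P p s * localFactor c p s - 1‖ ≤ u p) :
    HasLargestPole (fun n => (c n : ℂ)) σ k := by
  set U : Set ℂ := {s : ℂ | σ - δ < s.re} with hU
  have hUo : IsOpen U := isOpen_lt continuous_const Complex.continuous_re
  have hσU : (σ : ℂ) ∈ U := by simp [hU, hδ]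
  set g : Nat.Primes → ℂ → ℂ := fun p s => P p s * localFactor c p s - 1 with hg
  have hgd : ∀ p, DifferentiableOn ℂ (g p) U := fun p =>
    ((hP p p.2).differentiableOn.mul (localFactor_differentiableOn (hloc p p.2))).sub_const 1
  have hprod := Summable.hasProdLocallyUniformlyOn_one_add hUo hu (Eventually.of_forall hPu)
    fun p => (hgd p).continuousOn
  set H : ℂ → ℂ := fun s => ∏' p, (1 + g p s) with hH
  have hHd : DifferentiableOn ℂ H U := by
    refine hprod.differentiableOn (Eventually.of_forall fun t => ?_) hUo
    refine DifferentiableOn.fun_finsetProd fun p _ => (hgd p).const_add 1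
  have hHa : ∀ s ∈ U, AnalyticAt ℂ H s := fun s hs => hHd.analyticAt (hUo.mem_nhds hs)
  have hHP : ∀ s ∈ U, HasProd (fun p : Nat.Primes => P p s * localFactor c p s) (H s) := fun s hs => by
    have := hprod.hasProd hs
    simpa [hg] using this
  -- Nonvanishing is needed at `σ` alone, to preserve the order there; elsewhere on `re s ≥ σ` zeros
  -- of `H` are harmless.
  have hHσ : H σ ≠ 0 := by
    refine tprod_one_add_ne_zero_of_summable (fun p => ?_) ?_
    · have := mul_ne_zero (hPσ p p.2) (localFactor_ofReal_ne_zero h1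
        (localFactor_summable_norm (hloc p p.2) (s := (σ : ℂ)) (by simp [hδ.le])))
      simpa [hg] using this
    · exact hu.of_nonneg_of_le (fun _ => norm_nonneg _) fun p => hPu p _ hσU
  have hlocs : ∀ (p : ℕ), p.Prime → ∀ x : ℝ, σ < x →
      Summable fun e : ℕ => ‖LSeries.term (fun n => (c n : ℂ)) (x : ℂ) (p ^ e)‖ := fun p hp x hx =>
    localFactor_summable_norm (hloc p hp) (by simp; linarith)
  -- Dividing partial products yields convergence of the Euler product before absolute convergence
  -- of the series is known; the latter is then deduced from it at real points.
  have hlim : ∀ s : ℂ, σ < s.re →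
      Tendsto (fun N : ℕ => ∏ p ∈ N.primesBelow, localFactor c p s) atTop (𝓝 (H s * G s)) := by
    intro s hs
    have hsU : s ∈ U := by simp only [hU, Set.mem_ofPred_eq]; linarith
    have e1 := tendsto_primesBelow_of_hasProd (f := fun p => P p s * localFactor c p s) (hHP s hsU)
    have e2 := tendsto_primesBelow_of_hasProd (f := fun p => P p s) (hPG s hs)
    have e3 := e1.div e2 (inv_ne_zero (hG0 s hs))
    rw [div_inv_eq_mul] at e3
    refine e3.congr' ?_
    filter_upwards [e2.eventually_ne (inv_ne_zero (hG0 s hs))] with N hN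
    simp only [Pi.div_apply, Finset.prod_mul_distrib]
    rw [mul_div_cancel_left₀ _ hN]
  have hsum : ∀ s : ℂ, σ < s.re → LSeriesSummable (fun n => (c n : ℂ)) s := by
    intro s hs
    have hb := (hlim (s.re : ℂ) (by simpa using hs)).norm.bddAbove_range
    obtain ⟨B, hB⟩ := hb
    refine LSeriesSummable.of_re_le_re (s := (s.re : ℂ)) (by simp) ?_
    exact lseriesSummable_of_localFactor_bounded h1 hmul (fun p hp => hlocs p hp _ hs) (B := B)
      fun N => hB ⟨N, rfl⟩
  refine ⟨hk, hsum, δ, hδ, fun s => H s * G s, ?_, ?_, ?_, ?_⟩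
  · exact fun s hs => (hHa s hs).meromorphicAt.mul (hGm s hs)
  · intro s hs
    exact tendsto_nhds_unique (hlim s hs) (tendsto_primesBelow_of_hasProd
      (f := fun p => localFactor c p s) (localFactor_hasProd h1 hmul (hsum s hs)))
  · intro s hs hne
    exact (hHa s (by simp only [hU, Set.mem_ofPred_eq]; linarith)).mul (hGa s hs hne)
  · have := meromorphicOrderAt_mul_of_ne_zero (f := G) (hHa σ hσU) hHσ
    rw [← hGo, ← this]
    rfl

end Euler

end

/-! ### Model Euler products: 1, the zeta function, Dirichlet L-functions -/

section

open Filter Topology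

/-- `G` is a meromorphic function with Euler factors `(1 - α p * p ^ (-s))⁻¹`, whose only possible
pole with real part at least `1` is at `1`, where it has a pole of order `k` (no pole or zero if
`k = 0`). -/
structure IsEulerModel (α : ℕ → ℂ) (G : ℂ → ℂ) (k : ℕ) : Prop where
  norm_le : ∀ p : ℕ, ‖α p‖ ≤ 1
  hasProd : ∀ s : ℂ, 1 < s.re →
    HasProd (fun p : Nat.Primes => 1 - α p * (p : ℂ) ^ (-s)) (G s)⁻¹
  ne_zero : ∀ s : ℂ, 1 < s.re → G s ≠ 0
  meromorphicAt : ∀ s, MeromorphicAt G s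
  analyticAt : ∀ s : ℂ, 1 ≤ s.re → s ≠ 1 → AnalyticAt ℂ G s
  order : meromorphicOrderAt G 1 = ((-(k : ℤ) : ℤ) : WithTop ℤ)

theorem HasProd.inv_of_ne_zero {ι : Type*} {f : ι → ℂ} {a : ℂ} (h : HasProd f a) (ha : a ≠ 0) :
    HasProd (fun i => (f i)⁻¹) a⁻¹ := by
  have := Tendsto.inv₀ h ha
  refine this.congr fun s => ?_
  simp

theorem isEulerModel_one : IsEulerModel (fun _ => 0) (fun _ => 1) 0 where
  norm_le := by simp
  hasProd s _ := by simp
  ne_zero := by simp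
  meromorphicAt s := by fun_prop
  analyticAt s _ _ := analyticAt_const
  order := by
    rw [(analyticAt_const).meromorphicOrderAt_eq]
    rw [((analyticAt_const (𝕜 := ℂ) (v := (1 : ℂ)) (x := (1 : ℂ))).analyticOrderAt_eq_zero).mpr (by simp)]
    simp

theorem riemannZeta_meromorphicAt_order :
    MeromorphicAt riemannZeta 1 ∧ meromorphicOrderAt riemannZeta 1 = ((-1 : ℤ) : WithTop ℤ) := by
  -- The value 1 at `s = 1` is the residue, so the update removes the singularity and `g` is entire
  -- with `g 1 ≠ 0`.
  set g : ℂ → ℂ := Function.update (fun s => (s - 1) * riemannZeta s) 1 1 with hg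
  have hgd : Differentiable ℂ g := by
    rw [← differentiableOn_univ, ← Complex.differentiableOn_compl_singleton_and_continuousAt_iff (c := (1 : ℂ)) univ_mem]
    constructor
    · have : DifferentiableOn ℂ (fun s => (s - 1) * riemannZeta s) (Set.univ \ {1}) := by
        refine DifferentiableOn.mul (by fun_prop) ?_
        intro s hs
        exact (differentiableAt_riemannZeta hs.2).differentiableWithinAt
      refine this.congr fun s hs => ?_
      simp [hg, Function.update_of_ne (show s ≠ 1 from hs.2)]
    · rw [hg, continuousAt_update_same]
      exact riemannZeta_residue_one
  have hga : AnalyticAt ℂ g 1 := hgd.analyticAt 1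
  have hev : ∀ᶠ s in 𝓝[≠] (1 : ℂ), riemannZeta s = (s - 1) ^ (-1 : ℤ) • g s := by
    filter_upwards [self_mem_nhdsWithin] with s hs
    have hs' : s - 1 ≠ 0 := sub_ne_zero.mpr hs
    simp [hg, Function.update_of_ne (show s ≠ 1 from hs), hs']
  have hm : MeromorphicAt riemannZeta 1 := by
    have : MeromorphicAt (fun s : ℂ => (s - 1) ^ (-1 : ℤ) • g s) 1 := by
      exact MeromorphicAt.smul (f := fun s : ℂ => (s - 1) ^ (-1 : ℤ)) (by fun_prop)
        hga.meromorphicAt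
    exact this.congr (hev.mono fun _ h => h.symm)
  exact ⟨hm, (meromorphicOrderAt_eq_int_iff hm).mpr ⟨g, hga, by simp [hg], hev⟩⟩

theorem isEulerModel_riemannZeta : IsEulerModel (fun _ => 1) riemannZeta 1 where
  norm_le := by simp
  ne_zero s hs := riemannZeta_ne_zero_of_one_le_re hs.le
  hasProd s hs := by
    simpa using (riemannZeta_eulerProduct_hasProd hs).inv_of_ne_zero
      (riemannZeta_ne_zero_of_one_le_re hs.le)
  meromorphicAt s := by
    rcases eq_or_ne s 1 with rfl | hs
    · exact riemannZeta_meromorphicAt_order.1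
    · exact (differentiableOn_riemannZeta.analyticAt
        (isOpen_compl_singleton.mem_nhds hs)).meromorphicAt
  analyticAt s _ hs := differentiableOn_riemannZeta.analyticAt (isOpen_compl_singleton.mem_nhds hs)
  order := by simpa using riemannZeta_meromorphicAt_order.2

theorem isEulerModel_LFunction {N : ℕ} [NeZero N] {χ : DirichletCharacter ℂ N} (hχ : χ ≠ 1) :
    IsEulerModel (fun n => χ n) (DirichletCharacter.LFunction χ) 0 where
  norm_le p := DirichletCharacter.norm_le_one χ _
  ne_zero s hs := DirichletCharacter.LFunction_ne_zero_of_one_le_re χ (Or.inl hχ) hs.le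
  hasProd s hs := by
    have := DirichletCharacter.LSeries_eulerProduct_hasProd χ hs
    rw [← DirichletCharacter.LFunction_eq_LSeries χ hs] at this
    simpa using this.inv_of_ne_zero
      (DirichletCharacter.LFunction_ne_zero_of_one_le_re χ (Or.inl hχ) hs.le)
  meromorphicAt s := ((DirichletCharacter.differentiable_LFunction hχ).analyticAt s).meromorphicAt
  analyticAt s _ _ := (DirichletCharacter.differentiable_LFunction hχ).analyticAt s
  order := by
    have ha := (DirichletCharacter.differentiable_LFunction hχ).analyticAt 1
    rw [ha.meromorphicOrderAt_eq,
      ha.analyticOrderAt_eq_zero.mpr (DirichletCharacter.LFunction_apply_one_ne_zero hχ)]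
    simp

namespace IsEulerModel

variable {α : ℕ → ℂ} {G : ℂ → ℂ} {k : ℕ}

theorem meromorphicAt_comp (h : IsEulerModel α G k) (σ : ℝ) (m s : ℂ) :
    MeromorphicAt (fun s => G (1 + m * (s - σ))) s :=
  (h.meromorphicAt _).comp_analyticAt (f := G) (g := fun s => 1 + m * (s - σ)) (by fun_prop)

/-- The substitution has nonzero derivative `m` and sends `σ` to 1. It is used with `m = 1` for
factors in `p ^ (-s)` and `m = 2` for those in `p ^ (-2 s)`, placing both poles at the same `σ`. -/
theorem order_comp (h : IsEulerModel α G k) (σ : ℝ) (m : ℂ) (hm : m ≠ 0) :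
    meromorphicOrderAt (fun s => G (1 + m * (s - σ))) (σ : ℂ) = ((-(k : ℤ) : ℤ) : WithTop ℤ) := by
  have := meromorphicOrderAt_comp_of_deriv_ne_zero (f := G) (g := fun s : ℂ => 1 + m * (s - σ))
    (x := (σ : ℂ)) (by fun_prop) (by simpa [deriv_const_mul] using hm)
  rw [← h.order]
  simpa [Function.comp_def] using this

end IsEulerModel

end

/-! ### The estimate for one Euler factor -/

section

open Filter Topology

theorem summable_sq_mul_geometric {ρ : ℝ} (h0 : 0 ≤ ρ) (h1 : ρ < 1) :
    Summable fun n : ℕ => ((n : ℝ) + 1) ^ 2 * ρ ^ n := by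
  have h : ‖ρ‖ < 1 := by rwa [Real.norm_of_nonneg h0]
  have h2 := summable_pow_mul_geometric_of_norm_lt_one (R := ℝ) 2 h
  have h1 := summable_pow_mul_geometric_of_norm_lt_one (R := ℝ) 1 h
  have h0 := summable_pow_mul_geometric_of_norm_lt_one (R := ℝ) 0 h
  refine ((h2.add (h1.mul_left 2)).add h0).congr fun n => ?_
  ring

/-- Main estimate for a single Euler factor, with `z = p ^ (-w)` and `p = r ^ 16`. -/
theorem norm_eulerFactor_sub_one_le {b : ℕ → ℝ} {α β z : ℂ} {r C ρ : ℝ} (hC : 0 ≤ C)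
    (hr : 1 ≤ r) (hρ : r⁻¹ ^ 7 ≤ ρ) (hρ1 : ρ < 1) (hα : ‖α‖ ≤ 1) (hβ : ‖β‖ ≤ 1) (hz : ‖z‖ ≤ r)
    (hb0 : b 0 = 1)
    (hb1 : ‖(b 1 : ℂ) - (1 + α) * (r : ℂ)⁻¹ ^ 16‖ ≤ C * r⁻¹ ^ 20)
    (hb2 : ‖(b 2 : ℂ) - β * (r : ℂ)⁻¹ ^ 16‖ ≤ C * r⁻¹ ^ 20)
    (hb : ∀ n, |b n| ≤ C * (n + 1) ^ 2 * (r⁻¹ ^ 8) ^ n) :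
    ‖(1 - (r : ℂ)⁻¹ ^ 16 * z) * (1 - α * ((r : ℂ)⁻¹ ^ 16 * z)) *
        (1 - β * ((r : ℂ)⁻¹ ^ 16 * z ^ 2)) * ∑' n, (b n : ℂ) * z ^ n - 1‖ ≤
      (19 + 8 * (2 * C + C * ∑' n : ℕ, ((n + 3 : ℕ) + 1 : ℝ) ^ 2 * ρ ^ n)) * r⁻¹ ^ 18 := by
  have hr0 : 0 < r := by linarith
  set t : ℝ := r⁻¹ with ht
  have ht0 : 0 < t := inv_pos.mpr hr0
  have ht1 : t ≤ 1 := inv_le_one_of_one_le₀ hr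
  have hrt : r * t = 1 := mul_inv_cancel₀ hr0.ne'
  have hρ0 : 0 ≤ ρ := le_trans (by positivity) hρ
  have htc : (r : ℂ)⁻¹ = (t : ℂ) := by simp [ht]
  rw [htc] at hb1 hb2 ⊢
  have htn : ‖(t : ℂ)‖ = t := by simp [abs_of_pos ht0]
  set X : ℂ := (t : ℂ) ^ 16 * z with hX
  set Y : ℂ := (t : ℂ) ^ 16 * z ^ 2 with hY
  have hXn : ‖X‖ ≤ t ^ 15 := by
    rw [hX, norm_mul, norm_pow, htn]
    calc t ^ 16 * ‖z‖ ≤ t ^ 16 * r := by gcongr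
      _ = t ^ 15 * (r * t) := by ring
      _ = t ^ 15 := by rw [hrt, mul_one]
  have hYn : ‖Y‖ ≤ t ^ 14 := by
    rw [hY, norm_mul, norm_pow, norm_pow, htn]
    calc t ^ 16 * ‖z‖ ^ 2 ≤ t ^ 16 * r ^ 2 := by gcongr
      _ = t ^ 14 * (r * t) ^ 2 := by ring
      _ = t ^ 14 := by rw [hrt]; ring
  have hX1 : ‖X‖ ≤ 1 := hXn.trans (pow_le_one₀ ht0.le ht1)
  have hY1 : ‖Y‖ ≤ 1 := hYn.trans (pow_le_one₀ ht0.le ht1)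
  -- tail
  have hterm : ∀ n : ℕ, ‖(b n : ℂ) * z ^ n‖ ≤ C * (n + 1) ^ 2 * (t ^ 7) ^ n := fun n => by
    rw [norm_mul, norm_pow, Complex.norm_real, Real.norm_eq_abs]
    calc |b n| * ‖z‖ ^ n ≤ (C * (n + 1) ^ 2 * (t ^ 8) ^ n) * r ^ n := by
          gcongr
          exact hb n
      _ = C * (n + 1) ^ 2 * (t ^ 7) ^ n * (r * t) ^ n := by ring
      _ = _ := by rw [hrt]; ring
  have hsq := summable_sq_mul_geometric hρ0 hρ1
  have hsum : Summable fun n => (b n : ℂ) * z ^ n := by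
    refine Summable.of_norm_bounded (hsq.mul_left C) fun n => (hterm n).trans ?_
    rw [mul_assoc]
    gcongr
  have hsq3 : Summable fun n : ℕ => ((n + 3 : ℕ) + 1 : ℝ) ^ 2 * ρ ^ n := by
    have h3 : ρ = 0 ∨ ρ ≠ 0 := eq_or_ne _ _
    rcases h3 with h3 | h3
    · refine summable_of_ne_finset_zero (s := {0}) fun n hn => ?_
      rw [h3, zero_pow (by simpa using hn), mul_zero]
    · refine (((summable_nat_add_iff 3).mpr hsq).mul_left (ρ⁻¹ ^ 3)).congr fun n => ?_
      rw [pow_add]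
      field_simp
  have htail : ‖∑' n, (b (n + 3) : ℂ) * z ^ (n + 3)‖ ≤
      (C * ∑' n : ℕ, ((n + 3 : ℕ) + 1 : ℝ) ^ 2 * ρ ^ n) * t ^ 18 := by
    rw [← tsum_mul_left, ← tsum_mul_right]
    refine tsum_of_norm_bounded ((hsq3.mul_left C).mul_right _).hasSum fun n => ?_
    refine (hterm (n + 3)).trans ?_
    rw [pow_add _ n 3]
    have e1 : (t ^ 7) ^ n ≤ ρ ^ n := by gcongr
    have e2 : (t ^ 7) ^ 3 ≤ t ^ 18 := by
      rw [← pow_mul]; exact pow_le_pow_of_le_one ht0.le ht1 (by norm_num)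
    calc C * ((n + 3 : ℕ) + 1 : ℝ) ^ 2 * ((t ^ 7) ^ n * (t ^ 7) ^ 3)
        ≤ C * ((n + 3 : ℕ) + 1 : ℝ) ^ 2 * (ρ ^ n * t ^ 18) := by gcongr
      _ = _ := by ring
  set T := ∑' n, (b (n + 3) : ℂ) * z ^ (n + 3) with hT
  set K := ∑' n : ℕ, ((n + 3 : ℕ) + 1 : ℝ) ^ 2 * ρ ^ n with hK
  set e1 : ℂ := ((b 1 : ℂ) - (1 + α) * (t : ℂ) ^ 16) * z with he1
  set e2 : ℂ := ((b 2 : ℂ) - β * (t : ℂ) ^ 16) * z ^ 2 with he2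
  have he1n : ‖e1‖ ≤ C * t ^ 18 := by
    rw [he1, norm_mul]
    calc _ ≤ (C * t ^ 20) * r := by gcongr
      _ = C * t ^ 19 * (r * t) := by ring
      _ ≤ C * t ^ 18 := by
        rw [hrt, mul_one]
        exact mul_le_mul_of_nonneg_left (pow_le_pow_of_le_one ht0.le ht1 (by norm_num)) hC
  -- This error fixes the exponent: `t ^ 20` times `r ^ 2` is exactly `t ^ 18`, that is `p ^
  -- (-9/8)`, which is still summable over primes.
  have he2n : ‖e2‖ ≤ C * t ^ 18 := by
    rw [he2, norm_mul, norm_pow]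
    calc _ ≤ (C * t ^ 20) * r ^ 2 := by gcongr
      _ = C * t ^ 18 * (r * t) ^ 2 := by ring
      _ = C * t ^ 18 := by rw [hrt]; ring
  have hZ : ∑' n, (b n : ℂ) * z ^ n = 1 + (1 + α) * X + β * Y + (e1 + e2 + T) := by
    rw [← hsum.sum_add_tsum_nat_add 3, ← hT]
    simp only [Finset.sum_range_succ, Finset.sum_range_zero, hb0]
    push_cast
    simp only [he1, he2, hX, hY]
    ring
  -- The terms linear in `X` and in `Y` cancel; what remains is quadratic in `X`, `Y` or contains an
  -- error term. The first bracket is bounded by `4 + 3 + 12 = 19` times `t ^ 18`.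
  have hid : (1 - X) * (1 - α * X) * (1 - β * Y) * (1 + (1 + α) * X + β * Y + (e1 + e2 + T)) - 1 =
      (-((1 + α) ^ 2 * X ^ 2) + α * X ^ 2 * (1 + (1 + α) * X) -
        (β * Y * ((1 + α) * X) + β ^ 2 * Y ^ 2) * (1 - (1 + α) * X + α * X ^ 2)) +
      (1 - X) * (1 - α * X) * (1 - β * Y) * (e1 + e2 + T) := by ring
  rw [hZ, hid]
  have hA : ‖1 + α‖ ≤ 2 := (norm_add_le _ _).trans (by simp; linarith)
  have hAX : ‖(1 + α) * X‖ ≤ 2 := by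
    rw [norm_mul]; calc _ ≤ (2 : ℝ) * 1 := by gcongr
      _ = 2 := by norm_num
  have hP : ‖(1 - X) * (1 - α * X) * (1 - β * Y)‖ ≤ 8 := by
    have a1 : ‖1 - X‖ ≤ 2 := (norm_sub_le _ _).trans (by simp; linarith)
    have a2 : ‖1 - α * X‖ ≤ 2 := (norm_sub_le _ _).trans (by
      rw [norm_mul, norm_one]; nlinarith [norm_nonneg α, norm_nonneg X])
    have a3 : ‖1 - β * Y‖ ≤ 2 := (norm_sub_le _ _).trans (by
      rw [norm_mul, norm_one]; nlinarith [norm_nonneg β, norm_nonneg Y])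
    rw [norm_mul, norm_mul]
    calc _ ≤ (2 : ℝ) * 2 * 2 := by gcongr
      _ = 8 := by norm_num
  have hE : ‖e1 + e2 + T‖ ≤ (2 * C + C * K) * t ^ 18 := by
    refine (norm_add₃_le).trans ?_
    linarith
  have p1 : ∀ m : ℕ, 18 ≤ m → t ^ m ≤ t ^ 18 := fun m hm => pow_le_pow_of_le_one ht0.le ht1 hm
  have hX2 : ‖X‖ ^ 2 ≤ t ^ 18 := by
    calc ‖X‖ ^ 2 ≤ (t ^ 15) ^ 2 := by gcongr
      _ ≤ _ := by rw [← pow_mul]; exact p1 _ (by norm_num)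
  have hY2 : ‖Y‖ ^ 2 ≤ t ^ 18 := by
    calc ‖Y‖ ^ 2 ≤ (t ^ 14) ^ 2 := by gcongr
      _ ≤ _ := by rw [← pow_mul]; exact p1 _ (by norm_num)
  have hXY : ‖Y‖ * ‖X‖ ≤ t ^ 18 := by
    calc ‖Y‖ * ‖X‖ ≤ t ^ 14 * t ^ 15 := by gcongr
      _ ≤ _ := by rw [← pow_add]; exact p1 _ (by norm_num)
  have q1 : ‖-((1 + α) ^ 2 * X ^ 2)‖ ≤ 4 * t ^ 18 := by
    rw [norm_neg, norm_mul, norm_pow, norm_pow]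
    calc _ ≤ (2 : ℝ) ^ 2 * t ^ 18 := by gcongr
      _ = _ := by norm_num
  have q2 : ‖α * X ^ 2 * (1 + (1 + α) * X)‖ ≤ 3 * t ^ 18 := by
    rw [norm_mul, norm_mul, norm_pow]
    have : ‖1 + (1 + α) * X‖ ≤ 3 := (norm_add_le _ _).trans (by rw [norm_one]; linarith)
    calc _ ≤ 1 * t ^ 18 * 3 := by gcongr
      _ = _ := by ring
  have q3 : ‖(β * Y * ((1 + α) * X) + β ^ 2 * Y ^ 2) * (1 - (1 + α) * X + α * X ^ 2)‖ ≤
      12 * t ^ 18 := by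
    rw [norm_mul]
    have u1 : ‖1 - (1 + α) * X + α * X ^ 2‖ ≤ 4 := by
      refine (norm_add_le _ _).trans ?_
      have : ‖α * X ^ 2‖ ≤ 1 := by
        rw [norm_mul, norm_pow]
        exact mul_le_one₀ hα (by positivity) (pow_le_one₀ (norm_nonneg _) hX1)
      have : ‖1 - (1 + α) * X‖ ≤ 3 := (norm_sub_le _ _).trans (by rw [norm_one]; linarith)
      linarith
    have u2 : ‖β * Y * ((1 + α) * X) + β ^ 2 * Y ^ 2‖ ≤ 3 * t ^ 18 := by
      refine (norm_add_le _ _).trans ?_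
      rw [norm_mul (β * Y), norm_mul β, norm_mul (1 + α), norm_mul (β ^ 2), norm_pow, norm_pow]
      have v1 : ‖β‖ * ‖Y‖ * (‖1 + α‖ * ‖X‖) ≤ 2 * t ^ 18 := by
        calc _ = ‖β‖ * ‖1 + α‖ * (‖Y‖ * ‖X‖) := by ring
          _ ≤ 1 * 2 * t ^ 18 := by gcongr
          _ = _ := by ring
      have v2 : ‖β‖ ^ 2 * ‖Y‖ ^ 2 ≤ t ^ 18 := by
        calc _ ≤ 1 ^ 2 * t ^ 18 := by gcongr
          _ = _ := by ring
      linarith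
    calc _ ≤ 3 * t ^ 18 * 4 := by gcongr
      _ = _ := by ring
  have q4 : ‖(1 - X) * (1 - α * X) * (1 - β * Y) * (e1 + e2 + T)‖ ≤
      8 * ((2 * C + C * K) * t ^ 18) := by
    rw [norm_mul]; gcongr
  refine (norm_add_le _ _).trans ?_
  have q5 := norm_sub_le (-((1 + α) ^ 2 * X ^ 2) + α * X ^ 2 * (1 + (1 + α) * X))
    ((β * Y * ((1 + α) * X) + β ^ 2 * Y ^ 2) * (1 - (1 + α) * X + α * X ^ 2))
  have q6 := norm_add_le (-((1 + α) ^ 2 * X ^ 2)) (α * X ^ 2 * (1 + (1 + α) * X))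
  linarith

end

/-! ### From bounds at prime powers to the largest pole -/

section

open Filter Topology

theorem natCast_pow_cpow (p e : ℕ) (s : ℂ) : ((p ^ e : ℕ) : ℂ) ^ s = ((p : ℂ) ^ s) ^ e := by
  induction e with
  | zero => simp
  | succ e ih => rw [pow_succ, Nat.cast_mul, Complex.natCast_mul_natCast_cpow, ih, pow_succ]

/-- This makes the local factor a power series in `z = p ^ (d - s)`. With `d + 1`, the expected
pole, in place of `d`, the condition `re s > d + 1 - 1/16` gives `‖z‖ ≤ p ^ (1/16)`. -/
theorem term_prime_pow (c : ℕ → ℕ) {p : ℕ} (hp : p.Prime) (d e : ℕ) (s : ℂ) :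
    LSeries.term (fun n => (c n : ℂ)) s (p ^ e) =
      (((c (p ^ e) : ℝ) / ((p : ℝ) ^ d) ^ e : ℝ) : ℂ) * ((p : ℂ) ^ ((d : ℂ) - s)) ^ e := by
  have hp0 : (p : ℂ) ≠ 0 := by exact_mod_cast hp.ne_zero
  rw [LSeries.term_of_ne_zero (pow_ne_zero _ hp.ne_zero), natCast_pow_cpow,
    Complex.cpow_sub _ _ hp0, Complex.cpow_natCast, div_pow]
  push_cast
  field_simp

theorem norm_prime_cpow_le {p : ℕ} (hp : p.Prime) {w : ℂ} {x : ℝ} (hw : w.re ≤ x) :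
    ‖(p : ℂ) ^ w‖ ≤ (p : ℝ) ^ x := by
  rw [Complex.norm_natCast_cpow_of_pos hp.pos]
  exact Real.rpow_le_rpow_of_exponent_le (by exact_mod_cast hp.one_lt.le) hw

theorem rpow_neg_div_sixteen {x : ℝ} (hx : 0 < x) (m : ℕ) :
    (x ^ (1 / 16 : ℝ))⁻¹ ^ m = x ^ (-(m / 16 : ℝ)) := by
  rw [← Real.rpow_neg hx.le, ← Real.rpow_natCast, ← Real.rpow_mul hx.le]
  congr 1
  ring

/-- A multiplicative sequence whose values at prime powers are close to those of
`ζ(s - d) * GA(s - d) * GB(2 s - 2 d - 1)` has its largest pole at `d + 1`, of the expected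
order. -/
theorem hasLargestPole_of_bounds {c : ℕ → ℕ} (h1 : c 1 = 1)
    (hmul : ∀ m n : ℕ, m.Coprime n → c (m * n) = c m * c n)
    {α : ℕ → ℂ} {GA GB : ℂ → ℂ} {kA kB : ℕ} {β : ℂ} (hA : IsEulerModel α GA kA)
    (hB : IsEulerModel (fun _ => β) GB kB) (d : ℕ) {C : ℝ}
    (ha : ∀ p : ℕ, p.Prime →
      ‖(c p : ℂ) - (1 + α p) * (p : ℂ) ^ d‖ ≤ C * (p : ℝ) ^ ((d : ℝ) - 1 / 4))
    (hb : ∀ p : ℕ, p.Prime →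
      ‖(c (p ^ 2) : ℂ) - β * (p : ℂ) ^ (2 * d + 1)‖ ≤ C * (p : ℝ) ^ (2 * (d : ℝ) + 3 / 4))
    (hc : ∀ p : ℕ, p.Prime → ∀ n : ℕ,
      (c (p ^ n) : ℝ) ≤ C * (n + 1) ^ 2 * (p : ℝ) ^ (((d : ℝ) + 1 / 2) * n)) :
    HasLargestPole (fun n => (c n : ℂ)) ((d + 1 : ℕ) : ℝ) (1 + kA + kB) := by
  have hC : 0 ≤ C := by
    have := (Nat.cast_nonneg _).trans (hc 2 Nat.prime_two 0)
    simpa using this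
  set P : ℕ → ℂ → ℂ := fun p s => (1 - (p : ℂ) ^ (-(1 + 1 * (s - ((d + 1 : ℕ) : ℝ))))) *
    (1 - α p * (p : ℂ) ^ (-(1 + 1 * (s - ((d + 1 : ℕ) : ℝ))))) *
    (1 - β * (p : ℂ) ^ (-(1 + 2 * (s - ((d + 1 : ℕ) : ℝ))))) with hPdef
  set G : ℂ → ℂ := fun s => riemannZeta (1 + 1 * (s - ((d + 1 : ℕ) : ℝ))) *
    GA (1 + 1 * (s - ((d + 1 : ℕ) : ℝ))) * GB (1 + 2 * (s - ((d + 1 : ℕ) : ℝ))) with hG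
  have hZ := isEulerModel_riemannZeta
  have hre1 : ∀ s : ℂ, ((d + 1 : ℕ) : ℝ) < s.re → 1 < (1 + 1 * (s - ((d + 1 : ℕ) : ℝ)) : ℂ).re := by
    intro s hs; simp at hs ⊢; linarith
  have hre2 : ∀ s : ℂ, ((d + 1 : ℕ) : ℝ) < s.re → 1 < (1 + 2 * (s - ((d + 1 : ℕ) : ℝ)) : ℂ).re := by
    intro s hs; simp at hs ⊢; linarith
  have hre1' : ∀ s : ℂ, ((d + 1 : ℕ) : ℝ) ≤ s.re → 1 ≤ (1 + 1 * (s - ((d + 1 : ℕ) : ℝ)) : ℂ).re := by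
    intro s hs; simp at hs ⊢; linarith
  have hre2' : ∀ s : ℂ, ((d + 1 : ℕ) : ℝ) ≤ s.re → 1 ≤ (1 + 2 * (s - ((d + 1 : ℕ) : ℝ)) : ℂ).re := by
    intro s hs; simp at hs ⊢; linarith
  have hr0 : ∀ p : ℕ, p.Prime → (0 : ℝ) < p := fun p hp => by exact_mod_cast hp.pos
  have hbn : ∀ p : ℕ, p.Prime → ∀ n : ℕ, |(c (p ^ n) : ℝ) / ((p : ℝ) ^ (d + 1)) ^ n| ≤
      C * (n + 1) ^ 2 * ((((p : ℝ) ^ (1 / 16 : ℝ))⁻¹) ^ 8) ^ n := by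
    intro p hp n
    have hp0 := hr0 p hp
    rw [abs_of_nonneg (by positivity), div_le_iff₀ (by positivity)]
    refine (hc p hp n).trans (le_of_eq ?_)
    rw [mul_assoc (C * _)]
    congr 1
    rw [rpow_neg_div_sixteen hp0, ← mul_pow, ← Real.rpow_natCast _ (d + 1), ← Real.rpow_add hp0,
      ← Real.rpow_natCast _ n, ← Real.rpow_mul hp0.le]
    congr 1
    push_cast
    ring
  -- The prime 2 is the worst case for the ratio `p ^ (-7/16)`, so this `ρ` serves all primes.
  set ρ : ℝ := ((2 : ℝ) ^ (1 / 16 : ℝ))⁻¹ ^ 7 with hρdef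
  have hρ1 : ρ < 1 := by
    refine pow_lt_one₀ (by positivity) ?_ (by norm_num)
    exact inv_lt_one_of_one_lt₀ (Real.one_lt_rpow (by norm_num) (by norm_num))
  have hr1 : ∀ p : ℕ, p.Prime → (1 : ℝ) ≤ (p : ℝ) ^ (1 / 16 : ℝ) := fun p hp =>
    Real.one_le_rpow (by exact_mod_cast hp.one_lt.le) (by norm_num)
  have hρ : ∀ p : ℕ, p.Prime → ((p : ℝ) ^ (1 / 16 : ℝ))⁻¹ ^ 7 ≤ ρ := fun p hp => by
    have h2p : (2 : ℝ) ≤ p := by exact_mod_cast hp.two_le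
    rw [hρdef]
    gcongr
  refine hasLargestPole_of_localFactor (P := P) (G := G) (δ := 1 / 16) h1 hmul (by omega) (by norm_num)
    ?_ ?_ ?_ ?_ ?_ ?_ ?_ ?_ (u := fun p => (19 + 8 * (2 * C + C *
      ∑' n : ℕ, ((n + 3 : ℕ) + 1 : ℝ) ^ 2 * ρ ^ n)) * (p : ℝ) ^ (-((18 : ℕ) / 16 : ℝ))) ?_ ?_
  · intro p hp
    have hp0 : (p : ℂ) ≠ 0 := by exact_mod_cast hp.ne_zero
    have hcp : ∀ m : ℂ, Differentiable ℂ fun s : ℂ => (p : ℂ) ^ (-(1 + m * (s - ((d + 1 : ℕ) : ℝ)))) :=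
      fun m => Differentiable.const_cpow (by fun_prop) (Or.inl hp0)
    exact (((hcp 1).const_sub 1).mul (((hcp 1).const_mul _).const_sub 1)).mul
      (((hcp 2).const_mul _).const_sub 1)
  · intro p hp
    have key : ∀ a : ℂ, ‖a‖ ≤ 1 → 1 - a * (p : ℂ)⁻¹ ≠ 0 := by
      intro a ha h0
      have h2 : ‖a * (p : ℂ)⁻¹‖ < 1 := by
        rw [norm_mul, norm_inv, Complex.norm_natCast]
        have : (p : ℝ)⁻¹ < 1 := inv_lt_one_of_one_lt₀ (by exact_mod_cast hp.one_lt)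
        have : 0 ≤ (p : ℝ)⁻¹ := by positivity
        nlinarith [norm_nonneg a]
      rw [← sub_eq_zero.mp h0] at h2
      simp at h2
    simp only [hPdef, sub_self, mul_zero, add_zero, Complex.cpow_neg_one]
    exact mul_ne_zero (mul_ne_zero (by simpa using key 1 (by simp)) (key _ (hA.norm_le p)))
      (key _ (hB.norm_le p))
  · intro s hs
    simp only [hG, mul_inv]
    have := ((hZ.hasProd _ (hre1 s hs)).mul (hA.hasProd _ (hre1 s hs))).mul
      (hB.hasProd _ (hre2 s hs))
    simpa [hPdef] using this
  · intro s hs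
    exact mul_ne_zero (mul_ne_zero (hZ.ne_zero _ (hre1 s hs)) (hA.ne_zero _ (hre1 s hs)))
      (hB.ne_zero _ (hre2 s hs))
  · intro s _
    exact ((hZ.meromorphicAt_comp _ 1 s).mul (hA.meromorphicAt_comp _ 1 s)).mul
      (hB.meromorphicAt_comp _ 2 s)
  · intro s hs hne
    have hne' : s - (((d + 1 : ℕ) : ℝ) : ℂ) ≠ 0 := sub_ne_zero.mpr hne
    have an : ∀ {α' : ℕ → ℂ} {G' : ℂ → ℂ} {k' : ℕ}, IsEulerModel α' G' k' → ∀ m : ℂ, m ≠ 0 →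
        1 ≤ (1 + m * (s - ((d + 1 : ℕ) : ℝ)) : ℂ).re →
        AnalyticAt ℂ (fun s => G' (1 + m * (s - ((d + 1 : ℕ) : ℝ)))) s := by
      intro α' G' k' h m hm hmre
      refine (h.analyticAt _ hmre ?_).fun_comp (f := fun s => 1 + m * (s - ((d + 1 : ℕ) : ℝ)))
        (by fun_prop)
      simpa using ⟨hm, by simpa using hne'⟩
    exact ((an hZ 1 one_ne_zero (hre1' s hs)).mul (an hA 1 one_ne_zero (hre1' s hs))).mul
      (an hB 2 two_ne_zero (hre2' s hs))
  · have m1 := hZ.meromorphicAt_comp ((d + 1 : ℕ) : ℝ) 1 (((d + 1 : ℕ) : ℝ) : ℂ)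
    have m2 := hA.meromorphicAt_comp ((d + 1 : ℕ) : ℝ) 1 (((d + 1 : ℕ) : ℝ) : ℂ)
    have m3 := hB.meromorphicAt_comp ((d + 1 : ℕ) : ℝ) 2 (((d + 1 : ℕ) : ℝ) : ℂ)
    have e := meromorphicOrderAt_mul (m1.mul m2) m3
    rw [meromorphicOrderAt_mul m1 m2, hZ.order_comp _ 1 one_ne_zero, hA.order_comp _ 1 one_ne_zero,
      hB.order_comp _ 2 two_ne_zero] at e
    refine (Eq.trans ?_ e).trans ?_
    · rfl
    · norm_cast
      push_cast
      ring_nf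
  · intro p hp
    refine Summable.of_nonneg_of_le (fun _ => norm_nonneg _) (fun e => ?_)
      ((summable_sq_mul_geometric (ρ := ρ) (by positivity) hρ1).mul_left C)
    have hp0 := hr0 p hp
    rw [term_prime_pow c hp (d + 1), norm_mul, norm_pow, Complex.norm_real, Real.norm_eq_abs]
    have hz : ‖(p : ℂ) ^ (((d + 1 : ℕ) : ℂ) - ((((d + 1 : ℕ) : ℝ) - 1 / 16 : ℝ) : ℂ))‖ ≤
        (p : ℝ) ^ (1 / 16 : ℝ) := norm_prime_cpow_le hp (by simp)
    calc _ ≤ (C * (e + 1) ^ 2 * ((((p : ℝ) ^ (1 / 16 : ℝ))⁻¹) ^ 8) ^ e) *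
          ((p : ℝ) ^ (1 / 16 : ℝ)) ^ e := by gcongr; exact hbn p hp e
      _ = C * ((e + 1) ^ 2 * ((((p : ℝ) ^ (1 / 16 : ℝ))⁻¹) ^ 7) ^ e) *
          (((p : ℝ) ^ (1 / 16 : ℝ))⁻¹ * (p : ℝ) ^ (1 / 16 : ℝ)) ^ e := by ring
      _ = C * ((e + 1) ^ 2 * ((((p : ℝ) ^ (1 / 16 : ℝ))⁻¹) ^ 7) ^ e) := by
          rw [inv_mul_cancel₀ (by positivity), one_pow, mul_one]
      _ ≤ _ := by gcongr; exact hρ p hp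
  · exact (Nat.Primes.summable_rpow.mpr (by norm_num)).mul_left _
  · intro p' s hs
    obtain ⟨p, hp⟩ := p'
    have hp0 := hr0 p hp
    have hpc : (p : ℂ) ≠ 0 := by exact_mod_cast hp.ne_zero
    set r : ℝ := (p : ℝ) ^ (1 / 16 : ℝ) with hrdef
    set z : ℂ := (p : ℂ) ^ (((d + 1 : ℕ) : ℂ) - s) with hzdef
    have hr16 : r ^ 16 = p := by
      rw [hrdef, ← Real.rpow_natCast, ← Real.rpow_mul hp0.le]; norm_num
    have hr16c : (r : ℂ)⁻¹ ^ 16 = (p : ℂ)⁻¹ := by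
      rw [inv_pow]; congr 1; exact_mod_cast hr16
    have hz : ‖z‖ ≤ r := norm_prime_cpow_le hp (by simp at hs ⊢; linarith)
    have hX : (p : ℂ) ^ (-(1 + 1 * (s - ((d + 1 : ℕ) : ℝ)))) = (r : ℂ)⁻¹ ^ 16 * z := by
      rw [hr16c, hzdef, ← Complex.cpow_neg_one, ← Complex.cpow_add _ _ hpc]
      congr 1; push_cast; ring
    have hY : (p : ℂ) ^ (-(1 + 2 * (s - ((d + 1 : ℕ) : ℝ)))) = (r : ℂ)⁻¹ ^ 16 * z ^ 2 := by
      rw [hr16c, hzdef, ← Complex.cpow_neg_one, pow_two, ← Complex.cpow_add _ _ hpc,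
        ← Complex.cpow_add _ _ hpc]
      congr 1; push_cast; ring
    have hloc : localFactor c p s =
        ∑' n, (((c (p ^ n) : ℝ) / ((p : ℝ) ^ (d + 1)) ^ n : ℝ) : ℂ) * z ^ n :=
      tsum_congr fun n => term_prime_pow c hp (d + 1) n s
    have h20 : r⁻¹ ^ 20 = (p : ℝ) ^ (-(5 / 4) : ℝ) := by
      rw [hrdef, rpow_neg_div_sixteen hp0]; norm_num
    have main := norm_eulerFactor_sub_one_le (b := fun n => (c (p ^ n) : ℝ) / ((p : ℝ) ^ (d + 1)) ^ n)
      (α := α p) (β := β) (z := z) hC (hr1 p hp) (hρ p hp) hρ1 (hA.norm_le p) (hB.norm_le 0) hz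
      (by simp [h1]) ?_ ?_ (hbn p hp)
    · simp only [hPdef, hX, hY, hloc]
      refine main.trans (le_of_eq ?_)
      rw [rpow_neg_div_sixteen hp0]
    · rw [hr16c, h20]
      have e : (((c (p ^ 1) : ℝ) / ((p : ℝ) ^ (d + 1)) ^ 1 : ℝ) : ℂ) - (1 + α p) * (p : ℂ)⁻¹ =
          ((c p : ℂ) - (1 + α p) * (p : ℂ) ^ d) * ((p : ℂ) ^ (d + 1))⁻¹ := by
        push_cast
        simp only [pow_one]
        field_simp
        ring
      rw [e, norm_mul, norm_inv, norm_pow, Complex.norm_natCast, ← div_eq_mul_inv,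
        div_le_iff₀ (by positivity)]
      refine (ha p hp).trans (le_of_eq ?_)
      rw [mul_assoc, ← Real.rpow_natCast, ← Real.rpow_add hp0]
      congr 2
      push_cast
      ring
    · rw [hr16c, h20]
      have e : (((c (p ^ 2) : ℝ) / ((p : ℝ) ^ (d + 1)) ^ 2 : ℝ) : ℂ) - β * (p : ℂ)⁻¹ =
          ((c (p ^ 2) : ℂ) - β * (p : ℂ) ^ (2 * d + 1)) * ((p : ℂ) ^ (2 * d + 2))⁻¹ := by
        push_cast
        field_simp
        ring
      rw [e, norm_mul, norm_inv, norm_pow, Complex.norm_natCast, ← div_eq_mul_inv,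
        div_le_iff₀ (by positivity)]
      refine (hb p hp).trans (le_of_eq ?_)
      rw [mul_assoc, ← Real.rpow_natCast, ← Real.rpow_add hp0]
      congr 2
      push_cast
      ring

end

/-! ### Jacobi characters and diagonalisation of ternary forms -/

section

open Matrix

/-- The Jacobi symbol `(d | ·)` as a Dirichlet character modulo `4 * |d|`. -/
noncomputable def jacobiCharacter (d : ℤ) (hd : d ≠ 0) : DirichletCharacter ℂ (4 * d.natAbs) :=
  MulChar.ofUnitHom (MonoidHom.toHomUnits
    { toFun := fun u : (ZMod (4 * d.natAbs))ˣ => ((jacobiSym d (u : ZMod (4 * d.natAbs)).val : ℤ) : ℂ)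
      map_one' := by
        have : Fact (1 < 4 * d.natAbs) := ⟨by have := Int.natAbs_pos.mpr hd; omega⟩
        rw [Units.val_one, ZMod.val_one]
        simp
      map_mul' := fun u v => by
        have : NeZero (4 * d.natAbs) := ⟨by have := Int.natAbs_pos.mpr hd; omega⟩
        have odd : ∀ w : (ZMod (4 * d.natAbs))ˣ, Odd (w : ZMod (4 * d.natAbs)).val := fun w => by
          have h := ZMod.val_coe_unit_coprime w
          rw [← Nat.coprime_two_right]
          exact h.coprime_dvd_right (Dvd.intro _ (by ring : 2 * (2 * d.natAbs) = 4 * d.natAbs))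
        have hu : NeZero (u : ZMod (4 * d.natAbs)).val := ⟨(odd u).pos.ne'⟩
        have hv : NeZero (v : ZMod (4 * d.natAbs)).val := ⟨(odd v).pos.ne'⟩
        rw [Units.val_mul, ZMod.val_mul, ← jacobiSym.mod_right d ((odd u).mul (odd v)),
          jacobiSym.mul_right]
        push_cast
        rfl })

theorem jacobiCharacter_prime (d : ℤ) (hd : d ≠ 0) {p : ℕ} (hp : p.Prime) (h2 : p ≠ 2)
    (hpd : ¬ (p : ℤ) ∣ d) :
    jacobiCharacter d hd (p : ZMod (4 * d.natAbs)) = ((jacobiSym d p : ℤ) : ℂ) := by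
  have hc : p.Coprime (4 * d.natAbs) := by
    refine Nat.Coprime.mul_right ?_ ?_
    · rw [show 4 = 2 ^ 2 from rfl]
      exact (((Nat.coprime_primes hp Nat.prime_two).mpr h2)).pow_right 2
    · rw [hp.coprime_iff_not_dvd]
      exact fun h => hpd (Int.natCast_dvd.mpr h)
  have : ((ZMod.unitOfCoprime p hc : (ZMod (4 * d.natAbs))ˣ) : ZMod (4 * d.natAbs)) = p :=
    ZMod.coe_unitOfCoprime p hc
  rw [← this, jacobiCharacter, MulChar.ofUnitHom_coe]
  simp only [MonoidHom.coe_toHomUnits, MonoidHom.coe_mk, OneHom.coe_mk, this, ZMod.val_natCast]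
  rw [← jacobiSym.mod_right d (hp.odd_of_ne_two h2)]

/-- If the Jacobi character is trivial, the zeta function is the model, with `k = 1`; otherwise its
L-function is, with `k = 0`. Only primes outside `2 d` are matched, which suffices because finitely
many primes do not influence the pole. -/
theorem exists_isEulerModel_jacobiSym (d : ℤ) (hd : d ≠ 0) :
    ∃ (α : ℕ → ℂ) (G : ℂ → ℂ) (k : ℕ), IsEulerModel α G k ∧
      ∀ p : ℕ, p.Prime → p ≠ 2 → ¬ (p : ℤ) ∣ d → α p = ((jacobiSym d p : ℤ) : ℂ) := by
  have : NeZero (4 * d.natAbs) := ⟨by have := Int.natAbs_pos.mpr hd; omega⟩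
  by_cases hχ : jacobiCharacter d hd = 1
  · refine ⟨_, _, _, isEulerModel_riemannZeta, fun p hp h2 hpd => ?_⟩
    have h := jacobiCharacter_prime d hd hp h2 hpd
    have hne : ((jacobiSym d p : ℤ) : ℂ) ≠ 0 := by
      exact_mod_cast jacobiSym.ne_zero (by
        rw [Int.gcd_comm]
        exact (Nat.Prime.coprime_iff_not_dvd hp).mpr fun h' => hpd (Int.natCast_dvd.mpr h'))
    rw [← h, hχ] at hne ⊢
    rw [MulChar.one_apply]
    by_contra hu
    exact hne (MulChar.map_nonunit _ hu)
  · exact ⟨_, _, _, isEulerModel_LFunction hχ, fun p hp h2 hpd => jacobiCharacter_prime d hd hp h2 hpd⟩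

/-- The value at `f` of the quadratic form `∑ M i j X i X j` over a commutative ring. -/
def quadEval (M : Matrix (Fin 3) (Fin 3) ℤ) {R : Type*} [CommRing R] (f : Fin 3 → R) : R :=
  ∑ i, ∑ j, (M i j : R) * f i * f j

theorem quadEval_eq (M : Matrix (Fin 3) (Fin 3) ℤ) {R : Type*} [CommRing R] (f : Fin 3 → R) :
    quadEval M f = f ⬝ᵥ (M.map (Int.cast : ℤ → R) *ᵥ f) := by
  simp only [quadEval, dotProduct, mulVec, Finset.mul_sum, Matrix.map_apply]
  exact Finset.sum_congr rfl fun i _ => Finset.sum_congr rfl fun j _ => by ring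

theorem quadEval_mulVec (M T : Matrix (Fin 3) (Fin 3) ℤ) {R : Type*} [CommRing R] (x : Fin 3 → R) :
    quadEval M (T.map (Int.cast : ℤ → R) *ᵥ x) = quadEval (Tᵀ * M * T) x := by
  rw [quadEval_eq, quadEval_eq]
  have h : (Tᵀ * M * T).map (Int.cast : ℤ → R) =
      (T.map (Int.cast : ℤ → R))ᵀ * M.map (Int.cast : ℤ → R) * T.map (Int.cast : ℤ → R) := by
    have := Matrix.map_mul (L := Tᵀ * M) (M := T) (f := Int.castRingHom R)
    have h2 := Matrix.map_mul (L := Tᵀ) (M := M) (f := Int.castRingHom R)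
    simp only [Int.coe_castRingHom] at this h2
    rw [this, h2, Matrix.transpose_map]
  rw [h, ← Matrix.mulVec_mulVec, ← Matrix.mulVec_mulVec, Matrix.mulVec_transpose,
    dotProduct_comm x, ← Matrix.dotProduct_mulVec, dotProduct_comm]

theorem quadEval_diag {N : Matrix (Fin 3) (Fin 3) ℤ} (hN : ∀ i j, i ≠ j → N i j + N j i = 0)
    {R : Type*} [CommRing R] (x : Fin 3 → R) : quadEval N x = ∑ i, (N i i : R) * x i ^ 2 := by
  have h01 : (N 0 1 : R) + N 1 0 = 0 := by exact_mod_cast congrArg (Int.cast : ℤ → R) (hN 0 1 (by decide))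
  have h02 : (N 0 2 : R) + N 2 0 = 0 := by exact_mod_cast congrArg (Int.cast : ℤ → R) (hN 0 2 (by decide))
  have h12 : (N 1 2 : R) + N 2 1 = 0 := by exact_mod_cast congrArg (Int.cast : ℤ → R) (hN 1 2 (by decide))
  simp only [quadEval, Fin.sum_univ_three]
  linear_combination (x 0 * x 1) * h01 + (x 0 * x 2) * h02 + (x 1 * x 2) * h12

/-- An integral ternary quadratic form can be diagonalised by an integral matrix of nonzero
determinant, with the nonzero coefficients first. -/
theorem exists_diagonalization (M : Matrix (Fin 3) (Fin 3) ℤ) :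
    ∃ T : Matrix (Fin 3) (Fin 3) ℤ, T.det ≠ 0 ∧
      (∀ i j, i ≠ j → (Tᵀ * M * T) i j + (Tᵀ * M * T) j i = 0) ∧
      ∀ i j, i ≤ j → (Tᵀ * M * T) j j ≠ 0 → (Tᵀ * M * T) i i ≠ 0 := by
  suffices h : ∃ T : Matrix (Fin 3) (Fin 3) ℤ, T.det ≠ 0 ∧
      (∀ i j, i ≠ j → (Tᵀ * M * T) i j + (Tᵀ * M * T) j i = 0) by
    obtain ⟨T, hT, hd⟩ := h
    -- Sorting by this weight moves the nonzero diagonal entries to the front.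
    set w : Fin 3 → ℕ := fun i => if (Tᵀ * M * T) i i = 0 then 1 else 0 with hw
    set π := Tuple.sort w
    have e : (T.submatrix id π)ᵀ * M * T.submatrix id π = (Tᵀ * M * T).submatrix π π := by
      ext i j
      simp [Matrix.mul_apply]
    refine ⟨T.submatrix id π, ?_, ?_, ?_⟩
    · rw [Matrix.det_permute']
      refine mul_ne_zero ?_ hT
      exact_mod_cast (Equiv.Perm.sign π).ne_zero
    · intro i j hij
      rw [e]
      exact hd _ _ (π.injective.ne hij)
    · intro i j hij
      have := Tuple.monotone_sort w hij
      rw [e]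
      simp only [Function.comp_apply, hw, Matrix.submatrix_apply] at this ⊢
      intro h1 h2
      change (if (Tᵀ * M * T) (π i) (π i) = 0 then 1 else 0) ≤
        (if (Tᵀ * M * T) (π j) (π j) = 0 then 1 else 0) at this
      rw [if_pos h2, if_neg h1] at this
      omega
  -- `M` need not be symmetric. An orthogonal rational basis for its symmetrisation, scaled by a
  -- common denominator, gives the columns of `T`.
  set A : Matrix (Fin 3) (Fin 3) ℚ := (M + Mᵀ).map (Int.cast : ℤ → ℚ) with hA
  have hAs : (Matrix.toBilin' A).IsSymm := by
    refine ⟨fun x y => ?_⟩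
    simp only [Matrix.toBilin'_apply']
    rw [Matrix.dotProduct_mulVec, dotProduct_comm, ← Matrix.mulVec_transpose]
    congr 2
    ext i j
    simp [hA, add_comm]
  obtain ⟨v, hv⟩ := LinearMap.BilinForm.exists_orthogonal_basis (LinearMap.BilinForm.isSymm_iff.mp hAs)
  have hfr : Module.finrank ℚ (Fin 3 → ℚ) = 3 := by simp
  set v' := v.reindex (finCongr hfr) with hv'
  have hvo : ∀ i j, i ≠ j → Matrix.toBilin' A (v' i) (v' j) = 0 := by
    intro i j hij
    simp only [hv', Module.Basis.reindex_apply]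
    exact hv (fun h => hij (by simpa using h))
  obtain ⟨n, hn⟩ := IsLocalization.exist_integer_multiples_of_finset (nonZeroDivisors ℤ)
    (Finset.univ.image fun ij : Fin 3 × Fin 3 => v' ij.1 ij.2)
  have hn' : ∀ i j, ∃ t : ℤ, (t : ℚ) = (n : ℤ) * v' i j := fun i j => by
    obtain ⟨t, ht⟩ := hn (v' i j) (Finset.mem_image.mpr ⟨(i, j), by simp, rfl⟩)
    exact ⟨t, by simpa using ht⟩
  choose t ht using hn'
  have hn0 : ((n : ℤ) : ℚ) ≠ 0 := by
    have := nonZeroDivisors.coe_ne_zero n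
    exact_mod_cast this
  set T : Matrix (Fin 3) (Fin 3) ℤ := Matrix.of fun i j => t j i with hTdef
  have hTv : T.map (Int.cast : ℤ → ℚ) = ((n : ℤ) : ℚ) • (Pi.basisFun ℚ (Fin 3)).toMatrix v' := by
    ext i j
    simp [hTdef, ht, Module.Basis.toMatrix_apply]
  refine ⟨T, ?_, ?_⟩
  · intro h0
    have h1 : (T.map (Int.cast : ℤ → ℚ)).det = 0 := by
      have := (Int.castRingHom ℚ).map_det T
      rw [h0] at this
      simpa using this.symm
    rw [hTv, Matrix.det_smul] at h1
    have h2 : ((Pi.basisFun ℚ (Fin 3)).toMatrix v').det ≠ 0 := by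
      rw [← Module.Basis.det_apply]
      exact ((Pi.basisFun ℚ (Fin 3)).isUnit_det v').ne_zero
    exact mul_ne_zero (pow_ne_zero _ hn0) h2 h1
  · intro i j hij
    have h1 : (Tᵀ * M * T) i j + (Tᵀ * M * T) j i = (Tᵀ * (M + Mᵀ) * T) i j := by
      have : (Tᵀ * M * T) j i = (Tᵀ * Mᵀ * T) i j := by
        rw [← Matrix.transpose_apply (Tᵀ * M * T), Matrix.transpose_mul, Matrix.transpose_mul,
          Matrix.transpose_transpose, Matrix.mul_assoc]
      rw [this, Matrix.mul_add, Matrix.add_mul, Matrix.add_apply]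
    rw [h1]
    have h2 : ((Tᵀ * (M + Mᵀ) * T) i j : ℚ) = (n : ℤ) ^ 2 * Matrix.toBilin' A (v' i) (v' j) := by
      rw [Matrix.toBilin'_apply]
      simp only [Matrix.mul_apply, Matrix.transpose_apply, hTdef, Finset.sum_mul, Finset.mul_sum,
        Matrix.of_apply]
      push_cast
      rw [Finset.sum_comm]
      refine Finset.sum_congr rfl fun a _ => Finset.sum_congr rfl fun b _ => ?_
      rw [ht, ht, hA]
      simp
      ring
    rw [hvo i j hij, mul_zero] at h2
    exact_mod_cast h2

end

/-! ### Zeros of a quadratic form modulo prime powers -/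

section

open Matrix Finset

/-- If both valuations were at most `m - 1`, their sum would be at most `2 m - 2 < k`. -/
theorem pow_dvd_or_pow_dvd_of_pow_dvd_mul {p : ℕ} (hp : p.Prime) {m k : ℕ} (hmk : 2 * m ≤ k + 1)
    {x y : ℤ} (h : (p : ℤ) ^ k ∣ x * y) : (p : ℤ) ^ m ∣ x ∨ (p : ℤ) ^ m ∣ y := by
  by_contra! hcon
  obtain ⟨h1, h2⟩ := hcon
  have hp' : Prime (p : ℤ) := Nat.prime_iff_prime_int.mp hp
  have e := emultiplicity_mul hp' (a := x) (b := y)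
  have a1 := emultiplicity_lt_iff_not_dvd.mpr h1
  have a2 := emultiplicity_lt_iff_not_dvd.mpr h2
  have a3 := le_emultiplicity_of_pow_dvd h
  rw [e] at a3
  obtain ⟨i, hi⟩ := ENat.ne_top_iff_exists.mp (ne_top_of_lt a1)
  obtain ⟨j, hj⟩ := ENat.ne_top_iff_exists.mp (ne_top_of_lt a2)
  rw [← hi, ← hj] at a3
  rw [← hi] at a1
  rw [← hj] at a2
  norm_cast at a1 a2 a3
  omega

/-- Differences of solutions are killed by `u`, and a cyclic group has at most `|u|` such elements.
The bound does not depend on `n`. -/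
theorem card_filter_intCast_mul_eq_le {n : ℕ} [NeZero n] {u : ℤ} (hu : u ≠ 0) (y : ZMod n) :
    #{x : ZMod n | (u : ZMod n) * x = y} ≤ u.natAbs := by
  rcases Finset.eq_empty_or_nonempty ({x : ZMod n | (u : ZMod n) * x = y} : Finset (ZMod n)) with h | ⟨x0, hx0⟩
  · simp [h]
  · refine le_trans ?_ (IsAddCyclic.card_nsmul_eq_zero_le (α := ZMod n) (Int.natAbs_pos.mpr hu))
    refine Finset.card_le_card_of_injOn (fun x => x - x0) (fun x hx => ?_) (fun a _ b _ h => by simpa using h)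
    simp only [coe_filter, mem_filter, mem_univ, true_and, Set.mem_ofPred_eq] at hx hx0 ⊢
    have h0 : (u : ZMod n) * (x - x0) = 0 := by rw [mul_sub, hx, hx0, sub_self]
    rcases Int.natAbs_eq u with h | h
    · rw [h] at h0; simpa using h0
    · rw [h] at h0; simpa using h0

theorem card_filter_castHom_mem_le {n m : ℕ} [NeZero n] [NeZero m] (h : m ∣ n) (S : Finset (ZMod m)) :
    #{t : ZMod n | ZMod.castHom h (ZMod m) t ∈ S} = #S * (n / m) := by
  have hsurj : Function.Surjective (ZMod.castHom h (ZMod m)) := ZMod.castHom_surjective h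
  have hf : ∀ x : ZMod m, #{t : ZMod n | ZMod.castHom h (ZMod m) t = x} =
      #{t : ZMod n | ZMod.castHom h (ZMod m) t = 0} := fun x => by
    exact AddMonoidHom.card_fiber_eq_of_mem_range (ZMod.castHom h (ZMod m)) (hsurj x) (hsurj 0)
  have tot : ∀ T : Finset (ZMod m), #{t : ZMod n | ZMod.castHom h (ZMod m) t ∈ T} =
      #T * #{t : ZMod n | ZMod.castHom h (ZMod m) t = 0} := fun T => by
    rw [card_eq_sum_card_fiberwise (f := ZMod.castHom h (ZMod m)) (t := T) (fun x hx => mem_coe.mpr (mem_filter.mp (mem_coe.mp hx)).2)]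
    rw [← smul_eq_mul, ← sum_const]
    refine sum_congr rfl fun x hx => ?_
    rw [← hf x, filter_filter]
    congr 1
    ext t
    simp only [mem_filter, mem_univ, true_and]
    exact ⟨fun h => h.2, fun h => ⟨h ▸ hx, h⟩⟩
  rw [tot S]
  congr 1
  have h1 := tot Finset.univ
  simp only [mem_univ, filter_true, card_univ, ZMod.card] at h1
  exact (Nat.div_eq_of_eq_mul_right (Nat.pos_of_ne_zero (NeZero.ne m)) h1).symm

/-- A quadratic congruence with leading coefficient `u` has few solutions modulo `p ^ a`. -/
theorem card_quadratic_roots_le {p : ℕ} (hp : p.Prime) (a c : ℕ) [NeZero (p ^ a)] {u : ℤ}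
    (hu : u ≠ 0) (A B : ZMod (p ^ a)) :
    (#{t : ZMod (p ^ a) | (p : ZMod (p ^ a)) ^ c * (A + B * t + u * t ^ 2) = 0} : ℝ) ≤
      2 * u.natAbs * (p : ℝ) ^ (((a : ℝ) + c) / 2) := by
  have hp1 : (1 : ℝ) ≤ p := by exact_mod_cast hp.one_lt.le
  have hu1 : (1 : ℝ) ≤ u.natAbs := by exact_mod_cast Int.natAbs_pos.mpr hu
  rcases le_or_gt a c with hac | hac
  · have h1 : (#{t : ZMod (p ^ a) | (p : ZMod (p ^ a)) ^ c * (A + B * t + u * t ^ 2) = 0} : ℝ) ≤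
        (p : ℝ) ^ a := by
      have := card_le_univ ({t : ZMod (p ^ a) | (p : ZMod (p ^ a)) ^ c * (A + B * t + u * t ^ 2) = 0} : Finset _)
      rw [ZMod.card] at this
      exact_mod_cast this
    have h2 : (p : ℝ) ^ a ≤ (p : ℝ) ^ (((a : ℝ) + c) / 2) := by
      rw [← Real.rpow_natCast]
      refine Real.rpow_le_rpow_of_exponent_le hp1 ?_
      have : (a : ℝ) ≤ c := by exact_mod_cast hac
      linarith
    have : 0 ≤ (p : ℝ) ^ (((a : ℝ) + c) / 2) := by positivity
    nlinarith
  obtain ⟨k, rfl⟩ := Nat.exists_eq_add_of_lt hac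
  -- Here `a - c = k + 1` and `m` is half of it, rounded up. Subtracting the equations of two roots
  -- `t`, `t0` gives `p ^ (k + 1) ∣ (t - t0) (u t + B + u t0)`, so `p ^ m` divides one factor. This
  -- leaves at most `1 + |u|` classes modulo `p ^ m`, for every `p`, including 2 and the divisors of
  -- `u`.
  set m := (k + 2) / 2 with hm
  have hma : p ^ m ∣ p ^ (c + k + 1) := pow_dvd_pow p (by omega)
  have : NeZero (p ^ m) := ⟨pow_ne_zero _ hp.ne_zero⟩
  set φ := ZMod.castHom hma (ZMod (p ^ m)) with hφ
  rcases Finset.eq_empty_or_nonempty ({t : ZMod (p ^ (c + k + 1)) |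
      (p : ZMod (p ^ (c + k + 1))) ^ c * (A + B * t + u * t ^ 2) = 0} : Finset _) with h0 | ⟨t0, ht0⟩
  · rw [h0]; simp; positivity
  have key : ∀ t : ZMod (p ^ (c + k + 1)), (p : ZMod (p ^ (c + k + 1))) ^ c * (A + B * t + u * t ^ 2) = 0 →
      φ t = φ t0 ∨ (u : ZMod (p ^ m)) * φ t = - φ B - u * φ t0 := by
    intro t ht
    simp only [mem_filter, mem_univ, true_and] at ht0
    obtain ⟨τ, rfl⟩ := ZMod.intCast_surjective t
    obtain ⟨τ0, rfl⟩ := ZMod.intCast_surjective t0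
    obtain ⟨b, rfl⟩ := ZMod.intCast_surjective B
    have h1 : (((p : ℤ) ^ c * ((τ - τ0) * (u * τ + b + u * τ0)) : ℤ) : ZMod (p ^ (c + k + 1))) = 0 := by
      push_cast
      linear_combination ht - ht0
    rw [ZMod.intCast_zmod_eq_zero_iff_dvd] at h1
    push_cast at h1
    have h2 : (p : ℤ) ^ (k + 1) ∣ (τ - τ0) * (u * τ + b + u * τ0) := by
      rw [add_assoc, pow_add] at h1
      exact Int.dvd_of_mul_dvd_mul_left (pow_ne_zero _ (by exact_mod_cast hp.ne_zero)) h1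
    rcases pow_dvd_or_pow_dvd_of_pow_dvd_mul hp (m := m) (by omega) h2 with h3 | h3
    · left
      have : ((τ - τ0 : ℤ) : ZMod (p ^ m)) = 0 := by
        rw [ZMod.intCast_zmod_eq_zero_iff_dvd]; exact_mod_cast h3
      push_cast at this
      simpa using sub_eq_zero.mp this
    · right
      have : ((u * τ + b + u * τ0 : ℤ) : ZMod (p ^ m)) = 0 := by
        rw [ZMod.intCast_zmod_eq_zero_iff_dvd]; exact_mod_cast h3
      push_cast at this
      simp only [map_intCast]
      linear_combination this
  set S : Finset (ZMod (p ^ m)) := {φ t0} ∪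
    ({x : ZMod (p ^ m) | (u : ZMod (p ^ m)) * x = - φ B - u * φ t0} : Finset _) with hS
  have hScard : #S ≤ 1 + u.natAbs := (card_union_le _ _).trans
    (Nat.add_le_add (by simp) (card_filter_intCast_mul_eq_le hu _))
  have h1 : #{t : ZMod (p ^ (c + k + 1)) | (p : ZMod (p ^ (c + k + 1))) ^ c * (A + B * t + u * t ^ 2) = 0} ≤
      #S * (p ^ (c + k + 1) / p ^ m) := by
    rw [← card_filter_castHom_mem_le hma S]
    refine card_le_card fun t ht => ?_
    simp only [mem_filter, mem_univ, true_and] at ht ⊢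
    rw [hS, mem_union, mem_singleton, mem_filter]
    exact (key t ht).imp id fun h => ⟨mem_univ _, h⟩
  rw [Nat.pow_div (by omega) hp.pos] at h1
  have h2 : (#{t : ZMod (p ^ (c + k + 1)) | (p : ZMod (p ^ (c + k + 1))) ^ c * (A + B * t + u * t ^ 2) = 0} : ℝ) ≤
      (1 + u.natAbs) * (p : ℝ) ^ (c + k + 1 - m) := by
    exact_mod_cast h1.trans (Nat.mul_le_mul_right _ hScard)
  refine h2.trans ?_
  have h3 : (p : ℝ) ^ (c + k + 1 - m) ≤ (p : ℝ) ^ ((((c + k + 1 : ℕ) : ℝ) + c) / 2) := by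
    rw [← Real.rpow_natCast]
    refine Real.rpow_le_rpow_of_exponent_le hp1 ?_
    rw [le_div_iff₀ (by norm_num)]
    norm_cast
    omega
  have h4 : (1 : ℝ) + u.natAbs ≤ 2 * u.natAbs := by linarith
  gcongr

theorem quadEval_add_smul (M : Matrix (Fin 3) (Fin 3) ℤ) {R : Type*} [CommRing R] (f v : Fin 3 → R) :
    ∃ B : R, ∀ t : R, quadEval M (f + t • v) = quadEval M f + B * t + quadEval M v * t ^ 2 := by
  refine ⟨∑ i, ∑ j, (M i j : R) * (f i * v j + v i * f j), fun t => ?_⟩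
  simp only [quadEval, Finset.sum_mul, ← Finset.sum_add_distrib]
  refine Finset.sum_congr rfl fun i _ => Finset.sum_congr rfl fun j _ => ?_
  simp only [Pi.add_apply, Pi.smul_apply, smul_eq_mul]
  ring

theorem quadEval_intCast (M : Matrix (Fin 3) (Fin 3) ℤ) (R : Type*) [CommRing R] (v : Fin 3 → ℤ) :
    quadEval M (fun i => (v i : R)) = ((quadEval M v : ℤ) : R) := by
  simp [quadEval]

/-- Zeros of `p ^ c * Q` modulo `p ^ a`, for a ternary quadratic form `Q` with `Q v ≠ 0`. -/
theorem card_quadEval_zeros_le (M : Matrix (Fin 3) (Fin 3) ℤ) {v : Fin 3 → ℤ}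
    (hv : quadEval M v ≠ 0) {p : ℕ} (hp : p.Prime) (a c : ℕ) [NeZero (p ^ a)] :
    (#{f : Fin 3 → ZMod (p ^ a) | (p : ZMod (p ^ a)) ^ c * quadEval M f = 0} : ℝ) ≤
      2 * (quadEval M v).natAbs * (p : ℝ) ^ (((a : ℝ) + c) / 2) * (p : ℝ) ^ (2 * a) := by
  set V : Fin 3 → ZMod (p ^ a) := fun i => (v i : ZMod (p ^ a)) with hV
  set Z : Finset (Fin 3 → ZMod (p ^ a)) := {f | (p : ZMod (p ^ a)) ^ c * quadEval M f = 0} with hZ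
  -- Double counting along the lines in direction `v`: on each of them the form is a quadratic
  -- polynomial in `t` with the fixed nonzero integral leading coefficient `Q(v)`.
  have h1 : #Z * p ^ a = ∑ f : Fin 3 → ZMod (p ^ a), #{t : ZMod (p ^ a) | f + t • V ∈ Z} := by
    have e1 : ∀ t : ZMod (p ^ a), #{f : Fin 3 → ZMod (p ^ a) | f + t • V ∈ Z} = #Z := fun t => by
      refine card_bij (fun f _ => f + t • V) (fun f hf => by simpa using hf) (fun f _ g _ h => by simpa using h)
        fun g hg => ⟨g - t • V, by simpa using hg, by simp⟩
    have e2 := Finset.sum_card_bipartiteAbove_eq_sum_card_bipartiteBelow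
      (s := (univ : Finset (Fin 3 → ZMod (p ^ a)))) (t := (univ : Finset (ZMod (p ^ a))))
      (fun f t => f + t • V ∈ Z)
    simp only [bipartiteAbove, bipartiteBelow] at e2
    rw [e2, sum_congr rfl fun t _ => e1 t]
    simp [mul_comm]
  have h2 : ∀ f : Fin 3 → ZMod (p ^ a), (#{t : ZMod (p ^ a) | f + t • V ∈ Z} : ℝ) ≤
      2 * (quadEval M v).natAbs * (p : ℝ) ^ (((a : ℝ) + c) / 2) := fun f => by
    obtain ⟨B, hB⟩ := quadEval_add_smul M f V
    have := card_quadratic_roots_le hp a c hv (quadEval M f) B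
    refine le_trans (le_of_eq ?_) this
    congr 2
    ext t
    simp only [hZ, mem_filter, mem_univ, true_and, hB]
    rw [hV, quadEval_intCast]
  have h3 : (#Z : ℝ) * (p : ℝ) ^ a ≤ (p : ℝ) ^ (3 * a) *
      (2 * (quadEval M v).natAbs * (p : ℝ) ^ (((a : ℝ) + c) / 2)) := by
    have : ((#Z * p ^ a : ℕ) : ℝ) = _ := congrArg (Nat.cast : ℕ → ℝ) h1
    push_cast at this
    rw [this]
    refine (Finset.sum_le_card_nsmul _ _ _ fun f _ => h2 f).trans (le_of_eq ?_)
    rw [nsmul_eq_mul, card_univ, Fintype.card_fun, ZMod.card, Fintype.card_fin]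
    push_cast
    ring
  have hpa : (0 : ℝ) < (p : ℝ) ^ a := by
    have : (0 : ℝ) < p := by exact_mod_cast hp.pos
    positivity
  refine le_of_mul_le_mul_right (h3.trans (le_of_eq ?_)) hpa
  ring

end

/-! ### Character sums and zeros modulo a prime -/

section

open Matrix Finset

theorem card_fun_fin_three {F : Type*} [Fintype F] [DecidableEq F] (P : F → F → F → Prop)
    [∀ x y z, Decidable (P x y z)] :
    #{x : Fin 3 → F | P (x 0) (x 1) (x 2)} = ∑ y : F, ∑ z : F, #{x : F | P x y z} := by
  have e : #{x : Fin 3 → F | P (x 0) (x 1) (x 2)} = #{q : (F × F) × F | P q.2 q.1.1 q.1.2} := by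
    refine card_bij' (fun x _ => ((x 1, x 2), x 0)) (fun q _ => ![q.2, q.1.1, q.1.2])
      (by simp) (by simp) (fun x _ => ?_) (by simp)
    ext i
    fin_cases i <;> rfl
  rw [e, ← Fintype.sum_prod_type' (f := fun y z => #{x : F | P x y z}),
    card_eq_sum_card_fiberwise (f := Prod.fst) (t := univ) (by simp)]
  refine sum_congr rfl fun q _ => ?_
  refine card_bij' (fun r _ => r.2) (fun x _ => (q, x)) ?_ ?_ ?_ ?_
  · rintro ⟨r1, r2⟩ hr
    simp only [mem_filter, mem_univ, true_and] at hr ⊢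
    obtain ⟨h1, rfl⟩ := hr
    exact h1
  · intro x hx
    simpa using hx
  · rintro ⟨r1, r2⟩ hr
    simp only [mem_filter, mem_univ, true_and] at hr
    simp [hr.2]
  · simp

section CharacterSums

variable {F : Type*} [Field F] [Fintype F] [DecidableEq F]

theorem card_mul_sq_eq (hF : ringChar F ≠ 2) {a : F} (ha : a ≠ 0) (b : F) :
    (#{x : F | a * x ^ 2 = b} : ℤ) = quadraticChar F (a * b) + 1 := by
  have h := quadraticChar_card_sqrts hF (b * a⁻¹)
  have e : quadraticChar F (b * a⁻¹) = quadraticChar F (a * b) := by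
    rw [show a * b = (b * a⁻¹) * a ^ 2 by field_simp, map_mul _ (b * a⁻¹),
      quadraticChar_sq_one' ha, mul_one]
  rw [← e, ← h]
  congr 2
  ext x
  simp only [mem_filter, mem_univ, true_and, Set.mem_toFinset, Set.mem_ofPred_eq]
  rw [eq_mul_inv_iff_mul_eq₀ ha, mul_comm]

/-- Substituting `t = z ^ 2`, which has `1 + χ(t)` square roots, leaves a vanishing linear sum and
`∑ χ(t) χ(a + b t)`. For `t ≠ 0` the summand is `χ(a t⁻¹ + b)`, so the latter is a full linear sum
minus its value `χ(b)` at 0. -/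
theorem sum_quadraticChar_add_mul_sq (hF : ringChar F ≠ 2) {a b : F} (ha : a ≠ 0) (hb : b ≠ 0) :
    ∑ z : F, quadraticChar F (a + b * z ^ 2) = - quadraticChar F b := by
  have h1 : ∑ z : F, quadraticChar F (a + b * z ^ 2) =
      ∑ t : F, (quadraticChar F t + 1) * quadraticChar F (a + b * t) := by
    rw [← Finset.sum_fiberwise (s := univ) (g := fun z : F => z ^ 2)]
    refine sum_congr rfl fun t _ => ?_
    have := card_mul_sq_eq hF one_ne_zero t
    simp only [one_mul] at this
    rw [← this, ← nsmul_eq_mul, ← sum_const]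
    refine sum_congr rfl fun z hz => ?_
    rw [(mem_filter.mp hz).2]
  have h2 : ∑ t : F, quadraticChar F (a + b * t) = 0 := by
    rw [← quadraticChar_sum_zero hF]
    refine Fintype.sum_bijective (fun t => a + b * t) ⟨fun x y h => ?_, fun y => ⟨(y - a) / b, ?_⟩⟩ _ _
      fun _ => rfl
    · simpa [hb] using h
    · field_simp; ring
  have h3 : ∑ t : F, quadraticChar F t * quadraticChar F (a + b * t) = - quadraticChar F b := by
    have e1 : ∑ t : F, quadraticChar F t * quadraticChar F (a + b * t) =
        ∑ t ∈ univ.erase (0 : F), quadraticChar F (a * t + b) := by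
      rw [← Finset.sum_erase_add _ _ (mem_univ (0 : F))]
      simp only [MulChar.map_zero, zero_mul, add_zero]
      refine sum_nbij' (fun t => t⁻¹) (fun t => t⁻¹) (by simp) (by simp) (by simp) (by simp) ?_
      intro t ht
      have ht0 : t ≠ 0 := by simpa using ht
      rw [← map_mul, show t * (a + b * t) = (a * t⁻¹ + b) * t ^ 2 by field_simp, map_mul,
        quadraticChar_sq_one' ht0, mul_one]
    have e2 : ∑ t : F, quadraticChar F (a * t + b) = 0 := by
      rw [← quadraticChar_sum_zero hF]
      refine Fintype.sum_bijective (fun t => a * t + b) ⟨fun x y h => ?_, fun y => ⟨(y - b) / a, ?_⟩⟩ _ _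
        fun _ => rfl
      · simpa [ha] using h
      · field_simp; ring
    rw [e1]
    rw [← Finset.sum_erase_add _ _ (mem_univ (0 : F))] at e2
    simp only [mul_zero, zero_add] at e2
    linarith
  rw [h1]
  simp only [add_mul, one_mul, sum_add_distrib, h2, h3, add_zero]

theorem sum_quadraticChar_mul_sq (b : F) :
    ∑ z : F, quadraticChar F (b * z ^ 2) = (Fintype.card F - 1) * quadraticChar F b := by
  rw [← Finset.sum_erase_add _ _ (mem_univ (0 : F))]
  simp only [ne_eq, OfNat.ofNat_ne_zero, not_false_eq_true, zero_pow, mul_zero, MulChar.map_zero, add_zero]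
  rw [sum_congr rfl (g := fun _ => quadraticChar F b) fun z hz => by
    rw [map_mul, quadraticChar_sq_one' (by simpa using hz), mul_one]]
  rw [sum_const, card_erase_of_mem (mem_univ _), card_univ, nsmul_eq_mul,
    Nat.cast_sub (Fintype.card_pos)]
  simp

/-- Each of the `q - 1` values `y ≠ 0` contributes `-χ(b)`, and `y = 0` contributes `(q - 1) χ(b)`.
Hence a form of rank 3 has exactly `q ^ 2` zeros. -/
theorem sum_sum_quadraticChar_eq_zero (hF : ringChar F ≠ 2) {a b : F} (ha : a ≠ 0) (hb : b ≠ 0) :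
    ∑ y : F, ∑ z : F, quadraticChar F (a * y ^ 2 + b * z ^ 2) = 0 := by
  rw [← Finset.sum_erase_add _ _ (mem_univ (0 : F))]
  have h0 : ∀ y ∈ univ.erase (0 : F), ∑ z : F, quadraticChar F (a * y ^ 2 + b * z ^ 2) =
      - quadraticChar F b := fun y hy => sum_quadraticChar_add_mul_sq hF
    (mul_ne_zero ha (pow_ne_zero 2 (by simpa using hy))) hb
  rw [sum_congr rfl h0, sum_const, card_erase_of_mem (mem_univ _), card_univ, nsmul_eq_mul,
    Nat.cast_sub (Fintype.card_pos)]
  simp only [ne_eq, OfNat.ofNat_ne_zero, not_false_eq_true, zero_pow, mul_zero, zero_add,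
    sum_quadraticChar_mul_sq]
  push_cast
  ring

theorem card_diagonal_zeros (hF : ringChar F ≠ 2) {a : F} (ha : a ≠ 0) (b c : F) :
    (#{x : Fin 3 → F | a * x 0 ^ 2 + b * x 1 ^ 2 + c * x 2 ^ 2 = 0} : ℤ) =
      (Fintype.card F : ℤ) ^ 2 + ∑ y : F, ∑ z : F, quadraticChar F (-(a * b) * y ^ 2 + -(a * c) * z ^ 2) := by
  rw [card_fun_fin_three (fun x y z => a * x ^ 2 + b * y ^ 2 + c * z ^ 2 = 0)]
  push_cast
  have h : ∀ y z : F, (#{x : F | a * x ^ 2 + b * y ^ 2 + c * z ^ 2 = 0} : ℤ) =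
      1 + quadraticChar F (-(a * b) * y ^ 2 + -(a * c) * z ^ 2) := fun y z => by
    have := card_mul_sq_eq hF ha (-(b * y ^ 2 + c * z ^ 2))
    rw [show a * -(b * y ^ 2 + c * z ^ 2) = -(a * b) * y ^ 2 + -(a * c) * z ^ 2 by ring] at this
    rw [add_comm (1 : ℤ), ← this]
    congr 2
    ext x
    simp only [mem_filter, mem_univ, true_and]
    constructor <;> intro h <;> linear_combination h
  simp only [h, sum_add_distrib, sum_const, card_univ, nsmul_eq_mul, mul_one]
  ring

end CharacterSums

/-- `f` is a unimodular vector: its entries generate the unit ideal. -/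
def IsUnimodular {R : Type*} [CommRing R] (f : Fin 3 → R) : Prop := ∃ g : Fin 3 → R, g ⬝ᵥ f = 1

/-- The number of unimodular zeros modulo `n` of a ternary quadratic form. -/
noncomputable def unimodularZeroCount (M : Matrix (Fin 3) (Fin 3) ℤ) (n : ℕ) : ℕ :=
  Nat.card {f : Fin 3 → ZMod n // IsUnimodular f ∧ quadEval M f = 0}

/-- The diagonalising `T` is invertible only rationally, but modulo powers of a prime not dividing
`det T` it is a change of coordinates. -/
theorem unimodularZeroCount_congr (M T : Matrix (Fin 3) (Fin 3) ℤ) {n : ℕ}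
    (hT : IsUnit ((T.det : ℤ) : ZMod n)) :
    unimodularZeroCount (Tᵀ * M * T) n = unimodularZeroCount M n := by
  set U : Matrix (Fin 3) (Fin 3) (ZMod n) := T.map (Int.cast : ℤ → ZMod n) with hU
  have hUd : IsUnit U.det := by
    have := (Int.castRingHom (ZMod n)).map_det T
    simp only [eq_intCast, RingHom.mapMatrix_apply, Int.coe_castRingHom] at this
    rwa [hU, ← this]
  have uni : ∀ (A : Matrix (Fin 3) (Fin 3) (ZMod n)), IsUnit A.det → ∀ f : Fin 3 → ZMod n,
      IsUnimodular f → IsUnimodular (A *ᵥ f) := by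
    rintro A hA f ⟨g, hg⟩
    refine ⟨g ᵥ* A⁻¹, ?_⟩
    rw [Matrix.dotProduct_mulVec, Matrix.vecMul_vecMul, Matrix.nonsing_inv_mul _ hA,
      Matrix.vecMul_one, hg]
  refine Nat.card_congr ⟨fun f => ⟨U *ᵥ f.1, uni U hUd _ f.2.1, ?_⟩,
    fun f => ⟨U⁻¹ *ᵥ f.1, uni _ (by simpa using hUd) _ f.2.1, ?_⟩, ?_, ?_⟩
  · rw [hU, quadEval_mulVec]; exact f.2.2
  · rw [← quadEval_mulVec, ← hU, Matrix.mulVec_mulVec, Matrix.mul_nonsing_inv _ hUd, Matrix.one_mulVec]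
    exact f.2.2
  · intro f
    ext1
    simp only [Matrix.mulVec_mulVec, Matrix.nonsing_inv_mul _ hUd, Matrix.one_mulVec]
  · intro f
    ext1
    simp only [Matrix.mulVec_mulVec, Matrix.mul_nonsing_inv _ hUd, Matrix.one_mulVec]

theorem isUnimodular_of_isUnit {R : Type*} [CommRing R] {f : Fin 3 → R} {i : Fin 3} (h : IsUnit (f i)) :
    IsUnimodular f := by
  obtain ⟨u, hu⟩ := h
  exact ⟨Pi.single i (u⁻¹ : Rˣ), by rw [single_dotProduct, ← hu]; simp⟩

theorem isUnimodular_iff_ne_zero {F : Type*} [Field F] (f : Fin 3 → F) : IsUnimodular f ↔ f ≠ 0 := by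
  constructor
  · rintro ⟨g, hg⟩ rfl
    simp at hg
  · intro h
    obtain ⟨i, hi⟩ := Function.ne_iff.mp h
    exact isUnimodular_of_isUnit (i := i) (isUnit_iff_ne_zero.mpr hi)

theorem unimodularZeroCount_prime (M : Matrix (Fin 3) (Fin 3) ℤ) {p : ℕ} [Fact p.Prime] :
    unimodularZeroCount M p + 1 = #{f : Fin 3 → ZMod p | quadEval M f = 0} := by
  have h0 : (0 : Fin 3 → ZMod p) ∈ ({f : Fin 3 → ZMod p | quadEval M f = 0} : Finset _) := by
    rw [mem_filter]; simp [quadEval]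
  rw [← Finset.card_erase_add_one h0, unimodularZeroCount, ← Nat.card_eq_finsetCard]
  congr 1
  refine Nat.card_congr (Equiv.subtypeEquivRight fun f => ?_)
  simp [isUnimodular_iff_ne_zero]

/-- The number of zeros of a diagonal ternary form over `𝔽_p`, in terms of its rank. -/
theorem unimodularZeroCount_diag_prime {N : Matrix (Fin 3) (Fin 3) ℤ}
    (hN : ∀ i j, i ≠ j → N i j + N j i = 0) {p : ℕ} (hp : p.Prime) (hp2 : p ≠ 2)
    (h0 : ¬ (p : ℤ) ∣ N 0 0) (h1 : ¬ (p : ℤ) ∣ N 1 1 ∨ (N 1 1 = 0 ∧ N 2 2 = 0))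
    (h2 : ¬ (p : ℤ) ∣ N 2 2 ∨ N 2 2 = 0) :
    (unimodularZeroCount N p : ℤ) = (p - 1) * (p + 1 +
      p * if N 1 1 ≠ 0 ∧ N 2 2 = 0 then jacobiSym (-(N 0 0 * N 1 1)) p else 0) := by
  have : Fact p.Prime := ⟨hp⟩
  have hF : ringChar (ZMod p) ≠ 2 := by rwa [ZMod.ringChar_zmod_n]
  have nz : ∀ {z : ℤ}, ¬ (p : ℤ) ∣ z → (z : ZMod p) ≠ 0 := fun h h' =>
    h ((ZMod.intCast_zmod_eq_zero_iff_dvd _ _).mp h')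
  have c1 := card_diagonal_zeros hF (nz h0) (N 1 1 : ZMod p) (N 2 2 : ZMod p)
  have c2 := unimodularZeroCount_prime N (p := p)
  simp only [quadEval_diag hN, Fin.sum_univ_three] at c2
  rw [← c2, ZMod.card] at c1
  push_cast at c1
  have c3 : (unimodularZeroCount N p : ℤ) = p ^ 2 - 1 + ∑ y : ZMod p, ∑ z : ZMod p,
      quadraticChar (ZMod p) (-((N 0 0 : ZMod p) * N 1 1) * y ^ 2 + -((N 0 0 : ZMod p) * N 2 2) * z ^ 2) := by
    linarith
  rw [c3]
  rcases h1 with h1 | ⟨h1, h1'⟩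
  · have h1n : N 1 1 ≠ 0 := fun h => h1 (h ▸ dvd_zero _)
    rcases h2 with h2 | h2
    · have h2n : N 2 2 ≠ 0 := fun h => h2 (h ▸ dvd_zero _)
      rw [sum_sum_quadraticChar_eq_zero hF (neg_ne_zero.mpr (mul_ne_zero (nz h0) (nz h1)))
        (neg_ne_zero.mpr (mul_ne_zero (nz h0) (nz h2))), if_neg (by tauto)]
      ring
    · rw [if_pos ⟨h1n, h2⟩, h2]
      simp only [Int.cast_zero, mul_zero, neg_zero, zero_mul, add_zero, sum_const, card_univ, ZMod.card,
        nsmul_eq_mul]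
      rw [← mul_sum, sum_quadraticChar_mul_sq, ZMod.card, ← jacobiSym.legendreSym.to_jacobiSym, legendreSym]
      push_cast
      ring
  · rw [if_neg (by tauto), h1, h1']
    simp
    ring

end

/-! ### Zeros modulo the square of a prime -/

section

open Matrix Finset

section PrimeSquare

variable {p : ℕ} [hp : Fact p.Prime]

theorem isUnit_of_castHom_ne_zero {x : ZMod (p ^ 2)}
    (hx : ZMod.castHom (dvd_pow_self p two_ne_zero) (ZMod p) x ≠ 0) : IsUnit x := by
  obtain ⟨τ, rfl⟩ := ZMod.intCast_surjective x
  rw [map_intCast, Ne, ZMod.intCast_zmod_eq_zero_iff_dvd] at hx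
  rw [ZMod.coe_int_isUnit_iff_isCoprime]
  push_cast
  exact ((Nat.prime_iff_prime_int.mp hp.out).coprime_iff_not_dvd.mpr hx).pow_left

theorem sq_eq_zero_iff_castHom (x : ZMod (p ^ 2)) :
    x ^ 2 = 0 ↔ ZMod.castHom (dvd_pow_self p two_ne_zero) (ZMod p) x = 0 := by
  constructor
  · intro h
    have := congrArg (ZMod.castHom (dvd_pow_self p two_ne_zero) (ZMod p)) h
    rw [map_pow, map_zero] at this
    exact pow_eq_zero_iff two_ne_zero |>.mp this
  · obtain ⟨τ, rfl⟩ := ZMod.intCast_surjective x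
    rw [map_intCast, ZMod.intCast_zmod_eq_zero_iff_dvd]
    intro h
    have : (((τ ^ 2 : ℤ)) : ZMod (p ^ 2)) = 0 := by
      rw [ZMod.intCast_zmod_eq_zero_iff_dvd]
      push_cast
      exact pow_dvd_pow_of_dvd h 2
    exact_mod_cast this

theorem card_castHom_eq_zero :
    #{x : ZMod (p ^ 2) | ZMod.castHom (dvd_pow_self p two_ne_zero) (ZMod p) x = 0} = p := by
  have := card_filter_castHom_mem_le (dvd_pow_self p two_ne_zero) ({0} : Finset (ZMod p))
  simp only [mem_singleton, card_singleton, one_mul] at this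
  rw [this, pow_two, Nat.mul_div_cancel _ hp.out.pos]

theorem isUnit_intCast_of_not_dvd {a : ℤ} (ha : ¬ (p : ℤ) ∣ a) : IsUnit (a : ZMod (p ^ 2)) := by
  refine isUnit_of_castHom_ne_zero ?_
  rw [map_intCast, Ne, ZMod.intCast_zmod_eq_zero_iff_dvd]
  exact ha

/-- For `b = 0` the solutions are the `p` multiples of `p`. For `b ≠ 0` a solution `x0` is a unit,
so `p` cannot divide both `x - x0` and `x + x0`, and only `±x0` remain. -/
theorem card_unit_mul_sq_eq_le (hp2 : p ≠ 2) {a : ZMod (p ^ 2)} (ha : IsUnit a) (b : ZMod (p ^ 2)) :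
    #{x : ZMod (p ^ 2) | a * x ^ 2 = b} ≤ 2 + p * if b = 0 then 1 else 0 := by
  split_ifs with hb
  · subst hb
    rw [mul_one]
    refine le_trans (le_of_eq ?_) (Nat.le_add_left p 2)
    refine Eq.trans ?_ (card_castHom_eq_zero (p := p))
    congr 1
    ext x
    simp only [mem_filter, mem_univ, true_and]
    rw [ha.mul_right_eq_zero, sq_eq_zero_iff_castHom]
  · rw [mul_zero, add_zero]
    rcases Finset.eq_empty_or_nonempty ({x : ZMod (p ^ 2) | a * x ^ 2 = b} : Finset _) with h | ⟨x0, hx0⟩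
    · simp [h]
    · simp only [mem_filter, mem_univ, true_and] at hx0
      refine le_trans (card_le_card (t := {x0, -x0}) fun x hx => ?_) card_le_two
      simp only [mem_filter, mem_univ, true_and, mem_insert, mem_singleton] at hx ⊢
      have h0 : (x - x0) * (x + x0) = 0 := by
        have : a * ((x - x0) * (x + x0)) = 0 := by linear_combination hx - hx0
        rwa [ha.mul_right_eq_zero] at this
      set φ := ZMod.castHom (dvd_pow_self p two_ne_zero) (ZMod p)
      have hc : φ x0 ≠ 0 := fun h => hb (by rw [← hx0, (sq_eq_zero_iff_castHom x0).mpr h, mul_zero])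
      by_cases h1 : φ (x - x0) = 0
      · left
        have h2 : φ (x + x0) ≠ 0 := by
          intro h2
          have h3 : (2 : ZMod p) * φ x0 = 0 := by
            rw [map_sub] at h1
            rw [map_add] at h2
            linear_combination h2 - h1
          have h4 : (2 : ZMod p) ≠ 0 := by
            intro h
            have : ((2 : ℕ) : ZMod p) = 0 := by exact_mod_cast h
            rw [ZMod.natCast_eq_zero_iff] at this
            exact hp2 ((Nat.prime_dvd_prime_iff_eq hp.out Nat.prime_two).mp this)
          exact (mul_ne_zero h4 hc) h3
        rw [(isUnit_of_castHom_ne_zero h2).mul_left_eq_zero] at h0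
        exact sub_eq_zero.mp h0
      · right
        rw [(isUnit_of_castHom_ne_zero h1).mul_right_eq_zero] at h0
        exact eq_neg_of_add_eq_zero_left h0

theorem unimodularZeroCount_le (M : Matrix (Fin 3) (Fin 3) ℤ) (n : ℕ) [NeZero n] :
    unimodularZeroCount M n ≤ #{f : Fin 3 → ZMod n | quadEval M f = 0} := by
  rw [unimodularZeroCount, ← Nat.card_eq_finsetCard]
  exact Nat.card_le_card_of_injective
    (fun f => ⟨f.1, by rw [mem_filter]; exact ⟨mem_univ _, f.2.2⟩⟩)
    fun f g h => Subtype.ext (congrArg (fun x => x.1) h)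

/-- For rank at least 2: dividing by `φ(p ^ 2)` leaves `O(p ^ 2)` subalgebras of index `p ^ 2`, too
few to contribute a factor `ζ(2 s - 3)`. -/
theorem unimodularZeroCount_diag_prime_sq_le {N : Matrix (Fin 3) (Fin 3) ℤ}
    (hN : ∀ i j, i ≠ j → N i j + N j i = 0) (hp2 : p ≠ 2)
    (h0 : ¬ (p : ℤ) ∣ N 0 0) (h1 : ¬ (p : ℤ) ∣ N 1 1) :
    unimodularZeroCount N (p ^ 2) ≤ 4 * p ^ 4 := by
  refine (unimodularZeroCount_le N _).trans ?_
  set a : ZMod (p ^ 2) := (N 0 0 : ZMod (p ^ 2)) with ha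
  set b : ZMod (p ^ 2) := (N 1 1 : ZMod (p ^ 2)) with hb
  set c : ZMod (p ^ 2) := (N 2 2 : ZMod (p ^ 2)) with hc
  have e0 : #{f : Fin 3 → ZMod (p ^ 2) | quadEval N f = 0} = ∑ y : ZMod (p ^ 2), ∑ z : ZMod (p ^ 2),
      #{x : ZMod (p ^ 2) | a * x ^ 2 + b * y ^ 2 + c * z ^ 2 = 0} := by
    rw [← card_fun_fin_three (fun x y z : ZMod (p ^ 2) => a * x ^ 2 + b * y ^ 2 + c * z ^ 2 = 0)]
    congr 1
    ext f
    simp only [mem_filter, mem_univ, true_and, quadEval_diag hN, Fin.sum_univ_three, ha, hb, hc]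
  rw [e0]
  have e1 : ∀ y z : ZMod (p ^ 2), #{x : ZMod (p ^ 2) | a * x ^ 2 + b * y ^ 2 + c * z ^ 2 = 0} ≤
      2 + p * if b * y ^ 2 = - (c * z ^ 2) then 1 else 0 := fun y z => by
    have := card_unit_mul_sq_eq_le hp2 (isUnit_intCast_of_not_dvd h0) (-(b * y ^ 2 + c * z ^ 2))
    convert! this using 3
    · constructor <;> intro h <;> linear_combination h
    · congr 1
      apply propext
      constructor <;> intro h <;> linear_combination -h
  have e2 : ∀ z : ZMod (p ^ 2), #{y : ZMod (p ^ 2) | b * y ^ 2 = - (c * z ^ 2)} ≤ 2 + p := fun z => by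
    refine (card_unit_mul_sq_eq_le hp2 (isUnit_intCast_of_not_dvd h1) _).trans ?_
    split_ifs <;> omega
  calc _ ≤ ∑ y : ZMod (p ^ 2), ∑ z : ZMod (p ^ 2), (2 + p * if b * y ^ 2 = - (c * z ^ 2) then 1 else 0) :=
        sum_le_sum fun y _ => sum_le_sum fun z _ => e1 y z
    _ = 2 * p ^ 4 + p * ∑ z : ZMod (p ^ 2), #{y : ZMod (p ^ 2) | b * y ^ 2 = - (c * z ^ 2)} := by
        rw [sum_comm]
        simp only [sum_add_distrib, ← mul_sum, card_filter, sum_const, card_univ, ZMod.card, smul_eq_mul]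
        ring
    _ ≤ 2 * p ^ 4 + p * (p ^ 2 * (2 + p)) := by
        gcongr
        refine (sum_le_card_nsmul _ _ _ fun z _ => e2 z).trans (le_of_eq ?_)
        rw [card_univ, ZMod.card, smul_eq_mul]
    _ ≤ 4 * p ^ 4 := by
        have := hp.out.two_le
        have h3 : 2 * p ^ 3 ≤ p * p ^ 3 := Nat.mul_le_mul_right _ this
        nlinarith

/-- The form `a x ^ 2` vanishes as soon as `p ∣ x`, giving `p * p ^ 2 * p ^ 2` zeros, of which at
most `p ^ 3` (all coordinates divisible by `p`) are not unimodular. This excess of double zeros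
causes the second order of the pole in rank 1. -/
theorem unimodularZeroCount_diag_prime_sq_rank_one {N : Matrix (Fin 3) (Fin 3) ℤ}
    (hN : ∀ i j, i ≠ j → N i j + N j i = 0)
    (h0 : ¬ (p : ℤ) ∣ N 0 0) (h1 : N 1 1 = 0) (h2 : N 2 2 = 0) :
    unimodularZeroCount N (p ^ 2) ≤ p ^ 5 ∧ p ^ 5 ≤ unimodularZeroCount N (p ^ 2) + p ^ 3 := by
  have hq : ∀ x : Fin 3 → ZMod (p ^ 2), quadEval N x = 0 ↔
      ZMod.castHom (dvd_pow_self p two_ne_zero) (ZMod p) (x 0) = 0 := fun x => by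
    rw [quadEval_diag hN, Fin.sum_univ_three, h1, h2]
    simp only [Int.cast_zero, zero_mul, add_zero]
    rw [(isUnit_intCast_of_not_dvd h0).mul_right_eq_zero, sq_eq_zero_iff_castHom]
  have htot : #{f : Fin 3 → ZMod (p ^ 2) | quadEval N f = 0} = p ^ 5 := by
    simp only [hq]
    rw [card_fun_fin_three (fun x _ _ : ZMod (p ^ 2) =>
      ZMod.castHom (dvd_pow_self p two_ne_zero) (ZMod p) x = 0), card_castHom_eq_zero]
    simp only [sum_const, card_univ, ZMod.card, smul_eq_mul]
    ring
  refine ⟨htot ▸ unimodularZeroCount_le N _, ?_⟩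
  classical
  have h3 : unimodularZeroCount N (p ^ 2) =
      #{f : Fin 3 → ZMod (p ^ 2) | IsUnimodular f ∧ quadEval N f = 0} := by
    rw [unimodularZeroCount, ← Nat.card_eq_finsetCard]
    exact Nat.card_congr (Equiv.subtypeEquivRight fun f => by simp)
  have h4 : #(Fintype.piFinset fun _ : Fin 3 => ({x : ZMod (p ^ 2) |
      ZMod.castHom (dvd_pow_self p two_ne_zero) (ZMod p) x = 0} : Finset _)) = p ^ 3 := by
    rw [Fintype.card_piFinset, prod_const, card_castHom_eq_zero, card_univ, Fintype.card_fin]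
  rw [← htot, h3, ← h4]
  refine le_trans (card_le_card fun f hf => ?_) (card_union_le _ _)
  simp only [mem_union, mem_filter, mem_univ, true_and, Fintype.mem_piFinset] at hf ⊢
  by_cases hu : IsUnimodular f
  · exact Or.inl ⟨hu, hf⟩
  · refine Or.inr fun i => ?_
    by_contra h
    exact hu (isUnimodular_of_isUnit (isUnit_of_castHom_ne_zero h))

end PrimeSquare

end

/-! ### Kernels modulo n and the quadratic form of the bracket -/

section

open Matrix Finset

section Kernel

variable {L : Type*} [AddCommGroup L] (b : Module.Basis (Fin 3) ℤ L) {n : ℕ}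

/-- The kernel of the homomorphism `L → ℤ/n` with values `f` on the basis `b`. -/
noncomputable def modKer (f : Fin 3 → ZMod n) : Submodule ℤ L :=
  LinearMap.ker (b.constr ℤ f : L →ₗ[ℤ] ZMod n)

theorem mem_modKer {f : Fin 3 → ZMod n} {x : L} : x ∈ modKer b f ↔ b.constr ℤ f x = 0 :=
  LinearMap.mem_ker

theorem constr_eq_sum (f : Fin 3 → ZMod n) (x : L) :
    b.constr ℤ f x = ∑ i, ((b.repr x i : ℤ) : ZMod n) * f i := by
  rw [b.constr_apply_fintype ℤ]
  simp [zsmul_eq_mul]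

theorem exists_constr_eq_one {f : Fin 3 → ZMod n} (hf : IsUnimodular f) :
    ∃ z : L, b.constr ℤ f z = 1 := by
  obtain ⟨g, hg⟩ := hf
  choose g' hg' using fun i => ZMod.intCast_surjective (g i)
  refine ⟨∑ i, g' i • b i, ?_⟩
  rw [map_sum, ← hg, dotProduct]
  refine Finset.sum_congr rfl fun i _ => ?_
  rw [map_zsmul, b.constr_basis, zsmul_eq_mul, hg']

theorem isUnimodular_iff_surjective {f : Fin 3 → ZMod n} :
    IsUnimodular f ↔ Function.Surjective (b.constr ℤ f : L →ₗ[ℤ] ZMod n) := by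
  constructor
  · intro hf y
    obtain ⟨z, hz⟩ := exists_constr_eq_one b hf
    obtain ⟨k, rfl⟩ := ZMod.intCast_surjective y
    exact ⟨k • z, by rw [map_zsmul, hz, zsmul_eq_mul, mul_one]⟩
  · intro hs
    obtain ⟨z, hz⟩ := hs 1
    rw [constr_eq_sum] at hz
    exact ⟨fun i => (b.repr z i : ZMod n), hz⟩

theorem constr_smul_vec (u : ZMod n) (f : Fin 3 → ZMod n) (x : L) :
    b.constr ℤ (u • f) x = u * b.constr ℤ f x := by
  simp only [constr_eq_sum, Finset.mul_sum, Pi.smul_apply, smul_eq_mul]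
  exact Finset.sum_congr rfl fun i _ => by ring

theorem modKer_unit_smul (u : (ZMod n)ˣ) (f : Fin 3 → ZMod n) :
    modKer b ((u : ZMod n) • f) = modKer b f := by
  ext x
  rw [mem_modKer, mem_modKer, constr_smul_vec, Units.mul_right_eq_zero]

theorem IsUnimodular.unit_smul {R : Type*} [CommRing R] {f : Fin 3 → R} (hf : IsUnimodular f) (u : Rˣ) :
    IsUnimodular ((u : R) • f) := by
  obtain ⟨g, hg⟩ := hf
  exact ⟨((u⁻¹ : Rˣ) : R) • g, by simp [dotProduct_smul, smul_dotProduct, hg]⟩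

theorem constr_eq_mul_of_modKer_le {f f' : Fin 3 → ZMod n} (h : modKer b f ≤ modKer b f') {z : L}
    (hz : b.constr ℤ f z = 1) (x : L) : b.constr ℤ f' x = b.constr ℤ f' z * b.constr ℤ f x := by
  obtain ⟨k, hk⟩ := ZMod.intCast_surjective (b.constr ℤ f x)
  have h1 : x - k • z ∈ modKer b f := by
    rw [mem_modKer, map_sub, map_zsmul, hz, zsmul_eq_mul, mul_one, hk, sub_self]
  have h2 := mem_modKer b |>.mp (h h1)
  rw [map_sub, map_zsmul, zsmul_eq_mul, hk] at h2
  linear_combination h2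

theorem modKer_eq_iff {f f' : Fin 3 → ZMod n} (hf : IsUnimodular f) (hf' : IsUnimodular f') :
    modKer b f = modKer b f' ↔ ∃ u : (ZMod n)ˣ, f' = (u : ZMod n) • f := by
  constructor
  · intro h
    obtain ⟨z, hz⟩ := exists_constr_eq_one b hf
    obtain ⟨z', hz'⟩ := exists_constr_eq_one b hf'
    have h1 := constr_eq_mul_of_modKer_le b h.le hz
    refine ⟨⟨b.constr ℤ f' z, b.constr ℤ f z', by rw [← h1, hz'], by rw [mul_comm, ← h1, hz']⟩, ?_⟩
    funext i
    have := h1 (b i)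
    simpa only [b.constr_basis, Pi.smul_apply, smul_eq_mul] using this
  · rintro ⟨u, rfl⟩
    exact (modKer_unit_smul b u f).symm

theorem index_modKer [NeZero n] {f : Fin 3 → ZMod n} (hf : IsUnimodular f) :
    (modKer b f).toAddSubgroup.index = n := by
  have h := AddSubgroup.index_ker (b.constr ℤ f : L →ₗ[ℤ] ZMod n).toAddMonoidHom
  have h2 : (modKer b f).toAddSubgroup = (b.constr ℤ f : L →ₗ[ℤ] ZMod n).toAddMonoidHom.ker := by
    ext x; rfl
  have h3 : (b.constr ℤ f : L →ₗ[ℤ] ZMod n).toAddMonoidHom.range = ⊤ :=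
    AddMonoidHom.range_eq_top.mpr ((isUnimodular_iff_surjective b).mp hf)
  rw [h2, h, h3]
  simp

end Kernel

/-- Counting a finite set through the fibres of a map onto it. -/
theorem ncard_image_mul_eq {α β : Type*} [Finite α] (F : α → β) (k : ℕ)
    (h : ∀ a, Nat.card {x // F x = F a} = k) : (Set.range F).ncard * k = Nat.card α := by
  have e : α ≃ Σ y : Set.range F, {x // F x = y} :=
    (Equiv.sigmaFiberEquiv (Set.rangeFactorization F)).symm.trans
      (Equiv.sigmaCongrRight fun y => Equiv.subtypeEquivRight fun x => by
        rw [Subtype.ext_iff]; rfl)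
  have : Fintype (Set.range F) := Fintype.ofFinite _
  rw [Nat.card_congr e, Nat.card_sigma, Finset.sum_congr rfl (g := fun _ => k) (by
    rintro ⟨_, a, rfl⟩ _; exact h a), Finset.sum_const, smul_eq_mul, Finset.card_univ,
    ← Nat.card_eq_fintype_card, Nat.card_coe_set_eq]

section Count

variable {L : Type*} [AddCommGroup L] (b : Module.Basis (Fin 3) ℤ L) {n : ℕ} [NeZero n]

theorem finite_modKer (P : (Fin 3 → ZMod n) → Prop) :
    {K | ∃ f : Fin 3 → ZMod n, IsUnimodular f ∧ P f ∧ K = modKer b f}.Finite := by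
  refine (Set.finite_range (modKer b (n := n))).subset ?_
  rintro _ ⟨f, _, _, rfl⟩
  exact ⟨f, rfl⟩

/-- The unit group acts freely on unimodular vectors, and by `modKer_eq_iff` its orbits are the
fibres of `modKer`. -/
theorem ncard_modKer_mul_totient {P : (Fin 3 → ZMod n) → Prop}
    (hP : ∀ (u : (ZMod n)ˣ) f, P f → P ((u : ZMod n) • f)) :
    {K | ∃ f : Fin 3 → ZMod n, IsUnimodular f ∧ P f ∧ K = modKer b f}.ncard * n.totient =
      Nat.card {f : Fin 3 → ZMod n // IsUnimodular f ∧ P f} := by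
  rw [← ncard_image_mul_eq (fun f : {f : Fin 3 → ZMod n // IsUnimodular f ∧ P f} => modKer b f.1)
    n.totient]
  · congr 2
    ext K
    constructor
    · rintro ⟨f, h1, h2, rfl⟩
      exact ⟨⟨f, h1, h2⟩, rfl⟩
    · rintro ⟨⟨f, h1, h2⟩, rfl⟩
      exact ⟨f, h1, h2, rfl⟩
  · rintro ⟨f, h1, h2⟩
    rw [← ZMod.card_units_eq_totient, ← Nat.card_eq_fintype_card]
    symm
    refine Nat.card_congr (Equiv.ofBijective (fun u => ⟨⟨(u : ZMod n) • f, h1.unit_smul u, hP u f h2⟩,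
      modKer_unit_smul b u f⟩) ⟨fun u v huv => ?_, ?_⟩)
    · have h3 : (u : ZMod n) • f = (v : ZMod n) • f := congrArg (fun x => x.1.1) huv
      obtain ⟨g, hg⟩ := h1
      have h4 := congrArg (fun x => g ⬝ᵥ x) h3
      simp only [dotProduct_smul, hg, smul_eq_mul, mul_one] at h4
      exact Units.ext h4
    · rintro ⟨⟨f', h1', h2'⟩, h3⟩
      obtain ⟨u, hu⟩ := (modKer_eq_iff b h1 h1').mp h3.symm
      exact ⟨u, by simp [hu]⟩

end Count

section Bracket

variable {L : Type*} [LieRing L] (b : Module.Basis (Fin 3) ℤ L)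

/-- The matrix of the ternary quadratic form `f ↦ ∑ f (e i) f [e (i + 1), e (i + 2)]` on the
dual of `L`. -/
noncomputable def bracketMatrix : Matrix (Fin 3) (Fin 3) ℤ :=
  Matrix.of fun i j => b.repr ⁅b (i + 1), b (i + 2)⁆ j

theorem quadEval_bracketMatrix {n : ℕ} (f : Fin 3 → ZMod n) :
    quadEval (bracketMatrix b) f = ∑ i, f i * b.constr ℤ f ⁅b (i + 1), b (i + 2)⁆ := by
  simp only [quadEval, bracketMatrix, Matrix.of_apply, constr_eq_sum, Finset.mul_sum]
  exact Finset.sum_congr rfl fun i _ => Finset.sum_congr rfl fun j _ => by ring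

/-- The alternating trilinear form `φ x * φ ⁅y, z⁆ + φ y * φ ⁅z, x⁆ + φ z * φ ⁅x, y⁆`. -/
noncomputable def bracketForm {R : Type*} [CommRing R] (φ : L →ₗ[ℤ] R) : L [⋀^Fin 3]→ₗ[ℤ] R where
  toFun v := φ (v 0) * φ ⁅v 1, v 2⁆ + φ (v 1) * φ ⁅v 2, v 0⁆ + φ (v 2) * φ ⁅v 0, v 1⁆
  map_update_add' v i x y := by
    have h01 : (0 : Fin 3) ≠ 1 := by omega
    have h02 : (0 : Fin 3) ≠ 2 := by omega
    have h12 : (1 : Fin 3) ≠ 2 := by omega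
    have hi : i = 0 ∨ i = 1 ∨ i = 2 := by omega
    rcases hi with rfl | rfl | rfl <;>
      simp only [Function.update_self, Function.update_of_ne h01, Function.update_of_ne h02,
        Function.update_of_ne h12, Function.update_of_ne h01.symm, Function.update_of_ne h02.symm,
        Function.update_of_ne h12.symm, map_add, lie_add, add_lie] <;> ring
  map_update_smul' v i k x := by
    have h01 : (0 : Fin 3) ≠ 1 := by omega
    have h02 : (0 : Fin 3) ≠ 2 := by omega
    have h12 : (1 : Fin 3) ≠ 2 := by omega
    have hi : i = 0 ∨ i = 1 ∨ i = 2 := by omega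
    rcases hi with rfl | rfl | rfl <;>
      simp only [Function.update_self, Function.update_of_ne h01, Function.update_of_ne h02,
        Function.update_of_ne h12, Function.update_of_ne h01.symm, Function.update_of_ne h02.symm,
        Function.update_of_ne h12.symm, map_zsmul, zsmul_eq_mul, smul_lie,
        lie_smul] <;> ring
  map_eq_zero_of_eq' v i j h hij := by
    have sk : ∀ x y : L, φ ⁅x, y⁆ = - φ ⁅y, x⁆ := fun x y => by rw [← map_neg, lie_skew]
    fin_cases i <;> fin_cases j <;> simp at h hij ⊢ <;> rw [h] <;> simp
    · rw [sk (v 1) (v 2)]; ring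
    · rw [sk (v 1) (v 2)]; ring
    · rw [sk (v 0) (v 2)]; ring
    · rw [sk (v 2) (v 0)]; ring
    · rw [sk (v 0) (v 1)]; ring
    · rw [sk (v 0) (v 1)]; ring

theorem bracketForm_apply {R : Type*} [CommRing R] (φ : L →ₗ[ℤ] R) (x y z : L) :
    bracketForm φ ![x, y, z] = φ x * φ ⁅y, z⁆ + φ y * φ ⁅z, x⁆ + φ z * φ ⁅x, y⁆ := rfl

theorem bracketForm_basis {n : ℕ} (f : Fin 3 → ZMod n) :
    bracketForm (b.constr ℤ f : L →ₗ[ℤ] ZMod n) b = quadEval (bracketMatrix b) f := by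
  rw [quadEval_bracketMatrix, Fin.sum_univ_three]
  simp only [← b.constr_basis ℤ f]
  rfl

/-- An alternating form of top degree is determined by its value on one basis. -/
theorem bracketForm_eq_det_smul {n : ℕ} (f : Fin 3 → ZMod n) (v : Fin 3 → L) :
    bracketForm (b.constr ℤ f : L →ₗ[ℤ] ZMod n) v = b.det v • quadEval (bracketMatrix b) f := by
  rw [← bracketForm_basis]
  have h : bracketForm (b.constr ℤ f : L →ₗ[ℤ] ZMod n) =
      ((LinearMap.toSpanSingleton ℤ (ZMod n) (bracketForm (b.constr ℤ f : L →ₗ[ℤ] ZMod n) b)).compAlternatingMap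
        b.det) := by
    refine Module.Basis.ext_alternating b fun w hw => ?_
    obtain ⟨σ, rfl⟩ : ∃ σ : Equiv.Perm (Fin 3), w = σ :=
      ⟨Equiv.ofBijective w (Finite.injective_iff_bijective.mp hw), rfl⟩
    have e1 := AlternatingMap.map_perm (bracketForm (b.constr ℤ f : L →ₗ[ℤ] ZMod n)) b σ
    have e2 := AlternatingMap.map_perm b.det b σ
    simp only [Function.comp_def] at e1 e2
    rw [e1, LinearMap.compAlternatingMap_apply, LinearMap.toSpanSingleton_apply, e2, b.det_self]
    rcases Int.units_eq_one_or (Equiv.Perm.sign σ) with h | h <;> rw [h] <;> simp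
  conv_lhs => rw [h]
  rfl

theorem det_basis_basis {L : Type*} [AddCommGroup L] (b : Module.Basis (Fin 3) ℤ L) (z : L) (i : Fin 3) :
    b.det ![b (i + 1), b (i + 2), z] = b.repr z i := by
  rw [Module.Basis.det_apply, Matrix.det_fin_three]
  simp only [Module.Basis.toMatrix_apply]
  fin_cases i <;> simp

/-- The kernel of a surjection `L → ℤ/n` is closed under brackets exactly if the corresponding
vector is a zero of the quadratic form of `L`. -/
theorem modKer_closed_iff {n : ℕ} {f : Fin 3 → ZMod n} (hf : IsUnimodular f) :
    (∀ x ∈ modKer b f, ∀ y ∈ modKer b f, ⁅x, y⁆ ∈ modKer b f) ↔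
      quadEval (bracketMatrix b) f = 0 := by
  obtain ⟨z, hz⟩ := exists_constr_eq_one b hf
  set φ : L →ₗ[ℤ] ZMod n := b.constr ℤ f with hφ
  have key : ∀ x ∈ modKer b f, ∀ y ∈ modKer b f,
      φ ⁅x, y⁆ = b.det ![x, y, z] • quadEval (bracketMatrix b) f := by
    intro x hx y hy
    rw [← bracketForm_eq_det_smul, ← hφ, bracketForm_apply, hz, (mem_modKer b).mp hx, (mem_modKer b).mp hy]
    ring
  constructor
  · intro h
    -- Any `x` differs from an element of the kernel by a multiple of `z`, and such a change leaves
    -- the alternating form with third argument `z` unaltered.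
    have h1 : ∀ x y : L, b.det ![x, y, z] • quadEval (bracketMatrix b) f = 0 := by
      intro x y
      obtain ⟨k, hk⟩ := ZMod.intCast_surjective (φ x)
      obtain ⟨l, hl⟩ := ZMod.intCast_surjective (φ y)
      have hx : x - k • z ∈ modKer b f := by
        rw [mem_modKer, map_sub, map_zsmul, ← hφ, hz, zsmul_eq_mul, mul_one, hk, sub_self]
      have hy : y - l • z ∈ modKer b f := by
        rw [mem_modKer, map_sub, map_zsmul, ← hφ, hz, zsmul_eq_mul, mul_one, hl, sub_self]
      have h2 := key _ hx _ hy
      rw [(mem_modKer b).mp (h _ hx _ hy)] at h2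
      rw [← bracketForm_eq_det_smul, bracketForm_apply] at h2 ⊢
      rw [h2]
      simp only [map_sub, map_zsmul, lie_sub, sub_lie, lie_self, zsmul_eq_mul, zsmul_lie, lie_zsmul]
      have sk : ∀ x y : L, b.constr ℤ f ⁅x, y⁆ = - b.constr ℤ f ⁅y, x⁆ := fun x y => by
        rw [← map_neg, lie_skew]
      simp only [map_zero]
      rw [sk z x, sk z y]
      ring
    -- Taking two basis vectors for `x`, `y` makes the determinant a coordinate of `z`. The
    -- combination of these coordinates with the weights `f i` is `φ z = 1`.
    have h3 : ∀ i, ((b.repr z i : ℤ) : ZMod n) * quadEval (bracketMatrix b) f = 0 := fun i => by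
      rw [← zsmul_eq_mul, ← det_basis_basis b z i]
      exact h1 _ _
    rw [← one_mul (quadEval (bracketMatrix b) f), ← hz, hφ, constr_eq_sum, Finset.sum_mul]
    refine Finset.sum_eq_zero fun i _ => ?_
    linear_combination f i * h3 i
  · intro h x hx y hy
    rw [mem_modKer, ← hφ, key x hx y hy, h, smul_zero]

end Bracket

end

/-! ### Submodules ⟨w⟩ + qK and elementary divisors -/

section

open Matrix Finset

theorem ncard_image_mul_le {α β : Type*} [Finite α] (F : α → β) (k : ℕ)
    (h : ∀ a, k ≤ Nat.card {x // F x = F a}) : (Set.range F).ncard * k ≤ Nat.card α := by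
  have e : α ≃ Σ y : Set.range F, {x // F x = y} :=
    (Equiv.sigmaFiberEquiv (Set.rangeFactorization F)).symm.trans
      (Equiv.sigmaCongrRight fun y => Equiv.subtypeEquivRight fun x => by
        rw [Subtype.ext_iff]; rfl)
  have : Fintype (Set.range F) := Fintype.ofFinite _
  have h2 : Finset.card (Finset.univ : Finset (Set.range F)) • k ≤
      ∑ y : Set.range F, Nat.card {x // F x = y} :=
    Finset.card_nsmul_le_sum _ _ _ (by rintro ⟨_, a, rfl⟩ _; exact h a)
  rw [Nat.card_congr e, Nat.card_sigma]
  rwa [smul_eq_mul, Finset.card_univ, ← Nat.card_eq_fintype_card, Nat.card_coe_set_eq] at h2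

section Cyclic

variable {K : Type*} [AddCommGroup K]

/-- The submodule generated by `w` and all multiples of `q`. -/
def cyclicOver (q : ℕ) (w : K) : Submodule ℤ K :=
  Submodule.span ℤ {w} ⊔ LinearMap.range (LinearMap.lsmul ℤ K (q : ℤ))

theorem mem_cyclicOver {q : ℕ} {w x : K} :
    x ∈ cyclicOver q w ↔ ∃ (k : ℤ) (y : K), x = k • w + (q : ℤ) • y := by
  simp only [cyclicOver, Submodule.mem_sup, Submodule.mem_span_singleton, LinearMap.mem_range,
    LinearMap.lsmul_apply]
  constructor
  · rintro ⟨_, ⟨k, rfl⟩, _, ⟨y, rfl⟩, rfl⟩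
    exact ⟨k, y, rfl⟩
  · rintro ⟨k, y, rfl⟩
    exact ⟨_, ⟨k, rfl⟩, _, ⟨y, rfl⟩, rfl⟩

theorem cyclicOver_le {q : ℕ} {w w' : K} (h : w ∈ cyclicOver q w') : cyclicOver q w ≤ cyclicOver q w' := by
  obtain ⟨k, y, rfl⟩ := mem_cyclicOver.mp h
  intro x hx
  obtain ⟨l, z, rfl⟩ := mem_cyclicOver.mp hx
  exact mem_cyclicOver.mpr ⟨l * k, l • y + z, by module⟩

variable (κ : Module.Basis (Fin 3) ℤ K) (q : ℕ)

/-- The vector with coordinates the standard representatives of `v`. -/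
noncomputable def liftVec (v : Fin 3 → ZMod q) : K := ∑ i, ((v i).val : ℤ) • κ i

theorem repr_liftVec (v : Fin 3 → ZMod q) (i : Fin 3) : κ.repr (liftVec κ q v) i = (v i).val := by
  rw [liftVec, κ.repr_sum_self]

theorem mem_cyclicOver_of_repr {w x : K} (k : ℤ)
    (h : ∀ i, ((κ.repr x i : ℤ) : ZMod q) = k * (κ.repr w i : ℤ)) : x ∈ cyclicOver q w := by
  have h1 : ∀ i, ∃ y : ℤ, κ.repr x i = k * κ.repr w i + q * y := fun i => by
    have h2 : ((κ.repr x i - k * κ.repr w i : ℤ) : ZMod q) = 0 := by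
      push_cast; rw [h i, sub_self]
    rw [ZMod.intCast_zmod_eq_zero_iff_dvd] at h2
    obtain ⟨y, hy⟩ := h2
    exact ⟨y, by linarith⟩
  choose y hy using h1
  refine mem_cyclicOver.mpr ⟨k, ∑ i, y i • κ i, ?_⟩
  refine κ.repr.injective (Finsupp.ext fun i => ?_)
  rw [map_add, map_zsmul, map_zsmul, Finsupp.add_apply, Finsupp.smul_apply, Finsupp.smul_apply,
    κ.repr_sum_self, hy]
  rfl

theorem cyclicOver_unit_smul [NeZero q] (v : Fin 3 → ZMod q) (u : (ZMod q)ˣ) :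
    cyclicOver q (liftVec κ q ((u : ZMod q) • v)) = cyclicOver q (liftVec κ q v) := by
  obtain ⟨k, hk⟩ := ZMod.intCast_surjective (u : ZMod q)
  obtain ⟨k', hk'⟩ := ZMod.intCast_surjective ((u⁻¹ : (ZMod q)ˣ) : ZMod q)
  refine le_antisymm (cyclicOver_le (mem_cyclicOver_of_repr κ q k fun i => ?_))
    (cyclicOver_le (mem_cyclicOver_of_repr κ q k' fun i => ?_))
  · simp [repr_liftVec, hk]
  · simp [repr_liftVec, hk']

/-- The submodules of `K` generated by `q K` and a primitive vector. -/
def primitiveCyclicOver (K : Type*) [AddCommGroup K] (q : ℕ) : Set (Submodule ℤ K) :=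
  {N | ∃ (w : K) (h : K →ₗ[ℤ] ℤ), h w = 1 ∧ N = cyclicOver q w}

theorem primitiveCyclicOver_subset [NeZero q] : primitiveCyclicOver K q ⊆
    Set.range fun v : {v : Fin 3 → ZMod q // IsUnimodular v} => cyclicOver q (liftVec κ q v.1) := by
  rintro _ ⟨w, h, hw, rfl⟩
  refine ⟨⟨fun i => ((κ.repr w i : ℤ) : ZMod q), fun i => ((h (κ i) : ℤ) : ZMod q), ?_⟩, ?_⟩
  · rw [← κ.sum_repr w, map_sum] at hw
    have := congrArg (Int.cast : ℤ → ZMod q) hw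
    push_cast at this
    rw [dotProduct, ← this]
    refine Finset.sum_congr rfl fun i _ => ?_
    rw [map_zsmul]
    simp [mul_comm]
  · refine le_antisymm (cyclicOver_le (mem_cyclicOver_of_repr κ q 1 fun i => ?_))
      (cyclicOver_le (mem_cyclicOver_of_repr κ q 1 fun i => ?_))
    · simp [repr_liftVec]
    · simp [repr_liftVec]

include κ in
theorem primitiveCyclicOver_finite [NeZero q] : (primitiveCyclicOver K q).Finite :=
  (Set.finite_range _).subset (primitiveCyclicOver_subset κ q)

-- Such a submodule depends only on `w` modulo `q` up to units, so every fibre over the unimodular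
-- vectors modulo `q` has at least `φ(q)` elements.
include κ in
theorem ncard_primitiveCyclicOver_mul_totient_le [NeZero q] :
    (primitiveCyclicOver K q).ncard * q.totient ≤ q ^ 3 := by
  refine (Nat.mul_le_mul_right _ (Set.ncard_le_ncard (primitiveCyclicOver_subset κ q)
    (Set.finite_range _))).trans ?_
  refine (ncard_image_mul_le _ q.totient ?_).trans ?_
  · rintro ⟨v, hv⟩
    rw [← ZMod.card_units_eq_totient, ← Nat.card_eq_fintype_card]
    refine Nat.card_le_card_of_injective (fun u => ⟨⟨(u : ZMod q) • v, hv.unit_smul u⟩,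
      cyclicOver_unit_smul κ q v u⟩) fun u u' huv => ?_
    have h3 : (u : ZMod q) • v = (u' : ZMod q) • v := congrArg (fun x => x.1.1) huv
    obtain ⟨g, hg⟩ := hv
    have h4 := congrArg (fun x => g ⬝ᵥ x) h3
    simp only [dotProduct_smul, hg, smul_eq_mul, mul_one] at h4
    exact Units.ext h4
  · refine (Nat.card_le_card_of_injective Subtype.val Subtype.val_injective).trans (le_of_eq ?_)
    rw [Nat.card_eq_fintype_card, Fintype.card_fun, ZMod.card, Fintype.card_fin]

end Cyclic

/-- Elementary divisor theorem for submodules of prime power index. -/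
theorem exists_adapted_basis {L : Type*} [AddCommGroup L] (b : Module.Basis (Fin 3) ℤ L)
    (N : Submodule ℤ L) {p n : ℕ} (hp : p.Prime) (hN : N.toAddSubgroup.index = p ^ n) :
    ∃ (u : Module.Basis (Fin 3) ℤ L) (e : Fin 3 → ℕ), Monotone e ∧ ∑ i, e i = n ∧
      ∀ x, x ∈ N ↔ ∀ i, (p : ℤ) ^ e i ∣ u.repr x i := by
  have : Module.Free ℤ L := Module.Free.of_basis b
  have : Module.Finite ℤ L := Module.Finite.of_basis b
  have hcard : Nat.card (L ⧸ N) = p ^ n := hN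
  have hfin : Finite (L ⧸ N) := Nat.finite_of_card_ne_zero (by rw [hcard]; exact pow_ne_zero _ hp.ne_zero)
  have hr := (Submodule.finiteQuotient_iff N).mp hfin
  set a := Submodule.smithNormalFormCoeffs b hr with ha
  set t := Submodule.smithNormalFormTopBasis b hr with ht
  have hbot := Submodule.smithNormalFormBotBasis_def b hr
  have hmem : ∀ x, x ∈ N ↔ ∀ i, a i ∣ t.repr x i := by
    intro x
    constructor
    · intro hx i
      have h1 := (Submodule.smithNormalFormBotBasis b hr).sum_repr ⟨x, hx⟩
      have h2 := congrArg (fun y : N => t.repr (y : L) i) h1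
      simp only [Submodule.coe_sum, Submodule.coe_smul, hbot, map_sum, map_zsmul, Finsupp.coe_finsetSum,
        Finset.sum_apply, Finsupp.smul_apply, ← ha, ← ht, t.repr_self] at h2
      rw [← h2]
      refine Finset.dvd_sum fun j _ => ?_
      rcases eq_or_ne j i with rfl | hji
      · simp
      · simp [hji]
    · intro h
      choose y hy using h
      rw [← t.sum_repr x]
      refine N.sum_mem fun i _ => ?_
      have : (t.repr x i) • t i = y i • ((Submodule.smithNormalFormBotBasis b hr i : N) : L) := by
        rw [hbot, hy, smul_smul, mul_comm]
      rw [this]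
      exact N.smul_mem _ (Subtype.coe_prop _)
  have hprod : ∏ i, (a i).natAbs = p ^ n := by
    rw [← hcard, Nat.card_congr (Submodule.quotientEquivPiZMod N b hr).toEquiv, Nat.card_pi]
    simp [Nat.card_zmod, ha]
  have hpow : ∀ i, ∃ k, (a i).natAbs = p ^ k := fun i => by
    obtain ⟨k, _, hk⟩ := (Nat.dvd_prime_pow hp).mp (hprod ▸ Finset.dvd_prod_of_mem (fun i => (a i).natAbs) (mem_univ i))
    exact ⟨k, hk⟩
  choose e he using hpow
  have hsum : ∑ i, e i = n := by
    simp only [he, Finset.prod_pow_eq_pow_sum] at hprod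
    exact Nat.pow_right_injective hp.two_le hprod
  refine ⟨t.reindex (Tuple.sort e).symm, e ∘ Tuple.sort e, Tuple.monotone_sort e, ?_, fun x => ?_⟩
  · rw [← hsum]
    exact Equiv.sum_comp (Tuple.sort e) e
  · rw [hmem]
    have h1 : ∀ i, a i ∣ t.repr x i ↔ (p : ℤ) ^ e i ∣ t.repr x i := fun i => by
      have : ((p : ℤ) ^ e i) = ((a i).natAbs : ℤ) := by rw [he]; push_cast; rfl
      rw [this, Int.natAbs_dvd]
    simp only [h1, Module.Basis.repr_reindex_apply, Function.comp_apply, Equiv.symm_symm]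
    exact (Equiv.forall_congr_left (Tuple.sort e).symm).trans (by simp)

end

/-! ### Classification of subalgebras of prime power index -/

section

open Matrix Finset

theorem pow_le_two_mul_totient {p : ℕ} (hp : p.Prime) (a : ℕ) : p ^ a ≤ 2 * (p ^ a).totient := by
  rcases Nat.eq_zero_or_pos a with rfl | ha
  · simp
  · obtain ⟨k, rfl⟩ := Nat.exists_eq_succ_of_ne_zero ha.ne'
    rw [Nat.totient_prime_pow_succ hp, pow_succ]
    have := hp.two_le
    calc p ^ k * p ≤ p ^ k * (2 * (p - 1)) := Nat.mul_le_mul_left _ (by omega)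
      _ = _ := by ring

theorem ncard_biUnion_le_mul {α β : Type*} {s : Set α} (hs : s.Finite) (f : α → Set β) (k : ℕ)
    (h : ∀ a ∈ s, (f a).ncard ≤ k) : (⋃ a ∈ s, f a).ncard ≤ s.ncard * k := by
  induction s, hs using Set.Finite.induction_on with
  | empty => simp
  | @insert a s ha hs ih =>
    rw [Set.biUnion_insert, Set.ncard_insert_of_notMem ha hs, add_mul, one_mul, add_comm]
    exact (Set.ncard_union_le _ _).trans (Nat.add_le_add (h a (Set.mem_insert _ _))
      (ih fun x hx => h x (Set.mem_insert_of_mem _ hx)))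

section Smith

variable {L : Type*} [LieRing L] (b : Module.Basis (Fin 3) ℤ L) (p : ℕ)

/-- Kernels of the surjections `φ : L → ℤ/p^a` with `p ^ c * Q(φ) = 0`. -/
def conicKernels (a c : ℕ) : Set (Submodule ℤ L) :=
  {K | ∃ f : Fin 3 → ZMod (p ^ a), IsUnimodular f ∧
    (p : ZMod (p ^ a)) ^ c * quadEval (bracketMatrix b) f = 0 ∧ K = modKer b f}

/-- The submodules `p ^ c (p ^ d K + ℤ w)`, with `K` in `conicKernels b p a c` and `w` primitive
in `K`. -/
def smithClass (a d c : ℕ) : Set (Submodule ℤ L) :=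
  ⋃ K ∈ conicKernels b p a c,
    (fun N : Submodule ℤ K => (N.map K.subtype).map (LinearMap.lsmul ℤ L ((p : ℤ) ^ c))) ''
      primitiveCyclicOver K (p ^ d)

variable {p} (hp : p.Prime)

include hp in
theorem finite_conicKernels (a c : ℕ) : (conicKernels b p a c).Finite := by
  have : NeZero (p ^ a) := ⟨pow_ne_zero _ hp.ne_zero⟩
  exact finite_modKer b fun f => (p : ZMod (p ^ a)) ^ c * quadEval (bracketMatrix b) f = 0

theorem quadEval_smul (M : Matrix (Fin 3) (Fin 3) ℤ) {R : Type*} [CommRing R] (u : R) (f : Fin 3 → R) :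
    quadEval M (u • f) = u ^ 2 * quadEval M f := by
  simp only [quadEval, Finset.mul_sum, Pi.smul_apply, smul_eq_mul]
  exact Finset.sum_congr rfl fun i _ => Finset.sum_congr rfl fun j _ => by ring

include hp in
theorem ncard_conicKernels_mul_totient (a c : ℕ) :
    (conicKernels b p a c).ncard * (p ^ a).totient =
      Nat.card {f : Fin 3 → ZMod (p ^ a) // IsUnimodular f ∧
        (p : ZMod (p ^ a)) ^ c * quadEval (bracketMatrix b) f = 0} := by
  have : NeZero (p ^ a) := ⟨pow_ne_zero _ hp.ne_zero⟩
  refine ncard_modKer_mul_totient b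
    (P := fun f => (p : ZMod (p ^ a)) ^ c * quadEval (bracketMatrix b) f = 0) fun u f h => ?_
  rw [quadEval_smul]
  linear_combination (u : ZMod (p ^ a)) ^ 2 * h

include hp in
theorem ncard_conicKernels_le (a c : ℕ) [NeZero (p ^ a)] :
    (conicKernels b p a c).ncard * p ^ a ≤
      2 * #{f : Fin 3 → ZMod (p ^ a) | (p : ZMod (p ^ a)) ^ c * quadEval (bracketMatrix b) f = 0} := by
  refine (Nat.mul_le_mul_left _ (pow_le_two_mul_totient hp a)).trans ?_
  rw [mul_left_comm, ncard_conicKernels_mul_totient b hp]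
  refine Nat.mul_le_mul_left _ ?_
  rw [← Nat.card_eq_finsetCard]
  exact Nat.card_le_card_of_injective
    (fun f => ⟨f.1, by rw [mem_filter]; exact ⟨mem_univ _, f.2.2⟩⟩)
    fun f g h => Subtype.ext (congrArg (fun x => x.1) h)

theorem exists_basis_modKer {n : ℕ} [NeZero n] {f : Fin 3 → ZMod n} (hf : IsUnimodular f) :
    Nonempty (Module.Basis (Fin 3) ℤ (modKer b f)) := by
  have : Module.Free ℤ L := Module.Free.of_basis b
  have : Module.Finite ℤ L := Module.Finite.of_basis b
  have hcard : Nat.card (L ⧸ modKer b f) = n := index_modKer b hf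
  have hfin : Finite (L ⧸ modKer b f) := Nat.finite_of_card_ne_zero (by rw [hcard]; exact NeZero.ne n)
  have hr := (Submodule.finiteQuotient_iff _).mp hfin
  rw [Module.finrank_eq_card_basis b, Fintype.card_fin] at hr
  exact ⟨Module.finBasisOfFinrankEq ℤ _ hr⟩

include hp in
theorem smithClass_finite_and_ncard_le (a d c : ℕ) : (smithClass b p a d c).Finite ∧
    (smithClass b p a d c).ncard ≤ (conicKernels b p a c).ncard * (2 * p ^ (2 * d)) := by
  have : NeZero (p ^ a) := ⟨pow_ne_zero _ hp.ne_zero⟩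
  have : NeZero (p ^ d) := ⟨pow_ne_zero _ hp.ne_zero⟩
  have hfin : ∀ K ∈ conicKernels b p a c, (primitiveCyclicOver K (p ^ d)).Finite ∧
      (primitiveCyclicOver K (p ^ d)).ncard ≤ 2 * p ^ (2 * d) := by
    rintro _ ⟨f, hf, _, rfl⟩
    obtain ⟨κ⟩ := exists_basis_modKer b hf
    refine ⟨primitiveCyclicOver_finite κ _, ?_⟩
    have h1 := ncard_primitiveCyclicOver_mul_totient_le κ (p ^ d)
    have h2 := pow_le_two_mul_totient hp d
    have h3 : 0 < (p ^ d).totient := Nat.totient_pos.mpr (pow_pos hp.pos d)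
    refine Nat.le_of_mul_le_mul_right (h1.trans ?_) h3
    calc (p ^ d) ^ 3 = p ^ d * p ^ (2 * d) := by ring
      _ ≤ (2 * (p ^ d).totient) * p ^ (2 * d) := Nat.mul_le_mul_right _ h2
      _ = _ := by ring
  refine ⟨(finite_conicKernels b hp a c).biUnion fun K hK => (hfin K hK).1.image _, ?_⟩
  exact ncard_biUnion_le_mul (finite_conicKernels b hp a c) _ _ fun K hK =>
    (Set.ncard_image_le (hfin K hK).1).trans (hfin K hK).2

/-- The third coordinate with respect to a basis `u`, reduced modulo `n`, as a vector. -/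
noncomputable def coordVec (u : Module.Basis (Fin 3) ℤ L) (n : ℕ) : Fin 3 → ZMod n :=
  fun i => ((u.repr (b i) 2 : ℤ) : ZMod n)

theorem constr_coordVec (u : Module.Basis (Fin 3) ℤ L) (n : ℕ) (x : L) :
    b.constr ℤ (coordVec b u n) x = ((u.repr x 2 : ℤ) : ZMod n) := by
  conv_rhs => rw [← b.sum_repr x]
  rw [constr_eq_sum]
  simp only [map_sum, map_zsmul, Finsupp.coe_finsetSum, Finset.sum_apply, Finsupp.smul_apply, coordVec]
  push_cast
  simp

theorem isUnimodular_coordVec (u : Module.Basis (Fin 3) ℤ L) (n : ℕ) :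
    IsUnimodular (coordVec b u n) := by
  rw [isUnimodular_iff_surjective b]
  intro y
  obtain ⟨k, rfl⟩ := ZMod.intCast_surjective y
  exact ⟨k • u 2, by rw [constr_coordVec]; simp⟩

/-- The alternating form of the third coordinate, evaluated at `u` itself, reduces to the third
coordinate of `⁅u 0, u 1⁆`; passing from `b` to `u` costs only the determinant, a sign. -/
theorem quadEval_coordVec (u : Module.Basis (Fin 3) ℤ L) (n : ℕ) :
    ∃ ε : ℤˣ, quadEval (bracketMatrix b) (coordVec b u n) =
      (ε : ℤ) * ((u.repr ⁅u 0, u 1⁆ 2 : ℤ) : ZMod n) := by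
  have h := bracketForm_eq_det_smul b (coordVec b u n) ![u 0, u 1, u 2]
  rw [bracketForm_apply] at h
  simp only [constr_coordVec, Module.Basis.repr_self] at h
  have hu : ![u 0, u 1, u 2] = u := by
    funext i; fin_cases i <;> rfl
  rw [hu] at h
  obtain ⟨ε, hε⟩ := b.isUnit_det u
  refine ⟨ε, ?_⟩
  rw [← hε] at h
  have h2 : ((u.repr ⁅u 0, u 1⁆ 2 : ℤ) : ZMod n) = (ε : ℤ) * quadEval (bracketMatrix b) (coordVec b u n) := by
    simpa using h
  rw [h2, ← mul_assoc]
  rcases Int.units_eq_one_or ε with h | h <;> rw [h] <;> simp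

include hp in
/-- A subalgebra of index `p ^ n` lies in one of the classes `smithClass b p a d c`. -/
theorem exists_mem_smithClass (Λ : LieSubalgebra ℤ L) {n : ℕ}
    (hΛ : Λ.toSubmodule.toAddSubgroup.index = p ^ n) :
    ∃ a d c, a + 2 * d + 3 * c = n ∧ Λ.toSubmodule ∈ smithClass b p a d c ∧
      (d = 0 → c = 0 → Λ.toSubmodule ∈ conicKernels b p n 0) := by
  obtain ⟨u, e, hmono, hsum, hmem⟩ := exists_adapted_basis b Λ.toSubmodule hp hΛ
  obtain ⟨d, hd⟩ := Nat.exists_eq_add_of_le (hmono (show (0 : Fin 3) ≤ 1 by decide))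
  obtain ⟨a, ha⟩ := Nat.exists_eq_add_of_le (hmono (show (1 : Fin 3) ≤ 2 by decide))
  set c := e 0 with hc
  have hmem' : ∀ x, x ∈ Λ.toSubmodule ↔ (p : ℤ) ^ c ∣ u.repr x 0 ∧ (p : ℤ) ^ (c + d) ∣ u.repr x 1 ∧
      (p : ℤ) ^ (c + d + a) ∣ u.repr x 2 := fun x => by
    rw [hmem, Fin.forall_fin_succ, Fin.forall_fin_succ, Fin.forall_fin_succ]
    simp [ha, hd, ← hc]
  have hp0 : (p : ℤ) ≠ 0 := by exact_mod_cast hp.ne_zero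
  -- Closure is used for one pair only: the bracket of `p ^ c u 0` and `p ^ (c + d) u 1` has third
  -- coordinate divisible by `p ^ (c + d + a)`, and `p ^ (c + d)` cancels.
  have hrel : (p : ℤ) ^ a ∣ (p : ℤ) ^ c * u.repr ⁅u 0, u 1⁆ 2 := by
    have h0 : ((p : ℤ) ^ c) • u 0 ∈ Λ.toSubmodule := by
      rw [hmem']; simp
    have h1 : ((p : ℤ) ^ (c + d)) • u 1 ∈ Λ.toSubmodule := by
      rw [hmem']; simp
    have h2 : ⁅((p : ℤ) ^ c) • u 0, ((p : ℤ) ^ (c + d)) • u 1⁆ ∈ Λ.toSubmodule := Λ.lie_mem h0 h1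
    have h3 := ((hmem' _).mp h2).2.2
    rw [smul_lie, lie_smul, map_smul, map_smul, Finsupp.smul_apply, Finsupp.smul_apply, smul_eq_mul,
      smul_eq_mul, pow_add _ (c + d) a] at h3
    refine Int.dvd_of_mul_dvd_mul_left (pow_ne_zero (c + d) hp0) (h3.trans (dvd_of_eq ?_))
    ring
  have hK : ∀ m, (p : ℤ) ^ m ∣ (p : ℤ) ^ c * u.repr ⁅u 0, u 1⁆ 2 →
      modKer b (coordVec b u (p ^ m)) ∈ conicKernels b p m c := by
    intro m hm
    refine ⟨_, isUnimodular_coordVec b u _, ?_, rfl⟩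
    obtain ⟨ε, hε⟩ := quadEval_coordVec b u (p ^ m)
    have h1 : (((p : ℤ) ^ c * u.repr ⁅u 0, u 1⁆ 2 : ℤ) : ZMod (p ^ m)) = 0 := by
      rw [ZMod.intCast_zmod_eq_zero_iff_dvd]; exact_mod_cast hm
    push_cast at h1
    rw [hε]
    linear_combination ((ε : ℤ) : ZMod (p ^ m)) * h1
  have hKm : ∀ m (x : L), x ∈ modKer b (coordVec b u (p ^ m)) ↔ (p : ℤ) ^ m ∣ u.repr x 2 := fun m x => by
    rw [mem_modKer, constr_coordVec, ZMod.intCast_zmod_eq_zero_iff_dvd]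
    push_cast; rfl
  refine ⟨a, d, c, ?_, ?_, ?_⟩
  · rw [← hsum, Fin.sum_univ_three]; omega
  -- With `K` spanned by `u 0`, `u 1`, `p ^ a u 2`, the subalgebra is `p ^ c (ℤ u 0 + p ^ d K)`, and
  -- `u 0` is primitive because its first coordinate is 1.
  · have hu0 : u 0 ∈ modKer b (coordVec b u (p ^ a)) := by
      rw [hKm]; simp
    refine Set.mem_biUnion (hK a hrel) ⟨cyclicOver (p ^ d) ⟨u 0, hu0⟩,
      ⟨⟨u 0, hu0⟩, (u.coord 0).comp (Submodule.subtype _), by simp, rfl⟩, ?_⟩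
    ext x
    simp only [Submodule.mem_map, LinearMap.lsmul_apply, Submodule.subtype_apply]
    rw [hmem']
    constructor
    · rintro ⟨_, ⟨y, hy, rfl⟩, rfl⟩
      obtain ⟨k, z, rfl⟩ := mem_cyclicOver.mp hy
      have hz := (hKm a z).mp z.2
      simp only [Submodule.coe_add, Submodule.coe_smul, map_smul, map_add, Finsupp.smul_apply,
        Finsupp.add_apply, u.repr_self, smul_eq_mul]
      push_cast
      refine ⟨Dvd.intro _ rfl, ?_, ?_⟩
      · rw [pow_add]
        exact mul_dvd_mul_left _ (by simp)
      · rw [pow_add, pow_add, mul_assoc]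
        refine mul_dvd_mul_left _ ?_
        simpa using mul_dvd_mul_left ((p : ℤ) ^ d) hz
    · rintro ⟨⟨x0, h0⟩, ⟨x1, h1⟩, ⟨x2, h2⟩⟩
      have hy : x1 • u 1 + ((p : ℤ) ^ a * x2) • u 2 ∈ modKer b (coordVec b u (p ^ a)) := by
        rw [hKm]; simp
      refine ⟨_, ⟨x0 • ⟨u 0, hu0⟩ + ((p ^ d : ℕ) : ℤ) • ⟨_, hy⟩, mem_cyclicOver.mpr ⟨x0, ⟨_, hy⟩, rfl⟩, rfl⟩, ?_⟩
      conv_rhs => rw [← u.sum_repr x, Fin.sum_univ_three, h0, h1, h2]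
      simp only [Submodule.coe_add, Submodule.coe_smul]
      push_cast
      module
  · rintro rfl hc0
    rw [hc0] at hmem' hK hrel
    have han : a = n := by rw [← hsum, Fin.sum_univ_three]; omega
    subst han
    have := hK a hrel
    convert this using 1
    ext x
    rw [hmem', hKm]
    simp

end Smith

end

/-! ### Cotypes and multiplicativity of the counts -/

section

open Finset

theorem corankOfCotype_le_iff {d : ℕ} {α : Fin d → ℕ} {m : ℕ} :
    corankOfCotype α ≤ m ↔ ∀ i : Fin d, m ≤ i → α i = 1 := by
  simp only [corankOfCotype, Finset.sup_le_iff, mem_univ, forall_true_left]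
  refine forall_congr' fun i => ?_
  split_ifs with h
  · simp [h]
  · simp only [h, imp_false]; omega

section Cotype

variable {L : Type*} [LieRing L] {d : ℕ} {Λ : LieSubalgebra ℤ L} {α : Fin d → ℕ}

theorem isCotype_iff : IsCotype Λ α ↔ (∀ i, 0 < α i) ∧ (∀ i j, i ≤ j → α j ∣ α i) ∧
    ∃ φ : L →+ ((i : Fin d) → ZMod (α i)), Function.Surjective φ ∧ ∀ x, φ x = 0 ↔ x ∈ Λ := by
  refine and_congr_right fun _ => and_congr_right fun _ => ⟨?_, ?_⟩
  · rintro ⟨e⟩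
    refine ⟨e.toAddMonoidHom.comp Λ.toSubmodule.mkQ.toAddMonoidHom,
      e.surjective.comp Λ.toSubmodule.mkQ_surjective, fun x => ?_⟩
    simp
  · rintro ⟨φ, hφ, hk⟩
    have h1 : Λ.toSubmodule = LinearMap.ker φ.toIntLinearMap := by
      ext x
      exact (hk x).symm
    rw [h1]
    exact ⟨(φ.toIntLinearMap.quotKerEquivOfSurjective hφ).toAddEquiv⟩

theorem IsCotype.index_eq (h : IsCotype Λ α) : Λ.toSubmodule.toAddSubgroup.index = ∏ i, α i := by
  obtain ⟨_, _, ⟨e⟩⟩ := h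
  have : Λ.toSubmodule.toAddSubgroup.index = Nat.card (L ⧸ Λ.toSubmodule) := rfl
  rw [this, Nat.card_congr e.toEquiv, Nat.card_pi]
  simp

theorem smul_mem_of_index {n : ℕ} (h : Λ.toSubmodule.toAddSubgroup.index = n) (x : L) :
    (n : ℤ) • x ∈ Λ := by
  have := Λ.toSubmodule.toAddSubgroup.nsmul_index_mem x
  rw [h] at this
  rw [natCast_zsmul]
  exact this

/-- The subalgebra `Λ + n L`. -/
def addMultiples (Λ : LieSubalgebra ℤ L) (n : ℕ) : LieSubalgebra ℤ L where
  toSubmodule := Λ.toSubmodule ⊔ LinearMap.range (LinearMap.lsmul ℤ L (n : ℤ))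
  lie_mem' := by
    intro x y hx hy
    obtain ⟨a, ha, _, ⟨x, rfl⟩, rfl⟩ := Submodule.mem_sup.mp hx
    obtain ⟨b, hb, _, ⟨y, rfl⟩, rfl⟩ := Submodule.mem_sup.mp hy
    refine Submodule.mem_sup.mpr ⟨⁅a, b⁆, Λ.lie_mem ha hb, _,
      ⟨⁅a, y⁆ + ⁅x, b⁆ + (n : ℤ) • ⁅x, y⁆, rfl⟩, ?_⟩
    simp only [LinearMap.lsmul_apply, add_lie, lie_add, smul_lie, lie_smul, smul_add]
    abel

theorem mem_addMultiples {n : ℕ} {x : L} :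
    x ∈ addMultiples Λ n ↔ ∃ a ∈ Λ, ∃ y, x = a + (n : ℤ) • y := by
  rw [← LieSubalgebra.mem_toSubmodule, addMultiples]
  simp only [Submodule.mem_sup, LinearMap.mem_range, LinearMap.lsmul_apply, exists_exists_eq_and]
  exact exists_congr fun a => and_congr_right fun _ => exists_congr fun y => eq_comm

theorem IsCotype.addMultiples (h : IsCotype Λ α) (n : ℕ) :
    IsCotype (addMultiples Λ n) fun i => (α i).gcd n := by
  obtain ⟨hpos, hdvd, φ, hφ, hk⟩ := isCotype_iff.mp h
  refine isCotype_iff.mpr ⟨fun i => Nat.gcd_pos_of_pos_left _ (hpos i),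
    fun i j hij => Nat.gcd_dvd_gcd_of_dvd_left _ (hdvd i j hij), ?_⟩
  let r : ∀ i, ZMod (α i) →+* ZMod ((α i).gcd n) := fun i => ZMod.castHom (Nat.gcd_dvd_left _ _) _
  refine ⟨(AddMonoidHom.mk' (fun f i => r i (f i)) fun f g => by funext i; simp).comp φ, ?_, ?_⟩
  · intro g
    choose f hf using fun i => ZMod.castHom_surjective (Nat.gcd_dvd_left (α i) n) (g i)
    obtain ⟨x, rfl⟩ := hφ f
    exact ⟨x, funext hf⟩
  · intro x
    rw [mem_addMultiples]
    constructor
    · intro hx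
      have h1 : ∀ i, ∃ v : ZMod (α i), φ x i = (n : ℤ) • v := fun i => by
        obtain ⟨z, hz⟩ := ZMod.intCast_surjective (φ x i)
        have h2 : r i (φ x i) = 0 := congrFun hx i
        rw [← hz, map_intCast, ZMod.intCast_zmod_eq_zero_iff_dvd] at h2
        obtain ⟨w, rfl⟩ := h2
        refine ⟨((α i).gcdB n * w : ℤ), ?_⟩
        rw [← hz, Nat.gcd_eq_gcd_ab]
        push_cast
        simp
        ring
      choose v hv using h1
      obtain ⟨y, rfl⟩ := hφ v
      refine ⟨x - (n : ℤ) • y, ?_, y, by abel⟩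
      rw [← hk, map_sub, map_zsmul, sub_eq_zero]
      funext i
      rw [hv i]; rfl
    · rintro ⟨a, ha, y, rfl⟩
      funext i
      have h1 : ((n : ℕ) : ZMod ((α i).gcd n)) = 0 :=
        (ZMod.natCast_eq_zero_iff _ _).mpr (Nat.gcd_dvd_right _ _)
      simp [(hk a).mpr ha, h1]

theorem IsCotype.index_addMultiples (h : IsCotype Λ α) {m n : ℕ} (hmn : m.Coprime n)
    (hΛ : Λ.toSubmodule.toAddSubgroup.index = m * n) :
    (_root_.addMultiples Λ m).toSubmodule.toAddSubgroup.index = m := by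
  have hα := h.index_eq
  rw [hΛ] at hα
  rw [(h.addMultiples m).index_eq]
  have hfac : (∏ i, (α i).gcd m) * ∏ i, (α i).gcd n = m * n := by
    rw [hα, ← Finset.prod_mul_distrib]
    refine Finset.prod_congr rfl fun i _ => ?_
    rw [← hmn.gcd_mul, Nat.gcd_eq_left]
    rw [hα]
    exact dvd_prod_of_mem _ (mem_univ i)
  refine Nat.dvd_antisymm ?_ ?_
  · refine Nat.Coprime.dvd_of_dvd_mul_right (k := ∏ i, (α i).gcd m) (n := n) ?_ ⟨_, hfac.symm⟩
    exact Nat.Coprime.prod_left fun i _ => hmn.coprime_dvd_left (Nat.gcd_dvd_right _ _)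
  · refine Nat.Coprime.dvd_of_dvd_mul_right (k := m) (n := ∏ i, (α i).gcd n) ?_ ⟨_, hfac⟩
    exact Nat.Coprime.prod_right fun i _ => hmn.coprime_dvd_right (Nat.gcd_dvd_right _ _)

theorem IsCotype.inf {Λ' : LieSubalgebra ℤ L} {β : Fin d → ℕ} (h : IsCotype Λ α)
    (h' : IsCotype Λ' β) {m n : ℕ} (hmn : m.Coprime n) (hΛ : Λ.toSubmodule.toAddSubgroup.index = m)
    (hΛ' : Λ'.toSubmodule.toAddSubgroup.index = n) : IsCotype (Λ ⊓ Λ') fun i => α i * β i := by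
  have hα := h.index_eq
  have hβ := h'.index_eq
  obtain ⟨hpos, hdvd, φ, hφ, hk⟩ := isCotype_iff.mp h
  obtain ⟨hpos', hdvd', φ', hφ', hk'⟩ := isCotype_iff.mp h'
  refine isCotype_iff.mpr ⟨fun i => Nat.mul_pos (hpos i) (hpos' i),
    fun i j hij => mul_dvd_mul (hdvd i j hij) (hdvd' i j hij), ?_⟩
  have hcop : ∀ i, (α i).Coprime (β i) := fun i => by
    refine (hmn.coprime_dvd_left ?_).coprime_dvd_right ?_
    · rw [← hΛ, hα]; exact dvd_prod_of_mem _ (mem_univ i)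
    · rw [← hΛ', hβ]; exact dvd_prod_of_mem _ (mem_univ i)
  refine ⟨AddMonoidHom.mk' (fun x i => (ZMod.chineseRemainder (hcop i)).symm (φ x i, φ' x i))
    fun x y => ?_, fun g => ?_, fun x => ?_⟩
  · funext i
    simp only [map_add, Pi.add_apply]
    rw [← map_add]; rfl
  · obtain ⟨x, hx⟩ := hφ fun i => (ZMod.chineseRemainder (hcop i) (g i)).1
    obtain ⟨y, hy⟩ := hφ' fun i => (ZMod.chineseRemainder (hcop i) (g i)).2
    have hbez : (1 : ℤ) = m * m.gcdA n + n * m.gcdB n := by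
      rw [← Nat.gcd_eq_gcd_ab, hmn.gcd_eq_one]; rfl
    set s := m.gcdA n
    set t := m.gcdB n
    -- Chinese remaindering in `L`: this element is congruent to `x` modulo `m L ⊆ Λ` and to `y`
    -- modulo `n L ⊆ Λ'`.
    have hz : x + (m : ℤ) • (s • (y - x)) = y + (n : ℤ) • (t • (x - y)) := by
      have h2 : y - x = (m * s + n * t : ℤ) • (y - x) := by rw [← hbez, one_smul]
      have h3 : y = x + (m * s + n * t : ℤ) • (y - x) := by rw [← h2]; abel
      nth_rw 2 [h3]
      module
    refine ⟨x + (m : ℤ) • (s • (y - x)), ?_⟩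
    have e1 : φ (x + (m : ℤ) • (s • (y - x))) = φ x := by
      rw [map_add, (hk _).mpr (smul_mem_of_index hΛ _), add_zero]
    have e2 : φ' (x + (m : ℤ) • (s • (y - x))) = φ' y := by
      rw [hz, map_add, (hk' _).mpr (smul_mem_of_index hΛ' _), add_zero]
    funext i
    simp only [AddMonoidHom.mk'_apply]
    rw [e1, e2, hx, hy]
    exact (ZMod.chineseRemainder (hcop i)).symm_apply_apply _
  · have hval : ∀ i, (ZMod.chineseRemainder (hcop i)).symm (φ x i, φ' x i) = 0 ↔
        φ x i = 0 ∧ φ' x i = 0 := fun i => by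
      rw [EmbeddingLike.map_eq_zero_iff, Prod.mk_eq_zero]
    rw [LieSubalgebra.mem_inf, ← hk, ← hk']
    simp only [AddMonoidHom.mk'_apply, funext_iff, Pi.zero_apply, hval, forall_and]

end Cotype

section Multiplicative

variable {L : Type*} [LieRing L]

theorem subalgebraCount_one (m : ℕ) : subalgebraCount L m 1 = 1 := by
  rw [subalgebraCount, Set.ncard_eq_one]
  refine ⟨⊤, Set.eq_singleton_iff_unique_mem.mpr ⟨⟨by simp, fun _ => 1, ?_, ?_⟩, ?_⟩⟩
  · refine isCotype_iff.mpr ⟨by simp, by simp, 0, fun g => ⟨0, Subsingleton.elim _ _⟩, by simp⟩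
  · rw [corankOfCotype_le_iff]; simp
  · rintro Λ ⟨h, _⟩
    rw [AddSubgroup.index_eq_one] at h
    refine eq_top_iff.mpr fun x _ => ?_
    have : x ∈ Λ.toSubmodule.toAddSubgroup := by rw [h]; trivial
    exact this

/-- Intersection is a bijection from pairs of subalgebras of indices `m`, `n` to subalgebras of
index `m n`, with inverse `Λ ↦ (Λ + m L, Λ + n L)`. Cotypes multiply entrywise under it, so the
corank bound holds for the intersection exactly if it holds for both members. -/
theorem subalgebraCount_mul (r : ℕ) {m n : ℕ} (hmn : m.Coprime n) :
    subalgebraCount L r (m * n) = subalgebraCount L r m * subalgebraCount L r n := by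
  have hbez : (1 : ℤ) = m * m.gcdA n + n * m.gcdB n := by
    rw [← Nat.gcd_eq_gcd_ab, hmn.gcd_eq_one]; rfl
  have key : ∀ Λ Λ' : LieSubalgebra ℤ L, Λ.toSubmodule.toAddSubgroup.index = m →
      Λ'.toSubmodule.toAddSubgroup.index = n →
      addMultiples (Λ ⊓ Λ') m = Λ ∧ addMultiples (Λ ⊓ Λ') n = Λ' := by
    intro Λ Λ' h h'
    constructor
    · ext x
      rw [mem_addMultiples]
      constructor
      · rintro ⟨a, ha, y, rfl⟩
        exact Λ.add_mem ha.1 (smul_mem_of_index h y)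
      · intro hx
        refine ⟨(n : ℤ) • (m.gcdB n • x), ⟨Λ.smul_mem _ (Λ.smul_mem _ hx), smul_mem_of_index h' _⟩,
          m.gcdA n • x, ?_⟩
        rw [smul_smul, smul_smul, ← add_smul, add_comm, ← hbez, one_smul]
    · ext x
      rw [mem_addMultiples]
      constructor
      · rintro ⟨a, ha, y, rfl⟩
        exact Λ'.add_mem ha.2 (smul_mem_of_index h' y)
      · intro hx
        refine ⟨(m : ℤ) • (m.gcdA n • x), ⟨smul_mem_of_index h _, Λ'.smul_mem _ (Λ'.smul_mem _ hx)⟩,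
          m.gcdB n • x, ?_⟩
        rw [smul_smul, smul_smul, ← add_smul, ← hbez, one_smul]
  rw [subalgebraCount, subalgebraCount, subalgebraCount, ← Set.ncard_prod]
  symm
  refine Set.ncard_congr (fun P _ => P.1 ⊓ P.2) ?_ ?_ ?_
  · rintro ⟨Λ, Λ'⟩ ⟨⟨h1, α, hα, hα'⟩, ⟨h2, β, hβ, hβ'⟩⟩
    have h3 := hα.inf hβ hmn h1 h2
    refine ⟨?_, _, h3, ?_⟩
    · rw [h3.index_eq, Finset.prod_mul_distrib, ← hα.index_eq, ← hβ.index_eq, h1, h2]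
    · rw [corankOfCotype_le_iff] at *
      intro i hi
      rw [hα' i hi, hβ' i hi]
  · rintro ⟨Λ₁, Λ₁'⟩ ⟨Λ₂, Λ₂'⟩ ⟨⟨h1, _⟩, ⟨h1', _⟩⟩ ⟨⟨h2, _⟩, ⟨h2', _⟩⟩ heq
    have k1 := key _ _ h1 h1'
    have k2 := key _ _ h2 h2'
    dsimp only at heq k1 k2
    rw [heq] at k1
    exact Prod.ext (k1.1.symm.trans k2.1) (k1.2.symm.trans k2.2)
  · rintro Λ ⟨h, α, hα, hα'⟩
    rw [corankOfCotype_le_iff] at hα'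
    refine ⟨(addMultiples Λ m, addMultiples Λ n), ⟨⟨hα.index_addMultiples hmn h, _, hα.addMultiples m, ?_⟩,
      ⟨hα.index_addMultiples hmn.symm (by rw [h, mul_comm]), _, hα.addMultiples n, ?_⟩⟩, ?_⟩
    · rw [corankOfCotype_le_iff]
      intro i hi
      rw [hα' i hi, Nat.gcd_one_left]
    · rw [corankOfCotype_le_iff]
      intro i hi
      rw [hα' i hi, Nat.gcd_one_left]
    · ext x
      rw [LieSubalgebra.mem_inf, mem_addMultiples, mem_addMultiples]
      constructor
      · rintro ⟨⟨a, ha, y, hx⟩, ⟨a', ha', y', hx'⟩⟩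
        have e1 : (n : ℤ) • x ∈ Λ := by
          rw [hx, smul_add, smul_smul, mul_comm]
          refine Λ.add_mem (Λ.smul_mem _ ha) ?_
          have := smul_mem_of_index h y
          rwa [Nat.cast_mul] at this
        have e2 : (m : ℤ) • x ∈ Λ := by
          rw [hx', smul_add, smul_smul]
          refine Λ.add_mem (Λ.smul_mem _ ha') ?_
          have := smul_mem_of_index h y'
          rwa [Nat.cast_mul] at this
        have e3 : x = m.gcdA n • ((m : ℤ) • x) + m.gcdB n • ((n : ℤ) • x) := by
          rw [smul_smul, smul_smul, ← add_smul, mul_comm, mul_comm _ (n : ℤ), ← hbez, one_smul]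
        rw [e3]
        exact Λ.add_mem (Λ.smul_mem _ e2) (Λ.smul_mem _ e1)
      · intro hx
        exact ⟨⟨x, hx, 0, by simp⟩, ⟨x, hx, 0, by simp⟩⟩

end Multiplicative

end

/-! ### Counting subalgebras of prime power index -/

section

open Matrix Finset

section PrimePower

variable {L : Type*} [LieRing L] (b : Module.Basis (Fin 3) ℤ L) {p : ℕ} (hp : p.Prime)

theorem hasCorankLE_iff (hL : Module.finrank ℤ L = 3) (Λ : LieSubalgebra ℤ L) (m : ℕ) :
    HasCorankLE Λ m ↔ ∃ α : Fin 3 → ℕ, IsCotype Λ α ∧ ∀ i : Fin 3, m ≤ i → α i = 1 := by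
  unfold HasCorankLE
  rw [hL]
  simp only [corankOfCotype_le_iff]

theorem HasCorankLE.mono {Λ : LieSubalgebra ℤ L} {m n : ℕ} (h : HasCorankLE Λ m) (hmn : m ≤ n) :
    HasCorankLE Λ n := by
  obtain ⟨α, hα, h⟩ := h
  exact ⟨α, hα, h.trans hmn⟩

theorem hasCorankLE_one_iff (Λ : LieSubalgebra ℤ L) {n : ℕ} (hn : n ≠ 0) :
    Λ.toSubmodule.toAddSubgroup.index = n ∧ HasCorankLE Λ 1 ↔
      ∃ f : Fin 3 → ZMod n, IsUnimodular f ∧ Λ.toSubmodule = modKer b f := by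
  have : NeZero n := ⟨hn⟩
  rw [hasCorankLE_iff (Module.finrank_eq_card_basis b |>.trans (Fintype.card_fin 3))]
  constructor
  · rintro ⟨hind, α, hα, h1⟩
    have h2 := hα.index_eq
    rw [Fin.prod_univ_three, h1 1 (by decide), h1 2 (by decide), mul_one, mul_one, hind] at h2
    subst h2
    obtain ⟨_, _, φ, hφ, hk⟩ := isCotype_iff.mp hα
    let ψ : L →ₗ[ℤ] ZMod (α 0) := ((Pi.evalAddMonoidHom _ 0).comp φ).toIntLinearMap
    have hψ : b.constr ℤ (fun i => ψ (b i)) = ψ := b.constr_self ℤ ψ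
    refine ⟨fun i => ψ (b i), ?_, ?_⟩
    · rw [isUnimodular_iff_surjective b, hψ]
      exact (Function.surjective_eval 0).comp hφ
    · ext x
      rw [mem_modKer, hψ]
      refine (hk x).symm.trans ⟨fun h => congrFun h 0, fun h => ?_⟩
      have hs : ∀ i : Fin 3, 1 ≤ (i : ℕ) → Subsingleton (ZMod (α i)) := fun i hi => by
        rw [h1 i hi]; infer_instance
      funext i
      by_cases hi : i = 0
      · subst hi; exact h
      · exact (hs i (by omega)).elim _ _
  · rintro ⟨f, hf, hΛ⟩
    refine ⟨hΛ ▸ index_modKer b hf, ![n, 1, 1], ⟨?_, ?_, ?_⟩, ?_⟩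
    · simp [Fin.forall_fin_succ, Nat.pos_of_ne_zero hn]
    · simp [Fin.forall_fin_succ]
    · rw [hΛ]
      let ev : ((i : Fin 3) → ZMod (![n, 1, 1] i)) →+ ZMod n := Pi.evalAddMonoidHom _ 0
      have hev : Function.Bijective ev := by
        constructor
        · intro g g' h
          funext i
          match i with
          | 0 => exact h
          | 1 => exact Subsingleton.elim (α := ZMod 1) _ _
          | 2 => exact Subsingleton.elim (α := ZMod 1) _ _
        · exact Function.surjective_eval (0 : Fin 3)
      exact ⟨(((b.constr ℤ f).quotKerEquivOfSurjective
        ((isUnimodular_iff_surjective b).mp hf)).toAddEquiv).trans (AddEquiv.ofBijective ev hev).symm⟩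
    · simp [Fin.forall_fin_succ]

/-- The underlying submodules of the subalgebras of index `n` and corank at most `m`. -/
def subalgebraSet (L : Type*) [LieRing L] (m n : ℕ) : Set (Submodule ℤ L) :=
  LieSubalgebra.toSubmodule '' {Λ : LieSubalgebra ℤ L |
    Λ.toSubmodule.toAddSubgroup.index = n ∧ HasCorankLE Λ m}

theorem ncard_subalgebraSet (m n : ℕ) : (subalgebraSet L m n).ncard = subalgebraCount L m n :=
  Set.ncard_image_of_injective _ (LieSubalgebra.toSubmodule_injective)

theorem subalgebraSet_mono {m m' : ℕ} (h : m ≤ m') (n : ℕ) :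
    subalgebraSet L m n ⊆ subalgebraSet L m' n :=
  Set.image_mono fun _ hΛ => ⟨hΛ.1, hΛ.2.mono h⟩

include hp in
theorem subalgebraSet_one (n : ℕ) : subalgebraSet L 1 (p ^ n) = conicKernels b p n 0 := by
  have hn : p ^ n ≠ 0 := pow_ne_zero _ hp.ne_zero
  ext K
  constructor
  · rintro ⟨Λ, hΛ, rfl⟩
    obtain ⟨f, hf, h⟩ := (hasCorankLE_one_iff b Λ hn).mp hΛ
    refine ⟨f, hf, ?_, h⟩
    rw [pow_zero, one_mul, ← modKer_closed_iff b hf, ← h]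
    exact fun x hx y hy => Λ.lie_mem hx hy
  · rintro ⟨f, hf, hQ, rfl⟩
    rw [pow_zero, one_mul, ← modKer_closed_iff b hf] at hQ
    exact ⟨{ modKer b f with lie_mem' := fun {x y} hx hy => hQ x hx y hy },
      (hasCorankLE_one_iff b _ hn).mpr ⟨f, hf, rfl⟩, rfl⟩

/-- The types of the subalgebras of index `p ^ n` which do not have a cyclic quotient. -/
def noncyclicTypes (n : ℕ) : Finset (ℕ × ℕ) :=
  (range (n + 1) ×ˢ range (n + 1)).filter fun x => x ≠ 0 ∧ 2 * x.1 + 3 * x.2 ≤ n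

include hp in
theorem subalgebraSet_subset (m n : ℕ) : subalgebraSet L m (p ^ n) ⊆ conicKernels b p n 0 ∪
    ⋃ x ∈ noncyclicTypes n, smithClass b p (n - (2 * x.1 + 3 * x.2)) x.1 x.2 := by
  rintro _ ⟨Λ, ⟨hΛ, _⟩, rfl⟩
  obtain ⟨a, d, c, hn, h1, h2⟩ := exists_mem_smithClass b hp Λ hΛ
  by_cases h0 : ((d, c) : ℕ × ℕ) = 0
  · rw [Prod.mk_eq_zero] at h0
    exact Or.inl (h2 h0.1 h0.2)
  · refine Or.inr (Set.mem_biUnion (x := (d, c)) ?_ ?_)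
    · simp only [noncyclicTypes, coe_filter, mem_product, mem_range, Set.mem_ofPred_eq]
      exact ⟨⟨by omega, by omega⟩, h0, by omega⟩
    · rwa [show n - (2 * (d, c).1 + 3 * (d, c).2) = a by simp only; omega]

include hp in
theorem ncard_conicKernels_le_subalgebraCount {m : ℕ} (hm : 1 ≤ m) (n : ℕ) :
    (conicKernels b p n 0).ncard ≤ subalgebraCount L m (p ^ n) := by
  rw [← ncard_subalgebraSet, ← subalgebraSet_one b hp]
  refine Set.ncard_le_ncard (subalgebraSet_mono hm _) ?_
  refine Set.Finite.subset ?_ (subalgebraSet_subset b hp m n)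
  exact (finite_conicKernels b hp n 0).union
    ((noncyclicTypes n).finite_toSet.biUnion fun x _ => (smithClass_finite_and_ncard_le b hp _ _ _).1)

include hp in
theorem subalgebraCount_le (m n : ℕ) :
    subalgebraCount L m (p ^ n) ≤ (conicKernels b p n 0).ncard +
      ∑ x ∈ noncyclicTypes n,
        (conicKernels b p (n - (2 * x.1 + 3 * x.2)) x.2).ncard * (2 * p ^ (2 * x.1)) := by
  rw [← ncard_subalgebraSet]
  refine (Set.ncard_le_ncard (subalgebraSet_subset b hp m n) ?_).trans ?_
  · exact (finite_conicKernels b hp n 0).union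
      ((noncyclicTypes n).finite_toSet.biUnion fun x _ => (smithClass_finite_and_ncard_le b hp _ _ _).1)
  · refine (Set.ncard_union_le _ _).trans (Nat.add_le_add_left ?_ _)
    refine (Finset.set_ncard_biUnion_le _ _).trans (Finset.sum_le_sum fun x _ => ?_)
    exact (smithClass_finite_and_ncard_le b hp _ _ _).2

theorem noncyclicTypes_one : noncyclicTypes 1 = ∅ := by decide

theorem noncyclicTypes_two : noncyclicTypes 2 = {(1, 0)} := by decide

include hp in
theorem ncard_conicKernels_zero (c : ℕ) : (conicKernels b p 0 c).ncard ≤ 1 := by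
  have h := ncard_conicKernels_mul_totient b hp 0 c
  rw [pow_zero, Nat.totient_one, mul_one] at h
  rw [h]
  exact (Finite.card_le_one_iff_subsingleton).mpr ⟨fun x y => Subtype.ext (funext fun i =>
    Subsingleton.elim (α := ZMod 1) _ _)⟩

-- An index `p` quotient is cyclic, so every `m ≥ 1` yields the same count: the upper and lower
-- bounds coincide.
include hp in
theorem subalgebraCount_prime {m : ℕ} (hm : 1 ≤ m) :
    subalgebraCount L m p = (conicKernels b p 1 0).ncard := by
  have h1 := subalgebraCount_le b hp m 1
  have h2 := ncard_conicKernels_le_subalgebraCount b hp hm 1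
  rw [noncyclicTypes_one, Finset.sum_empty, add_zero, pow_one] at h1
  rw [pow_one] at h2
  exact le_antisymm h1 h2

-- The only noncyclic type has `d = 1`, `a = c = 0`. Its contribution `2 p ^ 2` is below the order
-- `p ^ 3` that matters at a pole at 2.
include hp in
theorem subalgebraCount_prime_sq_le (m : ℕ) :
    subalgebraCount L m (p ^ 2) ≤ (conicKernels b p 2 0).ncard + 2 * p ^ 2 := by
  refine (subalgebraCount_le b hp m 2).trans (Nat.add_le_add_left ?_ _)
  rw [noncyclicTypes_two, Finset.sum_singleton]
  exact (Nat.mul_le_mul_right _ (ncard_conicKernels_zero b hp 0)).trans (by simp)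

theorem card_noncyclicTypes_add_one_le (n : ℕ) : #(noncyclicTypes n) + 1 ≤ (n + 1) ^ 2 := by
  have h : noncyclicTypes n ⊆ (range (n + 1) ×ˢ range (n + 1)).erase 0 := fun x hx => by
    simp only [noncyclicTypes, mem_filter] at hx
    exact mem_erase.mpr ⟨hx.2.1, hx.1⟩
  have h2 := Finset.card_le_card h
  rw [card_erase_of_mem (by simp), card_product, card_range] at h2
  have : 1 ≤ (n + 1) * (n + 1) := Nat.mul_pos n.succ_pos n.succ_pos
  rw [sq]; omega

include hp in
/-- A bound for the conic kernels implies one for all subalgebras. -/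
theorem subalgebraCount_le_of_conicKernels {A r : ℝ} (hA : 0 ≤ A) (hr : 1 ≤ r)
    (h : ∀ a c, ((conicKernels b p a c).ncard : ℝ) ≤ A * (p : ℝ) ^ (r * a + c / 2)) (m n : ℕ) :
    (subalgebraCount L m (p ^ n) : ℝ) ≤ 2 * A * (n + 1) ^ 2 * (p : ℝ) ^ (r * n) := by
  have hp1 : (1 : ℝ) ≤ p := by exact_mod_cast hp.one_lt.le
  have hterm : ∀ x ∈ noncyclicTypes n,
      (((conicKernels b p (n - (2 * x.1 + 3 * x.2)) x.2).ncard * (2 * p ^ (2 * x.1)) : ℕ) : ℝ) ≤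
        2 * A * (p : ℝ) ^ (r * n) := by
    intro x hx
    simp only [noncyclicTypes, mem_filter] at hx
    push_cast
    have hx2 : ((n - (2 * x.1 + 3 * x.2) : ℕ) : ℝ) = n - (2 * x.1 + 3 * x.2) := by
      rw [Nat.cast_sub hx.2.2]; push_cast; rfl
    calc _ ≤ (A * (p : ℝ) ^ (r * ((n - (2 * x.1 + 3 * x.2) : ℕ) : ℝ) + x.2 / 2)) *
          (2 * (p : ℝ) ^ (2 * x.1)) := mul_le_mul_of_nonneg_right (h _ _) (by positivity)
      _ = 2 * A * (p : ℝ) ^ (r * (n - (2 * x.1 + 3 * x.2)) + x.2 / 2 + 2 * x.1) := by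
          rw [Real.rpow_add (by linarith) _ (2 * (x.1 : ℝ)), hx2]
          have : (p : ℝ) ^ (2 * (x.1 : ℝ)) = (p : ℝ) ^ (2 * x.1) := by
            rw [← Real.rpow_natCast]; push_cast; rfl
          rw [this]; ring
      -- The exponent comparison amounts to `2 d (1 - r) + c (1/2 - 3 r) ≤ 0`, which holds since `r
      -- ≥ 1`.
      _ ≤ _ := by
          refine mul_le_mul_of_nonneg_left (Real.rpow_le_rpow_of_exponent_le hp1 ?_) (by positivity)
          have h1 : (0 : ℝ) ≤ x.1 := Nat.cast_nonneg _
          have h2 : (0 : ℝ) ≤ x.2 := Nat.cast_nonneg _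
          nlinarith
  have h0 : ((conicKernels b p n 0).ncard : ℝ) ≤ 2 * A * (p : ℝ) ^ (r * n) := by
    refine (h n 0).trans ?_
    have : (0 : ℝ) ≤ A * (p : ℝ) ^ (r * n) := by positivity
    simp only [CharP.cast_eq_zero, zero_div, add_zero]
    linarith
  have hcard : ((#(noncyclicTypes n) : ℕ) : ℝ) + 1 ≤ ((n : ℝ) + 1) ^ 2 := by
    exact_mod_cast card_noncyclicTypes_add_one_le n
  calc (subalgebraCount L m (p ^ n) : ℝ) ≤ _ := Nat.cast_le.mpr (subalgebraCount_le b hp m n)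
    _ ≤ 2 * A * (p : ℝ) ^ (r * n) + #(noncyclicTypes n) • (2 * A * (p : ℝ) ^ (r * n)) := by
        rw [Nat.cast_add, Nat.cast_sum]
        exact add_le_add h0 (Finset.sum_le_card_nsmul _ _ _ hterm)
    _ = (#(noncyclicTypes n) + 1) * (2 * A * (p : ℝ) ^ (r * n)) := by
        rw [nsmul_eq_mul]; ring
    _ ≤ ((n : ℝ) + 1) ^ 2 * (2 * A * (p : ℝ) ^ (r * n)) :=
        mul_le_mul_of_nonneg_right hcard (by positivity)
    _ = _ := by ring

end PrimePower

end

/-! ### The pole according to the rank of the form -/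

section

open Matrix Finset

/-- A bound valid for all large primes is valid for all primes with a larger constant. -/
theorem exists_bound_of_eventually {x y : ℕ → ℝ} {C : ℝ} (D : ℕ) (hC : 0 ≤ C)
    (hx : ∀ p, 0 ≤ x p) (hy : ∀ p : ℕ, p.Prime → 1 ≤ y p)
    (h : ∀ p : ℕ, p.Prime → D < p → x p ≤ C * y p) :
    ∃ C', C ≤ C' ∧ ∀ p : ℕ, p.Prime → x p ≤ C' * y p := by
  have h0 : 0 ≤ ∑ q ∈ range (D + 1), x q := Finset.sum_nonneg fun q _ => hx q
  refine ⟨C + ∑ q ∈ range (D + 1), x q, by linarith, fun p hp => ?_⟩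
  have hy0 := hy p hp
  rw [add_mul]
  rcases lt_or_ge D p with hD | hD
  · have := h p hp hD
    have : 0 ≤ (∑ q ∈ range (D + 1), x q) * y p := mul_nonneg h0 (by linarith)
    linarith
  · have h1 : x p ≤ ∑ q ∈ range (D + 1), x q :=
      Finset.single_le_sum (f := x) (fun q _ => hx q) (mem_range.mpr (by omega))
    have : 0 ≤ C * y p := mul_nonneg hC (by linarith)
    nlinarith

/-- Finitely many primes are absorbed into the constants for `n = 1, 2`; the growth bound for all
`n` is still required at every prime, since it makes each local factor converge left of the pole. -/
theorem hasLargestPole_of_eventually_bounds {c : ℕ → ℕ} (h1 : c 1 = 1)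
    (hmul : ∀ m n : ℕ, m.Coprime n → c (m * n) = c m * c n)
    {α : ℕ → ℂ} {GA GB : ℂ → ℂ} {kA kB : ℕ} {β : ℂ} (hA : IsEulerModel α GA kA)
    (hB : IsEulerModel (fun _ => β) GB kB) {d : ℕ} (hd : 1 ≤ d) {C : ℝ} (D : ℕ)
    (ha : ∀ p : ℕ, p.Prime → D < p →
      ‖(c p : ℂ) - (1 + α p) * (p : ℂ) ^ d‖ ≤ C * (p : ℝ) ^ ((d : ℝ) - 1 / 4))
    (hb : ∀ p : ℕ, p.Prime → D < p →
      ‖(c (p ^ 2) : ℂ) - β * (p : ℂ) ^ (2 * d + 1)‖ ≤ C * (p : ℝ) ^ (2 * (d : ℝ) + 3 / 4))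
    (hc : ∀ p : ℕ, p.Prime → ∀ n : ℕ,
      (c (p ^ n) : ℝ) ≤ C * (n + 1) ^ 2 * (p : ℝ) ^ (((d : ℝ) + 1 / 2) * n)) :
    HasLargestPole (fun n => (c n : ℂ)) ((d + 1 : ℕ) : ℝ) (1 + kA + kB) := by
  have hC : 0 ≤ C := by
    have := (Nat.cast_nonneg _).trans (hc 2 Nat.prime_two 0)
    simpa using this
  have hd' : (1 : ℝ) ≤ d := by exact_mod_cast hd
  obtain ⟨C₁, hC₁, h₁⟩ := exists_bound_of_eventually D hC (fun p => norm_nonneg _)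
    (fun p hp => Real.one_le_rpow (by exact_mod_cast hp.one_lt.le) (by linarith)) ha
  obtain ⟨C₂, hC₂, h₂⟩ := exists_bound_of_eventually D hC (fun p => norm_nonneg _)
    (fun p hp => Real.one_le_rpow (by exact_mod_cast hp.one_lt.le) (by linarith)) hb
  refine hasLargestPole_of_bounds h1 hmul hA hB d (C := max C₁ C₂) (fun p hp => ?_) (fun p hp => ?_)
    (fun p hp n => ?_)
  · exact (h₁ p hp).trans (mul_le_mul_of_nonneg_right (le_max_left _ _) (by positivity))
  · exact (h₂ p hp).trans (mul_le_mul_of_nonneg_right (le_max_right _ _) (by positivity))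
  · refine (hc p hp n).trans ?_
    gcongr
    exact hC₁.trans (le_max_left _ _)

section Cases

variable {L : Type*} [LieRing L] (b : Module.Basis (Fin 3) ℤ L)

theorem ncard_conicKernels_mul_totient_eq {p : ℕ} (hp : p.Prime) (n : ℕ) :
    (conicKernels b p n 0).ncard * (p ^ n).totient =
      unimodularZeroCount (bracketMatrix b) (p ^ n) := by
  rw [ncard_conicKernels_mul_totient b hp, unimodularZeroCount]
  simp only [pow_zero, one_mul]

theorem ncard_conicKernels_one_mul {p : ℕ} (hp : p.Prime) :
    (conicKernels b p 1 0).ncard * (p - 1) = unimodularZeroCount (bracketMatrix b) p := by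
  have := ncard_conicKernels_mul_totient_eq b hp 1
  rwa [pow_one, Nat.totient_prime hp] at this

theorem ncard_conicKernels_two_mul {p : ℕ} (hp : p.Prime) :
    (conicKernels b p 2 0).ncard * (p * (p - 1)) = unimodularZeroCount (bracketMatrix b) (p ^ 2) := by
  have := ncard_conicKernels_mul_totient_eq b hp 2
  rwa [Nat.totient_prime_pow_succ hp 1, pow_one] at this

/-- The case of a vanishing bracket form: every sublattice with cyclic quotient is a subalgebra. -/
theorem hasLargestPole_of_form_eq_zero (h : ∀ v : Fin 3 → ℤ, quadEval (bracketMatrix b) v = 0)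
    {m : ℕ} (hm : 1 ≤ m) : HasLargestPole (corankZetaCoeff L m) ((2 + 1 : ℕ) : ℝ) (1 + 0 + 0) := by
  have hQ : ∀ (n : ℕ) (f : Fin 3 → ZMod n), quadEval (bracketMatrix b) f = 0 := fun n f => by
    choose v hv using fun i => ZMod.intCast_surjective (f i)
    have := quadEval_intCast (bracketMatrix b) (ZMod n) v
    rw [h, Int.cast_zero] at this
    rwa [← funext hv]
  have hc : ∀ p : ℕ, p.Prime → ∀ n : ℕ,
      (subalgebraCount L m (p ^ n) : ℝ) ≤ 4 * (n + 1) ^ 2 * (p : ℝ) ^ ((2 : ℝ) * n) := by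
    intro p hp n
    have hp1 : (1 : ℝ) ≤ p := by exact_mod_cast hp.one_lt.le
    have := subalgebraCount_le_of_conicKernels b hp (A := 2) (r := 2) (by norm_num) (by norm_num)
      (fun a c => ?_) m n
    · convert this using 3; norm_num
    · have : NeZero (p ^ a) := ⟨pow_ne_zero _ hp.ne_zero⟩
      have h1 := ncard_conicKernels_le b hp a c
      have h2 : #{f : Fin 3 → ZMod (p ^ a) | (p : ZMod (p ^ a)) ^ c * quadEval (bracketMatrix b) f = 0} ≤
          (p ^ a) ^ 3 := (Finset.card_le_univ _).trans (by simp [ZMod.card])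
      have h3 : (conicKernels b p a c).ncard ≤ 2 * p ^ (2 * a) := by
        refine Nat.le_of_mul_le_mul_right (h1.trans ((Nat.mul_le_mul_left 2 h2).trans ?_))
          (pow_pos hp.pos a)
        exact le_of_eq (by ring)
      calc ((conicKernels b p a c).ncard : ℝ) ≤ 2 * (p : ℝ) ^ (2 * a) := by exact_mod_cast h3
        _ = 2 * (p : ℝ) ^ ((2 : ℝ) * a) := by rw [← Real.rpow_natCast]; push_cast; rfl
        _ ≤ _ := by
          gcongr
          have : (0 : ℝ) ≤ c := Nat.cast_nonneg c
          linarith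
  -- The constant is `4 * (2 + 1) ^ 2`, from the growth bound at `n = 2`.
  refine hasLargestPole_of_eventually_bounds (C := 36) (β := 0) (subalgebraCount_one m)
    (fun _ _ => subalgebraCount_mul m) isEulerModel_one isEulerModel_one (d := 2) (by norm_num) 0
    (fun p hp _ => ?_) (fun p hp _ => ?_) (fun p hp n => ?_)
  · have hp1 : (1 : ℝ) ≤ p := by exact_mod_cast hp.one_lt.le
    have : Fact p.Prime := ⟨hp⟩
    have h1 := unimodularZeroCount_prime (bracketMatrix b) (p := p)
    rw [← ncard_conicKernels_one_mul b hp, ← subalgebraCount_prime b hp hm,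
      Finset.filter_true_of_mem fun f _ => hQ p f] at h1
    simp only [card_univ, Fintype.card_fun, ZMod.card, Fintype.card_fin] at h1
    obtain ⟨q, rfl⟩ := Nat.exists_eq_add_of_le' hp.one_lt.le
    have h2 : subalgebraCount L m (q + 1) = (q + 1) ^ 2 + (q + 1) + 1 := by
      have hq : 0 < q := by have := hp.one_lt; omega
      refine Nat.eq_of_mul_eq_mul_right hq ?_
      rw [Nat.add_sub_cancel] at h1
      nlinarith
    rw [h2]
    have h3 : ((((q + 1) ^ 2 + (q + 1) + 1 : ℕ) : ℂ) - (1 + 0) * ((q + 1 : ℕ) : ℂ) ^ 2) =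
        ((q + 1 + 1 : ℕ) : ℂ) := by push_cast; ring
    rw [h3, Complex.norm_natCast]
    calc ((q + 1 + 1 : ℕ) : ℝ) ≤ 36 * ((q + 1 : ℕ) : ℝ) ^ (1 : ℝ) := by
          rw [Real.rpow_one]; push_cast at hp1 ⊢; linarith
      _ ≤ _ := by gcongr; norm_num
  · have hp1 : (1 : ℝ) ≤ p := by exact_mod_cast hp.one_lt.le
    rw [zero_mul, sub_zero, Complex.norm_natCast]
    calc _ ≤ 4 * (((2 : ℕ) : ℝ) + 1) ^ 2 * (p : ℝ) ^ ((2 : ℝ) * (2 : ℕ)) := hc p hp 2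
      _ = 36 * (p : ℝ) ^ ((2 : ℝ) * (2 : ℕ)) := by norm_num
      _ ≤ _ := by gcongr; norm_num
  · have hp1 : (1 : ℝ) ≤ p := by exact_mod_cast hp.one_lt.le
    refine (hc p hp n).trans ?_
    gcongr
    · norm_num
    · norm_num

/-- The line-by-line zero count, divided by the units, gives `O(p ^ (3 a / 2 + c / 2))` kernels. The
exponent `3/2` per step lies below the pole at 2, so the terms with `n ≥ 3` cannot affect it. -/
theorem subalgebraCount_prime_pow_le_of_form_ne_zero {v : Fin 3 → ℤ}
    (hv : quadEval (bracketMatrix b) v ≠ 0) {p : ℕ} (hp : p.Prime) (m n : ℕ) :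
    (subalgebraCount L m (p ^ n) : ℝ) ≤ 8 * (quadEval (bracketMatrix b) v).natAbs * (n + 1) ^ 2 *
      (p : ℝ) ^ ((3 / 2 : ℝ) * n) := by
  have hp0 : (0 : ℝ) < p := by exact_mod_cast hp.pos
  set u : ℝ := ((quadEval (bracketMatrix b) v).natAbs : ℝ) with hu
  have := subalgebraCount_le_of_conicKernels b hp (A := 4 * u) (r := 3 / 2)
    (by positivity) (by norm_num) (fun a c => ?_) m n
  · convert this using 3; ring
  · have : NeZero (p ^ a) := ⟨pow_ne_zero _ hp.ne_zero⟩
    have h1 : ((conicKernels b p a c).ncard : ℝ) * (p : ℝ) ^ a ≤ 2 * (#{f : Fin 3 → ZMod (p ^ a) |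
        (p : ZMod (p ^ a)) ^ c * quadEval (bracketMatrix b) f = 0} : ℝ) := by
      exact_mod_cast ncard_conicKernels_le b hp a c
    have h2 := card_quadEval_zeros_le (bracketMatrix b) hv hp a c
    rw [← hu] at h2
    refine le_of_mul_le_mul_right ((h1.trans (mul_le_mul_of_nonneg_left h2 zero_le_two)).trans
      (le_of_eq ?_)) (pow_pos hp0 a)
    have e1 : (p : ℝ) ^ ((3 / 2 : ℝ) * a + c / 2) = (p : ℝ) ^ (((a : ℝ) + c) / 2) * (p : ℝ) ^ a := by
      rw [← Real.rpow_natCast, ← Real.rpow_add hp0]; congr 1; ring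
    rw [e1]; ring

/-- The general shape of the pole when the bracket form does not vanish. -/
theorem hasLargestPole_of_form_ne_zero {v : Fin 3 → ℤ} (hv : quadEval (bracketMatrix b) v ≠ 0)
    {α : ℕ → ℂ} {GA GB : ℂ → ℂ} {kA kB : ℕ} {β : ℂ} (hA : IsEulerModel α GA kA)
    (hB : IsEulerModel (fun _ => β) GB kB) {C : ℝ} (D : ℕ)
    (ha : ∀ p : ℕ, p.Prime → D < p → ((conicKernels b p 1 0).ncard : ℂ) = p + 1 + p * α p)
    (hb : ∀ p : ℕ, p.Prime → D < p →
      ‖((conicKernels b p 2 0).ncard : ℂ) - β * (p : ℂ) ^ 3‖ ≤ C * (p : ℝ) ^ 2) {m : ℕ} (hm : 1 ≤ m) :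
    HasLargestPole (corankZetaCoeff L m) ((1 + 1 : ℕ) : ℝ) (1 + kA + kB) := by
  set u : ℝ := ((quadEval (bracketMatrix b) v).natAbs : ℝ) with hu
  have hu1 : 1 ≤ u := by
    have := Int.natAbs_pos.mpr hv
    rw [hu]; exact_mod_cast this
  refine hasLargestPole_of_eventually_bounds (C := 8 * u + (|C| + 2)) (subalgebraCount_one m)
    (fun _ _ => subalgebraCount_mul m) hA hB le_rfl D
    (fun p hp hD => ?_) (fun p hp hD => ?_) (fun p hp n => ?_)
  · have hp1 : (1 : ℝ) ≤ p := by exact_mod_cast hp.one_lt.le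
    rw [subalgebraCount_prime b hp hm, ha p hp hD]
    have h1 : (p : ℂ) + 1 + p * α p - (1 + α p) * (p : ℂ) ^ 1 = 1 := by ring
    rw [h1, norm_one]
    have h2 : 1 ≤ (p : ℝ) ^ (((1 : ℕ) : ℝ) - 1 / 4) := Real.one_le_rpow hp1 (by norm_num)
    have h3 : 1 ≤ 8 * u + (|C| + 2) := by have := abs_nonneg C; linarith
    nlinarith
  · have hp1 : (1 : ℝ) ≤ p := by exact_mod_cast hp.one_lt.le
    have h1 : ((conicKernels b p 2 0).ncard : ℝ) ≤ subalgebraCount L m (p ^ 2) := by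
      exact_mod_cast ncard_conicKernels_le_subalgebraCount b hp hm 2
    have h2 : (subalgebraCount L m (p ^ 2) : ℝ) ≤ (conicKernels b p 2 0).ncard + 2 * (p : ℝ) ^ 2 := by
      exact_mod_cast subalgebraCount_prime_sq_le b hp m
    have h3 : ‖(subalgebraCount L m (p ^ 2) : ℂ) - (conicKernels b p 2 0).ncard‖ ≤ 2 * (p : ℝ) ^ 2 := by
      rw [← Complex.ofReal_natCast, ← Complex.ofReal_natCast, ← Complex.ofReal_sub,
        Complex.norm_real, Real.norm_eq_abs, abs_le]
      constructor <;> nlinarith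
    calc _ = ‖((subalgebraCount L m (p ^ 2) : ℂ) - (conicKernels b p 2 0).ncard) +
          (((conicKernels b p 2 0).ncard : ℂ) - β * (p : ℂ) ^ 3)‖ := by congr 1; ring
      _ ≤ 2 * (p : ℝ) ^ 2 + C * (p : ℝ) ^ 2 := norm_add_le_of_le h3 (hb p hp hD)
      _ = (C + 2) * (p : ℝ) ^ ((2 : ℕ) : ℝ) := by rw [Real.rpow_natCast]; ring
      _ ≤ _ := by
          have := le_abs_self C
          exact mul_le_mul (by linarith) (Real.rpow_le_rpow_of_exponent_le hp1 (by norm_num))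
            (by positivity) (by positivity)
  · refine (subalgebraCount_prime_pow_le_of_form_ne_zero b hv hp m n).trans ?_
    rw [← hu, show ((1 : ℕ) : ℝ) + 1 / 2 = 3 / 2 by norm_num]
    gcongr
    have := abs_nonneg C; linarith

theorem exists_largestPole_of_form_ne_zero {v : Fin 3 → ℤ} (hv : quadEval (bracketMatrix b) v ≠ 0) :
    ∃ k : ℕ, ∀ m : ℕ, 1 ≤ m → HasLargestPole (corankZetaCoeff L m) ((1 + 1 : ℕ) : ℝ) k := by
  set M := bracketMatrix b with hM
  obtain ⟨T, hT, hN, hord⟩ := exists_diagonalization M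
  set N := Tᵀ * M * T with hNdef
  have h00 : N 0 0 ≠ 0 := by
    intro h0
    have hz : ∀ i, N i i = 0 := fun i => by
      by_contra hi
      exact hord 0 i (Fin.zero_le _) hi h0
    -- If the first diagonal entry vanished, so would all of them; evaluating at `adj(T) v` would
    -- then give `det(T) ^ 2 Q(v) = 0`.
    have h1 := quadEval_mulVec M T (R := ℤ) (T.adjugate *ᵥ v)
    rw [← hNdef, quadEval_diag hN, mulVec_mulVec] at h1
    have h2 : T.map (Int.cast : ℤ → ℤ) = T := by ext i j; simp
    rw [h2, mul_adjugate, smul_mulVec, one_mulVec, quadEval_smul] at h1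
    simp only [hz, Int.cast_zero, zero_mul, Finset.sum_const_zero, mul_eq_zero,
      pow_eq_zero_iff two_ne_zero, hT, false_or] at h1
    exact hv h1
  -- Primes above `|E|` are odd, keep `T` invertible and divide no nonzero diagonal entry, so the
  -- rank modulo `p` is the rational rank.
  set E : ℤ := 2 * T.det * N 0 0 * (if N 1 1 = 0 then 1 else N 1 1) *
    (if N 2 2 = 0 then 1 else N 2 2) with hE
  have hE0 : E ≠ 0 := by
    rw [hE]
    refine mul_ne_zero (mul_ne_zero (mul_ne_zero (mul_ne_zero two_ne_zero hT) h00) ?_) ?_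
    · split_ifs with h <;> simp [h]
    · split_ifs with h <;> simp [h]
  have hgood : ∀ p : ℕ, E.natAbs < p → ¬ (p : ℤ) ∣ E := fun p hp h => by
    have := Nat.le_of_dvd (Int.natAbs_pos.mpr hE0) (Int.natCast_dvd.mp h)
    omega
  have good2 : ∀ p : ℕ, p.Prime → E.natAbs < p → p ≠ 2 := fun p _ hD h => hgood p hD (by
    subst h; rw [hE]; exact ⟨T.det * N 0 0 * (if N 1 1 = 0 then 1 else N 1 1) *
      (if N 2 2 = 0 then 1 else N 2 2), by push_cast; ring⟩)
  have goodT : ∀ p : ℕ, E.natAbs < p → ¬ (p : ℤ) ∣ T.det := fun p hD h => hgood p hD (by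
    rw [hE]; exact (((h.mul_left _).mul_right _).mul_right _).mul_right _)
  have good0 : ∀ p : ℕ, E.natAbs < p → ¬ (p : ℤ) ∣ N 0 0 := fun p hD h => hgood p hD (by
    rw [hE]; exact ((h.mul_left _).mul_right _).mul_right _)
  have good1 : ∀ p : ℕ, E.natAbs < p → N 1 1 ≠ 0 → ¬ (p : ℤ) ∣ N 1 1 := fun p hD h1 h => hgood p hD (by
    rw [hE, if_neg h1]; exact (h.mul_left _).mul_right _)
  have good22 : ∀ p : ℕ, E.natAbs < p → N 2 2 ≠ 0 → ¬ (p : ℤ) ∣ N 2 2 := fun p hD h1 h => hgood p hD (by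
    rw [hE, if_neg h1]; exact h.mul_left _)
  have h12 : N 1 1 = 0 → N 2 2 = 0 := fun h => by
    by_contra h2; exact hord 1 2 (by decide) h2 h
  have hprime : ∀ p : ℕ, p.Prime → E.natAbs < p → ((conicKernels b p 1 0).ncard : ℂ) = p + 1 + p *
      (((if N 1 1 ≠ 0 ∧ N 2 2 = 0 then jacobiSym (-(N 0 0 * N 1 1)) p else 0 : ℤ)) : ℂ) := by
    intro p hp hD
    have : Fact p.Prime := ⟨hp⟩
    have h1 := unimodularZeroCount_diag_prime hN hp (good2 p hp hD) (good0 p hD)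
      (or_iff_not_imp_right.mpr fun h => good1 p hD fun h' => h ⟨h', h12 h'⟩)
      (or_iff_not_imp_right.mpr fun h => good22 p hD h)
    rw [hNdef, unimodularZeroCount_congr M T, ← hNdef, ← ncard_conicKernels_one_mul b hp,
      Nat.cast_mul, Nat.cast_sub hp.one_lt.le, Nat.cast_one, mul_comm] at h1
    · have h2 : ((p : ℤ) - 1) ≠ 0 := by have := hp.one_lt; omega
      have h3 := mul_left_cancel₀ h2 h1
      exact_mod_cast congrArg (Int.cast : ℤ → ℂ) h3
    · rw [isUnit_iff_ne_zero, Ne, ZMod.intCast_zmod_eq_zero_iff_dvd]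
      exact goodT p hD
  have hsq : ∀ p : ℕ, p.Prime → E.natAbs < p →
      (conicKernels b p 2 0).ncard * (p * (p - 1)) = unimodularZeroCount N (p ^ 2) := by
    intro p hp hD
    have : Fact p.Prime := ⟨hp⟩
    rw [ncard_conicKernels_two_mul b hp, hNdef, unimodularZeroCount_congr M T]
    exact isUnit_intCast_of_not_dvd (goodT p hD)
  by_cases h11 : N 1 1 = 0
  -- Rank 1: the second zeta factor enters through index `p ^ 2`.
  · refine ⟨1 + 0 + 1, fun m hm => hasLargestPole_of_form_ne_zero b hv isEulerModel_one
      isEulerModel_riemannZeta (C := 2) E.natAbs (fun p hp hD => ?_) (fun p hp hD => ?_) hm⟩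
    · rw [hprime p hp hD]; simp [h11]
    · have : Fact p.Prime := ⟨hp⟩
      obtain ⟨h1, h2⟩ := unimodularZeroCount_diag_prime_sq_rank_one hN (good0 p hD) h11 (h12 h11)
      rw [← hsq p hp hD] at h1 h2
      have hp2 : (2 : ℝ) ≤ p := by exact_mod_cast hp.two_le
      have h1' : ((conicKernels b p 2 0).ncard : ℝ) * (p * (p - 1)) ≤ (p : ℝ) ^ 5 := by
        have := (Nat.cast_le (α := ℝ)).mpr h1
        rwa [Nat.cast_mul, Nat.cast_mul, Nat.cast_sub hp.one_lt.le, Nat.cast_one, Nat.cast_pow] at this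
      have h2' : (p : ℝ) ^ 5 ≤ ((conicKernels b p 2 0).ncard : ℝ) * (p * (p - 1)) + (p : ℝ) ^ 3 := by
        have := (Nat.cast_le (α := ℝ)).mpr h2
        rwa [Nat.cast_add, Nat.cast_mul, Nat.cast_mul, Nat.cast_sub hp.one_lt.le, Nat.cast_one,
          Nat.cast_pow, Nat.cast_pow] at this
      have hpos : (0 : ℝ) < p * (p - 1) := by nlinarith
      have e1 : ((conicKernels b p 2 0).ncard : ℝ) ≤ (p : ℝ) ^ 3 + 2 * (p : ℝ) ^ 2 := by
        refine le_of_mul_le_mul_right (h1'.trans ?_) hpos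
        have : 0 ≤ (p : ℝ) ^ 3 * ((p : ℝ) - 2) := mul_nonneg (by positivity) (by linarith)
        nlinarith
      have e2 : (p : ℝ) ^ 3 ≤ ((conicKernels b p 2 0).ncard : ℝ) := by
        refine le_of_mul_le_mul_right (le_trans ?_ (sub_le_iff_le_add.mpr h2')) hpos
        have : 0 ≤ (p : ℝ) ^ 3 * ((p : ℝ) - 1) := mul_nonneg (by positivity) (by linarith)
        nlinarith
      rw [one_mul, ← Complex.ofReal_natCast, ← Complex.ofReal_natCast, ← Complex.ofReal_pow,
        ← Complex.ofReal_sub, Complex.norm_real, Real.norm_eq_abs, abs_le]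
      constructor <;> nlinarith
  · have hb : ∀ p : ℕ, p.Prime → E.natAbs < p →
        ‖((conicKernels b p 2 0).ncard : ℂ) - 0 * (p : ℂ) ^ 3‖ ≤ 8 * (p : ℝ) ^ 2 := by
      intro p hp hD
      have : Fact p.Prime := ⟨hp⟩
      have h1 := unimodularZeroCount_diag_prime_sq_le hN (good2 p hp hD) (good0 p hD) (good1 p hD h11)
      rw [← hsq p hp hD] at h1
      have h2 : (conicKernels b p 2 0).ncard ≤ 8 * p ^ 2 := by
        have hp2 := hp.two_le
        refine Nat.le_of_mul_le_mul_right (h1.trans ?_) (Nat.mul_pos hp.pos (by omega : 0 < p - 1))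
        calc 4 * p ^ 4 = 4 * p ^ 3 * p := by ring
          _ ≤ 4 * p ^ 3 * (2 * (p - 1)) := Nat.mul_le_mul_left _ (by omega)
          _ = _ := by ring
      rw [zero_mul, sub_zero, Complex.norm_natCast]
      exact_mod_cast h2
    by_cases h22 : N 2 2 = 0
    -- Rank 2: modulo `p` the form splits into two linear factors or not according to this Jacobi
    -- symbol, and the order is 2 or 1 as the character is trivial or not.
    · obtain ⟨α, G, kA, hA, hα⟩ := exists_isEulerModel_jacobiSym (-(N 0 0 * N 1 1))
        (neg_ne_zero.mpr (mul_ne_zero h00 h11))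
      refine ⟨1 + kA + 0, fun m hm => hasLargestPole_of_form_ne_zero b hv hA isEulerModel_one
        E.natAbs (fun p hp hD => ?_) hb hm⟩
      rw [hprime p hp hD, if_pos ⟨h11, h22⟩, hα p hp (good2 p hp hD)]
      rw [dvd_neg]
      intro h
      rcases (Nat.prime_iff_prime_int.mp hp).dvd_or_dvd h with h | h
      · exact good0 p hD h
      · exact good1 p hD h11 h
    -- Rank 3: a smooth conic has `p + 1` points, so only `ζ(s - 1)` contributes.
    · refine ⟨1 + 0 + 0, fun m hm => hasLargestPole_of_form_ne_zero b hv isEulerModel_one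
        isEulerModel_one E.natAbs (fun p hp hD => ?_) hb hm⟩
      rw [hprime p hp hD]; simp [h22]

end Cases

end


theorem mainTheorem6 (L : Type*) [LieRing L] [Module.Free ℤ L] [Module.Finite ℤ L]
    (hL : Module.finrank ℤ L = 3) :
    ∃ (σ : ℝ) (k : ℕ), ∀ m : ℕ, 1 ≤ m → m ≤ 3 →
      HasLargestPole (corankZetaCoeff L m) σ k := by
  have b : Module.Basis (Fin 3) ℤ L := Module.finBasisOfFinrankEq ℤ L hL
  by_cases h : ∀ v : Fin 3 → ℤ, quadEval (bracketMatrix b) v = 0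
  · exact ⟨_, _, fun m hm _ => hasLargestPole_of_form_eq_zero b h hm⟩
  · push Not at h
    obtain ⟨v, hv⟩ := h
    obtain ⟨k, hk⟩ := exists_largestPole_of_form_ne_zero b hv
    exact ⟨_, k, fun m hm _ => hk m hm⟩
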